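/- Work in the smooth category on $J^2(\mathbb R^2,\mathbb R)$ with coordinates $(x,y,z,p,q,r,s,t)$ and contact forms $\theta^1=dz-p\,dx-q\,dy$, $\theta^2=dp-r\,dx-s\,dy$, $\theta^3=dq-s\,dx-t\,dy$. Consider a scalar second order equation $F(x,y,z,z_x,z_y,z_{xx},z_{xy},z_{yy})=0$, where $F$ is smooth on an open subset of $J^2$, with a nondegenerate parametrization $i_F:\Sigma_7\to J^2$: $\Sigma_7\subset\mathbb R^7$ is open, $i_F$ is smooth of rank $7$, its image is the locus $\{F=0\}$, and the locus is transverse to the fibres of $J^2\to J^1$. Let $I_F=\{\omega^1,\omega^2,\omega^3\}$ with $\omega^a=i_F^*\theta^a$. Assume that the equation is hyperbolic, i.e. $F_rF_t-\tfrac14F_s^2<0$ everywhere on the locus. Then there are locally exactly two rank two subsystems $M_1,M_2\subset I_F$ that are isotropic for $\langle\varphi,\psi\rangle_7\,\mathrm{Vol}=d\varphi\wedge d\psi\wedge\omega^1\wedge\omega^2\wedge\omega^3$. Assume moreover that the equation is generic (class 7-7), i.e. $M_1$ and $M_2$ have class $7$ at every point, where the class of $M$ is the rank of the annihilator of $\{X: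 X\in M^\perp,\ X\lrcorner\, dM\subset M\}$. A contact symmetry is a local diffeomorphism $\phi$ of $\Sigma_7$ with $\phi^*I_F=I_F$; the contact symmetry algebra on an open $U\subset\Sigma_7$ is the space of smooth vector fields $X$ on $U$ with $\mathcal L_XI_F\subset I_F$. **Theorem.** The contact symmetry group of any generic hyperbolic equation is finite dimensional, of dimension at most $9$, and the bound is sharp. Precisely: for every generic hyperbolic equation and every nonempty connected open $U\subset\Sigma_7$, 1. the contact symmetry algebra on $U$ is finite dimensional, of dimension at most $9$; 2. every local Lie group of transformations of $U$ that acts locally effectively by contact symmetries has dimension at most $9$. Moreover, there is a generic hyperbolic equation with $\Sigma_7$ nonempty and connected whose contact symmetry algebra on $\Sigma_7$ has dimension exactly $9$ and which admits a $9$-dimensional local Lie group of transformations of $\Sigma_7$ acting locally effectively by contact symmetries. -/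

import Mathlib

open scoped ContDiff

namespace ContactPDE

/-- The space `J²(ℝ², ℝ)` of 2-jets, with coordinates
`(x, y, z, p, q, r, s, t)` numbered `0, …, 7`. -/
abbrev J2 : Type := Fin 8 → ℝ

/-- The space `J¹(ℝ², ℝ)` of 1-jets, with coordinates `(x, y, z, p, q)` numbered `0, …, 4`. -/
abbrev J1 : Type := Fin 5 → ℝ

/-- The parameter space `ℝ⁷`. -/
abbrev R7 : Type := Fin 7 → ℝ

/-- The projection `π²₁ : J² → J¹`, `(x, y, z, p, q, r, s, t) ↦ (x, y, z, p, q)`. -/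
noncomputable def projJ1 : J2 →L[ℝ] J1 :=
  ContinuousLinearMap.pi fun k : Fin 5 =>
    ContinuousLinearMap.proj (R := ℝ) (φ := fun _ : Fin 8 => ℝ) (Fin.castLE (by norm_num) k)

/-- The coordinate differential `dx^k` on `J²`. -/
noncomputable def dJ (k : Fin 8) : J2 →L[ℝ] ℝ :=
  ContinuousLinearMap.proj (R := ℝ) (φ := fun _ : Fin 8 => ℝ) k

/-- The standard contact forms on `J²`:
`θ¹ = dz - p dx - q dy`, `θ² = dp - r dx - s dy`, `θ³ = dq - s dx - t dy`. -/
noncomputable def contactForm (j : J2) : Fin 3 → (J2 →L[ℝ] ℝ) :=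
  ![dJ 2 - j 3 • dJ 0 - j 4 • dJ 1,
    dJ 3 - j 5 • dJ 0 - j 6 • dJ 1,
    dJ 4 - j 6 • dJ 0 - j 7 • dJ 1]

/-- A (smooth) 1-form on (an open subset of) `ℝ⁷`. -/
abbrev OneForm : Type := R7 → (R7 →L[ℝ] ℝ)

/-- The exterior derivative of a 1-form at `u`, as a bilinear form:
`dφ(v, w) = v(φ(w)) - w(φ(v))` for constant vector fields `v`, `w`. -/
noncomputable def extD (φ : OneForm) (u : R7) : R7 →L[ℝ] R7 →L[ℝ] ℝ :=
  fderiv ℝ φ u - (fderiv ℝ φ u).flip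

/-- The exterior algebra of the cotangent space of `ℝ⁷` at a point. -/
abbrev Ext : Type := ExteriorAlgebra ℝ (R7 →L[ℝ] ℝ)

/-- The coordinate differential `du^k` on `ℝ⁷`. -/
noncomputable def dR (k : Fin 7) : R7 →L[ℝ] ℝ :=
  ContinuousLinearMap.proj (R := ℝ) (φ := fun _ : Fin 7 => ℝ) k

/-- A covector as an element of degree one of the exterior algebra. -/
noncomputable def covec (α : R7 →L[ℝ] ℝ) : Ext := ExteriorAlgebra.ι ℝ α

/-- A skew bilinear form `B` as an element of degree two of the exterior algebra:
`½ ∑ B(e_i, e_j) du^i ∧ du^j`. -/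
noncomputable def twoForm (B : R7 →L[ℝ] R7 →L[ℝ] ℝ) : Ext :=
  ∑ i : Fin 7, ∑ j : Fin 7,
    (B (Pi.single i 1) (Pi.single j 1) / 2) • (covec (dR i) * covec (dR j))

/-- A scalar second order equation `F(x, y, z, p, q, r, s, t) = 0`, with `F` smooth on an open
subset of `J²`, together with a nondegenerate parametrization `par : Sig → J²` of its locus:
`Sig` is open in `ℝ⁷`, `par` is smooth of maximal rank with image the locus, and the locus is
transverse to the fibres of `J² → J¹`. -/
structure Equation where
  /-- The open set on which `F` is defined. -/
  dom : Set J2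
  isOpen_dom : IsOpen dom
  /-- The left hand side of the equation. -/
  F : J2 → ℝ
  smooth_F : ContDiffOn ℝ ∞ F dom
  /-- The parameter domain `Σ₇`. -/
  Sig : Set R7
  isOpen_Sig : IsOpen Sig
  /-- The parametrization `i_F`. -/
  par : R7 → J2
  smooth_par : ContDiffOn ℝ ∞ par Sig
  image_par : par '' Sig = {j | j ∈ dom ∧ F j = 0}
  maximal_rank : ∀ u ∈ Sig, Function.Injective (fderiv ℝ par u)
  transverse : ∀ u ∈ Sig,
    LinearMap.range (fderiv ℝ par u).toLinearMap ⊔ LinearMap.ker projJ1.toLinearMap = ⊤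

namespace Equation

variable (E : Equation)

/-- The pulled back contact forms `ω^a = i_F^* θ^a`. -/
noncomputable def form (a : Fin 3) : OneForm :=
  fun u => (contactForm (E.par u) a).comp (fderiv ℝ E.par u)

/-- The Pfaffian system `I_F = {ω¹, ω², ω³}`, given by its fibre at each point. -/
noncomputable def system (u : R7) : Submodule ℝ (R7 →L[ℝ] ℝ) :=
  Submodule.span ℝ (Set.range fun a => E.form a u)

/-- The partial derivative of `F` with respect to the `k`-th coordinate of `J²`. -/
noncomputable def partialF (k : Fin 8) (j : J2) : ℝ := fderiv ℝ E.F j (Pi.single k 1)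

/-- Hyperbolicity: `Δ = F_r F_t - ¼ F_s²` is negative everywhere on the equation manifold. -/
def IsHyperbolic : Prop :=
  ∀ u ∈ E.Sig, E.partialF 5 (E.par u) * E.partialF 7 (E.par u)
    - E.partialF 6 (E.par u) ^ 2 / 4 < 0

/-- The value `dφ ∧ dψ ∧ ω¹ ∧ ω² ∧ ω³` at `u` of the (conformal class of the) symmetric bilinear
form `⟨φ, ψ⟩₇` on `I_F`. -/
noncomputable def pairing (φ ψ : OneForm) (u : R7) : Ext :=
  twoForm (extD φ u) * twoForm (extD ψ u) *
    covec (E.form 0 u) * covec (E.form 1 u) * covec (E.form 2 u)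

/-- `{σ¹, σ²}` is, on the open set `A`, a smooth rank two subsystem of `I_F` which is isotropic
for `⟨·, ·⟩₇`. For a hyperbolic equation there are locally exactly two such subsystems, the
characteristic systems `M₁` and `M₂`. -/
structure IsCharacteristicSystem (A : Set R7) (σ : Fin 2 → OneForm) : Prop where
  isOpen : IsOpen A
  subset : A ⊆ E.Sig
  smooth : ∀ b, ContDiffOn ℝ ∞ (σ b) A
  mem : ∀ b, ∀ u ∈ A, σ b u ∈ E.system u
  independent : ∀ u ∈ A, LinearIndependent ℝ fun b => σ b u
  isotropic : ∀ b c, ∀ u ∈ A, E.pairing (σ b) (σ c) u = 0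

end Equation

/-- The fibre at `u` of the Pfaffian system generated by two 1-forms. -/
noncomputable def pfaff (σ : Fin 2 → OneForm) (u : R7) : Submodule ℝ (R7 →L[ℝ] ℝ) :=
  Submodule.span ℝ (Set.range fun b => σ b u)

/-- The Cauchy characteristic space at `u` of the Pfaffian system `M = {σ¹, σ²}`:
the vectors `X ∈ M^⊥` with `X ⌟ dM ⊆ M`. -/
noncomputable def cauchyChar (σ : Fin 2 → OneForm) (u : R7) : Submodule ℝ R7 where
  carrier := {X | ∀ b, σ b u X = 0 ∧ extD (σ b) u X ∈ pfaff σ u}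
  zero_mem' := fun b => by simp
  add_mem' := fun {X Y} hX hY b => by
    refine ⟨by simp [(hX b).1, (hY b).1], ?_⟩
    rw [map_add]
    exact add_mem (hX b).2 (hY b).2
  smul_mem' := fun c X hX b => by
    refine ⟨by simp [(hX b).1], ?_⟩
    rw [map_smul]
    exact Submodule.smul_mem _ c (hX b).2

/-- The Cartan system at `u`: the annihilator of the Cauchy characteristic space. -/
noncomputable def cartanSystem (σ : Fin 2 → OneForm) (u : R7) : Submodule ℝ (R7 →L[ℝ] ℝ) where
  carrier := {α | ∀ X ∈ cauchyChar σ u, α X = 0}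
  zero_mem' := fun X _ => by simp
  add_mem' := fun {α β} hα hβ X hX => by simp [hα X hX, hβ X hX]
  smul_mem' := fun c α hα X hX => by simp [hα X hX]

/-- The class at `u` of the Pfaffian system `{σ¹, σ²}`: the rank of its Cartan system. -/
noncomputable def pfaffClass (σ : Fin 2 → OneForm) (u : R7) : ℕ :=
  Module.finrank ℝ (cartanSystem σ u)

namespace Equation

variable (E : Equation)

/-- Generic (class 7-7) type: both characteristic systems have class 7 at every point. -/
def IsGeneric : Prop :=
  ∀ (A : Set R7) (σ : Fin 2 → OneForm), E.IsCharacteristicSystem A σ →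
    ∀ u ∈ A, pfaffClass σ u = 7

/-- `φ`, restricted to the open set `A ⊆ Σ₇`, is a contact symmetry: a local diffeomorphism into
`Σ₇` with `φ^* I_F = I_F`. -/
structure IsContactSymmetry (A : Set R7) (φ : R7 → R7) : Prop where
  isOpen : IsOpen A
  subset : A ⊆ E.Sig
  mapsTo : Set.MapsTo φ A E.Sig
  smooth : ContDiffOn ℝ ∞ φ A
  bijective : ∀ u ∈ A, Function.Bijective (fderiv ℝ φ u)
  pullback : ∀ u ∈ A,
    (E.system (φ u)).map (ContinuousLinearMap.precomp ℝ (fderiv ℝ φ u)).toLinearMap = E.system u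

end Equation

/-- The Lie derivative at `u` of the 1-form `φ` along the vector field `X`:
`(L_X φ)(v) = (D_X φ)(v) + φ(D_v X)`. -/
noncomputable def lieD (X : R7 → R7) (φ : OneForm) (u : R7) : R7 →L[ℝ] ℝ :=
  fderiv ℝ φ u (X u) + (φ u).comp (fderiv ℝ X u)

namespace Equation

variable (E : Equation)

/-- The contact symmetry algebra on an open set `U ⊆ Σ₇`: the real vector space of smooth vector
fields `X` on `U` with `L_X I_F ⊆ I_F`. A vector field on `U` is represented by the function on
`ℝ⁷` that extends it by zero. -/
noncomputable def symmetryAlgebra (U : TopologicalSpace.Opens R7) : Submodule ℝ (R7 → R7) where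
  carrier := {X | ContDiffOn ℝ ∞ X U ∧ (∀ u, u ∉ U → X u = 0) ∧
    ∀ u ∈ U, ∀ a, lieD X (E.form a) u ∈ E.system u}
  zero_mem' := by
    refine ⟨contDiffOn_const, fun _ _ => rfl, fun u _ a => ?_⟩
    have h : lieD (0 : R7 → R7) (E.form a) u = 0 := by simp [lieD]
    rw [h]
    exact zero_mem _
  add_mem' := fun {X Y} hX hY => by
    refine ⟨hX.1.add hY.1, fun u hu => by simp [hX.2.1 u hu, hY.2.1 u hu], fun u hu a => ?_⟩
    have dX := (hX.1.contDiffAt (U.isOpen.mem_nhds hu)).differentiableAt (by simp)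
    have dY := (hY.1.contDiffAt (U.isOpen.mem_nhds hu)).differentiableAt (by simp)
    have h : lieD (X + Y) (E.form a) u = lieD X (E.form a) u + lieD Y (E.form a) u := by
      simp only [lieD, fderiv_add dX dY, Pi.add_apply, map_add, ContinuousLinearMap.comp_add]
      abel
    rw [h]
    exact add_mem (hX.2.2 u hu a) (hY.2.2 u hu a)
  smul_mem' := fun c X hX => by
    refine ⟨hX.1.const_smul c, fun u hu => by simp [hX.2.1 u hu], fun u hu a => ?_⟩
    have dX := (hX.1.contDiffAt (U.isOpen.mem_nhds hu)).differentiableAt (by simp)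
    have h : lieD (c • X) (E.form a) u = c • lieD X (E.form a) u := by
      simp only [lieD, fderiv_const_smul dX, Pi.smul_apply, map_smul,
        ContinuousLinearMap.comp_smul, smul_add]
    rw [h]
    exact Submodule.smul_mem _ c (hX.2.2 u hu a)

end Equation

/-- A `d`-dimensional local Lie group: an open neighbourhood of the identity `0` in `ℝ^d` with
smooth multiplication and, near the identity, smooth inversion, the group laws holding wherever
all products involved are defined. -/
structure LocalLieGroup (d : ℕ) where
  carrier : Set (Fin d → ℝ)
  isOpen_carrier : IsOpen carrier
  zero_mem : 0 ∈ carrier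
  mul : (Fin d → ℝ) → (Fin d → ℝ) → (Fin d → ℝ)
  smooth_mul : ContDiffOn ℝ ∞ (fun g : (Fin d → ℝ) × (Fin d → ℝ) => mul g.1 g.2)
    (carrier ×ˢ carrier)
  zero_mul : ∀ g ∈ carrier, mul 0 g = g
  mul_zero : ∀ g ∈ carrier, mul g 0 = g
  mul_assoc : ∀ g ∈ carrier, ∀ h ∈ carrier, ∀ k ∈ carrier,
    mul g h ∈ carrier → mul h k ∈ carrier → mul (mul g h) k = mul g (mul h k)
  /-- The set of elements that have an inverse. -/
  invDom : Set (Fin d → ℝ)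
  isOpen_invDom : IsOpen invDom
  zero_mem_invDom : 0 ∈ invDom
  invDom_subset : invDom ⊆ carrier
  inv : (Fin d → ℝ) → (Fin d → ℝ)
  smooth_inv : ContDiffOn ℝ ∞ inv invDom
  inv_mem : ∀ g ∈ invDom, inv g ∈ carrier
  inv_mul : ∀ g ∈ invDom, mul (inv g) g = 0
  mul_inv : ∀ g ∈ invDom, mul g (inv g) = 0

/-- A local action of a local Lie group on an open set `U ⊆ ℝ⁷` (a local Lie group of
transformations of `U`). -/
structure LocalAction {d : ℕ} (G : LocalLieGroup d) (U : Set R7) where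
  /-- The domain of definition of the action. -/
  dom : Set ((Fin d → ℝ) × R7)
  isOpen_dom : IsOpen dom
  dom_subset : dom ⊆ G.carrier ×ˢ U
  zero_mem_dom : ∀ u ∈ U, (0, u) ∈ dom
  act : (Fin d → ℝ) → R7 → R7
  smooth_act : ContDiffOn ℝ ∞ (fun y : (Fin d → ℝ) × R7 => act y.1 y.2) dom
  act_mem : ∀ g u, (g, u) ∈ dom → act g u ∈ U
  zero_act : ∀ u ∈ U, act 0 u = u
  mul_act : ∀ g h u, (h, u) ∈ dom → (g, act h u) ∈ dom → (G.mul g h, u) ∈ dom →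
    act g (act h u) = act (G.mul g h) u
  inv_act : ∀ g u, g ∈ G.invDom → (g, u) ∈ dom →
    (G.inv g, act g u) ∈ dom ∧ act (G.inv g) (act g u) = u

/-- Local effectiveness: on some nonempty open set `W` the elements of some neighbourhood `N` of
the identity are all defined, and only the identity acts trivially there. -/
def LocalAction.IsLocallyEffective {d : ℕ} {G : LocalLieGroup d} {U : Set R7}
    (Φ : LocalAction G U) : Prop :=
  ∃ N : Set (Fin d → ℝ), ∃ W : Set R7, IsOpen N ∧ 0 ∈ N ∧ IsOpen W ∧ W.Nonempty ∧
    N ×ˢ W ⊆ Φ.dom ∧ ∀ g ∈ N, (∀ u ∈ W, Φ.act g u = u) → g = 0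

/-- Every element of the local group acts, where it is defined, by a contact symmetry of `E`. -/
def LocalAction.ActsBySymmetries {d : ℕ} {G : LocalLieGroup d} {U : Set R7}
    (Φ : LocalAction G U) (E : Equation) : Prop :=
  ∀ g ∈ G.carrier, E.IsContactSymmetry {u | (g, u) ∈ Φ.dom} (Φ.act g)

/-- A `d`-dimensional local Lie group of contact symmetries of `E` exists on `U`. -/
def Equation.HasSymmetryGroup (E : Equation) (U : Set R7) (d : ℕ) : Prop :=
  ∃ (G : LocalLieGroup d) (Φ : LocalAction G U), Φ.IsLocallyEffective ∧ Φ.ActsBySymmetries E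

end ContactPDE

namespace ContactPDE

/-! ### Structure equations of a frame adapted to the two characteristic systems -/

section Algebra

variable {R : Type*} [CommRing R] [Algebra ℝ R]

/-! Let D be the rank four distribution annihilated by the contact system. Near any point of a
hyperbolic equation D has a frame a₁, b₁, a₂, b₂ with b₁, b₂ vertical over J¹, such that brackets of
an index 1 field with an index 2 field stay in D. The fields A = [a₁, b₁] and B = [a₂, b₂] complete
D to its derived distribution D', and Z = [A, a₁] supplies the seventh direction. Let u₁ be the
B-component of [A, b₁] and u₂ the A-component of [B, b₂]. At a zero of u₁ or u₂ the field b₁ or b₂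
would be a Cauchy characteristic of a characteristic system, so class 7-7 makes both units
(`isUnit_slopes`). The Jacobi identity gives c₀e₂ = u₁u₂ (`c_mul_e`), so the structure functions c₀
and e₂ are units as well.

An infinitesimal symmetry X preserves D, hence the vertical lines ⟨b₁⟩, ⟨b₂⟩ and the planes ⟨a₁,
b₁⟩, ⟨a₂, b₂⟩ (`IsSymmetry.preserves`). Its action on the frame is therefore described by six
functions: weights α₁, β₁, α₂, β₂ and shears κ₁, κ₂. Expanding X u₁, X u₂ and the two expressions
for Z gives three linear relations between the weights, so modulo the components of X only α₁ is
free. Since c₀ is a unit, κ₁ is then expressed through the components of X, α₁ and κ₂. The remaining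
Jacobi identities express the derivatives of α₁ and κ₂ along D. Thus the ideal generated by the
seven components of X together with α₁ and κ₂ is stable under D (`Preserves.apply_mem`), and under
all vector fields because D bracket-generates (`JetFrame.apply_mem_ideal`).

These nine functions satisfy a closed total linear system. On a convex neighbourhood their values at
one point determine X (`eq_zero_of_partialD_eq`, `exists_determining_map`), and connectedness
spreads this over U, which gives the bound (`finrank_symmetryAlgebra_le`). For a local group acting
locally effectively, sending a Lie algebra element to its fundamental field is an injection into the
symmetry algebra (`LocalAction.le_finrank`).

Sharpness comes from 3 r t³ + 1 = 0. It admits unimodular projective maps of x (dimension 3), a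
scaling and a translation of y (dimension 2), and the addition to z of polynomials in 1, x, y, xy
(dimension 4). The resulting local group is written out explicitly; with the upper bound it forces
the symmetry algebra to have dimension exactly 9. -/

theorem smul_lie_derivation (f : R) (Y Z : Derivation ℝ R R) :
    ⁅f • Y, Z⁆ = f • ⁅Y, Z⁆ - Z f • Y := by
  ext g
  simp [Derivation.commutator_apply, mul_comm]
  try ring

theorem lie_smul_derivation (f : R) (Y Z : Derivation ℝ R R) :
    ⁅Y, f • Z⁆ = f • ⁅Y, Z⁆ + Y f • Z := by
  ext g
  simp [Derivation.commutator_apply]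

/-- A frame adapted to a pair of characteristic distributions `⟨a₁, b₁⟩` and `⟨a₂, b₂⟩`,
with its structure functions and its dual coframe. -/
structure CharacteristicFrame (R : Type*) [CommRing R] [Algebra ℝ R] where
  a₁ : Derivation ℝ R R
  b₁ : Derivation ℝ R R
  a₂ : Derivation ℝ R R
  b₂ : Derivation ℝ R R
  A : Derivation ℝ R R
  B : Derivation ℝ R R
  Z : Derivation ℝ R R
  θ : Fin 7 → Derivation ℝ R R →ₗ[R] R
  dual : ∀ i j, θ i ((![a₁, b₁, a₂, b₂, A, B, Z] : Fin 7 → Derivation ℝ R R) j) =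
    if i = j then 1 else 0
  p : R
  q : R
  c : Fin 4 → R
  e : Fin 4 → R
  f : Fin 4 → R
  j : Fin 4 → R
  k : Fin 4 → R
  l : Fin 4 → R
  u₁ : R
  u₂ : R
  h₁ : R
  h₂ : R
  m : R
  n : R
  -- The omitted components carry the geometry: mixed brackets lie in the span of the first four
  -- fields, b₁ and b₂ span an integrable distribution, and bracketing `A` or `B` with a vertical
  -- field produces no `Z`.
  lie_a₁_b₁ : ⁅a₁, b₁⁆ = A
  lie_a₂_b₂ : ⁅a₂, b₂⁆ = B
  lie_A_a₁ : ⁅A, a₁⁆ = Z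
  lie_b₁_b₂ : ⁅b₁, b₂⁆ = p • b₁ + q • b₂
  lie_b₁_a₂ : ⁅b₁, a₂⁆ = c 0 • a₁ + c 1 • b₁ + c 2 • a₂ + c 3 • b₂
  lie_b₂_a₁ : ⁅b₂, a₁⁆ = e 0 • a₁ + e 1 • b₁ + e 2 • a₂ + e 3 • b₂
  lie_a₁_a₂ : ⁅a₁, a₂⁆ = f 0 • a₁ + f 1 • b₁ + f 2 • a₂ + f 3 • b₂
  lie_A_b₁ : ⁅A, b₁⁆ = u₁ • B + h₁ • A + j 0 • a₁ + j 1 • b₁ + j 2 • a₂ + j 3 • b₂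
  lie_B_b₂ : ⁅B, b₂⁆ = u₂ • A + h₂ • B + k 0 • a₁ + k 1 • b₁ + k 2 • a₂ + k 3 • b₂
  lie_B_a₂ : ⁅B, a₂⁆ = Z + m • A + n • B + l 0 • a₁ + l 1 • b₁ + l 2 • a₂ + l 3 • b₂

namespace CharacteristicFrame

variable (C : CharacteristicFrame R)

/-- The same frame with the two characteristic distributions exchanged. -/
def swap : CharacteristicFrame R where
  a₁ := C.a₂
  b₁ := C.b₂
  a₂ := C.a₁
  b₂ := C.b₁
  A := C.B
  B := C.A
  -- The exchanged frame must use [B, a₂] as its last vector; the coframe below is corrected to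
  -- remain dual. The symmetry halves the computations that follow.
  Z := C.Z + C.m • C.A + C.n • C.B + C.l 0 • C.a₁ + C.l 1 • C.b₁ + C.l 2 • C.a₂ + C.l 3 • C.b₂
  θ := ![C.θ 2 - C.l 2 • C.θ 6, C.θ 3 - C.l 3 • C.θ 6, C.θ 0 - C.l 0 • C.θ 6,
    C.θ 1 - C.l 1 • C.θ 6, C.θ 5 - C.n • C.θ 6, C.θ 4 - C.m • C.θ 6, C.θ 6]
  dual := by
    have h := C.dual
    simp only [Fin.forall_fin_succ] at h ⊢
    simp at h ⊢
    simp [h]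
  p := -C.q
  q := -C.p
  c := ![C.e 2, C.e 3, C.e 0, C.e 1]
  e := ![C.c 2, C.c 3, C.c 0, C.c 1]
  f := ![-C.f 2, -C.f 3, -C.f 0, -C.f 1]
  j := ![C.k 2, C.k 3, C.k 0, C.k 1]
  k := ![C.j 2, C.j 3, C.j 0, C.j 1]
  l := ![-C.l 2, -C.l 3, -C.l 0, -C.l 1]
  u₁ := C.u₂
  u₂ := C.u₁
  h₁ := C.h₂
  h₂ := C.h₁
  m := -C.n
  n := -C.m
  lie_a₁_b₁ := C.lie_a₂_b₂
  lie_a₂_b₂ := C.lie_a₁_b₁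
  lie_A_a₁ := C.lie_B_a₂
  lie_b₁_b₂ := by rw [← lie_skew, C.lie_b₁_b₂]; module
  lie_b₁_a₂ := by rw [C.lie_b₂_a₁]; simp; module
  lie_b₂_a₁ := by rw [C.lie_b₁_a₂]; simp; module
  lie_a₁_a₂ := by rw [← lie_skew, C.lie_a₁_a₂]; simp; module
  lie_A_b₁ := by rw [C.lie_B_b₂]; simp; module
  lie_B_b₂ := by rw [C.lie_A_b₁]; simp; module
  lie_B_a₂ := by rw [C.lie_A_a₁]; simp; module

theorem dual_table (C : CharacteristicFrame R) :
    ∀ i, (C.θ i C.a₁ = if i = 0 then 1 else 0) ∧ (C.θ i C.b₁ = if i = 1 then 1 else 0) ∧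
      (C.θ i C.a₂ = if i = 2 then 1 else 0) ∧ (C.θ i C.b₂ = if i = 3 then 1 else 0) ∧
      (C.θ i C.A = if i = 4 then 1 else 0) ∧ (C.θ i C.B = if i = 5 then 1 else 0) ∧
      (C.θ i C.Z = if i = 6 then 1 else 0) := fun i =>
  ⟨C.dual i 0, C.dual i 1, C.dual i 2, C.dual i 3, C.dual i 4, C.dual i 5, C.dual i 6⟩

@[simp] theorem θ_a₁ (i) : C.θ i C.a₁ = if i = 0 then 1 else 0 := (C.dual_table i).1
@[simp] theorem θ_b₁ (i) : C.θ i C.b₁ = if i = 1 then 1 else 0 := (C.dual_table i).2.1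
@[simp] theorem θ_a₂ (i) : C.θ i C.a₂ = if i = 2 then 1 else 0 := (C.dual_table i).2.2.1
@[simp] theorem θ_b₂ (i) : C.θ i C.b₂ = if i = 3 then 1 else 0 := (C.dual_table i).2.2.2.1
@[simp] theorem θ_A (i) : C.θ i C.A = if i = 4 then 1 else 0 := (C.dual_table i).2.2.2.2.1
@[simp] theorem θ_B (i) : C.θ i C.B = if i = 5 then 1 else 0 := (C.dual_table i).2.2.2.2.2.1
@[simp] theorem θ_Z (i) : C.θ i C.Z = if i = 6 then 1 else 0 := (C.dual_table i).2.2.2.2.2.2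

theorem lie_b₁_a₁ : ⁅C.b₁, C.a₁⁆ = -C.A := by rw [← lie_skew, C.lie_a₁_b₁]
theorem lie_b₂_a₂ : ⁅C.b₂, C.a₂⁆ = -C.B := by rw [← lie_skew, C.lie_a₂_b₂]
theorem lie_a₁_A : ⁅C.a₁, C.A⁆ = -C.Z := by rw [← lie_skew, C.lie_A_a₁]
theorem lie_b₂_b₁ : ⁅C.b₂, C.b₁⁆ = -(C.p • C.b₁ + C.q • C.b₂) := by
  rw [← lie_skew, C.lie_b₁_b₂]
theorem lie_a₂_b₁ : ⁅C.a₂, C.b₁⁆ =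
    -(C.c 0 • C.a₁ + C.c 1 • C.b₁ + C.c 2 • C.a₂ + C.c 3 • C.b₂) := by
  rw [← lie_skew, C.lie_b₁_a₂]
theorem lie_a₁_b₂ : ⁅C.a₁, C.b₂⁆ =
    -(C.e 0 • C.a₁ + C.e 1 • C.b₁ + C.e 2 • C.a₂ + C.e 3 • C.b₂) := by
  rw [← lie_skew, C.lie_b₂_a₁]
theorem lie_a₂_a₁ : ⁅C.a₂, C.a₁⁆ =
    -(C.f 0 • C.a₁ + C.f 1 • C.b₁ + C.f 2 • C.a₂ + C.f 3 • C.b₂) := by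
  rw [← lie_skew, C.lie_a₁_a₂]

/-- Jacobi identity in the form used throughout. -/
theorem lie_lie_eq (X Y Z : Derivation ℝ R R) : ⁅⁅X, Y⁆, Z⁆ = ⁅X, ⁅Y, Z⁆⁆ - ⁅Y, ⁅X, Z⁆⁆ := by
  rw [leibniz_lie X Y Z]; abel

/-- Jacobi identity for a₁, b₁, b₂. The a₁-coefficient is kept explicit because it is the source of
the product `c 0 * e 2` in `c_mul_e_aux`. -/
theorem lie_A_b₂ : ⁅C.A, C.b₂⁆ = (C.p - C.e 0) • C.A +
    (C.b₁ (C.e 0) + C.e 2 * C.c 0 - C.q * C.e 0) • C.a₁ +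
    (C.a₁ C.p - C.q * C.e 1 + C.b₁ (C.e 1) + C.e 2 * C.c 1 + C.e 3 * C.p) • C.b₁ +
    (C.b₁ (C.e 2) + C.e 2 * C.c 2 - C.q * C.e 2) • C.a₂ +
    (C.a₁ C.q - C.q * C.e 3 + C.b₁ (C.e 3) + C.e 2 * C.c 3 + C.e 3 * C.q) • C.b₂ := by
  rw [← C.lie_a₁_b₁, lie_lie_eq, C.lie_b₁_b₂, C.lie_a₁_b₂]
  simp only [lie_add, lie_neg, lie_smul_derivation, lie_b₁_a₁, lie_a₁_b₁, lie_b₁_a₂, lie_b₁_b₂,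
    lie_a₁_b₂, lie_self]
  module

/-- Only the `B`-coefficient is needed later, so the part in the distribution is left unnamed. -/
theorem exists_lie_B_b₁ : ∃ y : Fin 4 → R, ⁅C.B, C.b₁⁆ = (-C.q - C.c 2) • C.B +
    y 0 • C.a₁ + y 1 • C.b₁ + y 2 • C.a₂ + y 3 • C.b₂ := by
  have h := C.swap.lie_A_b₂
  simp only [swap] at h
  refine ⟨fun i => C.θ (i.castLE (by norm_num)) ⁅C.B, C.b₁⁆, ?_⟩
  rw [h]
  simp
  module

theorem exists_lie_B_a₁ : ∃ y : Fin 4 → R, ⁅C.B, C.a₁⁆ = (C.e 3 - C.f 2) • C.B +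
    y 0 • C.a₁ + y 1 • C.b₁ + y 2 • C.a₂ + y 3 • C.b₂ := by
  have h : ⁅C.B, C.a₁⁆ = ⁅C.a₂, ⁅C.b₂, C.a₁⁆⁆ - ⁅C.b₂, ⁅C.a₂, C.a₁⁆⁆ := by
    rw [← C.lie_a₂_b₂, lie_lie_eq]
  simp only [C.lie_b₂_a₁, lie_a₂_a₁, lie_add, lie_neg, lie_smul_derivation, lie_a₂_b₂,
    lie_a₂_b₁, lie_self, lie_b₂_b₁, lie_b₂_a₂] at h
  refine ⟨fun i => C.θ (i.castLE (by norm_num)) ⁅C.B, C.a₁⁆, ?_⟩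
  rw [h]
  simp
  module

/-- The `Z`-component of [Z, b₁] is computed twice, from Z = [A, a₁] and from Z ≡ [B, a₂]. -/
theorem h₁_eq : C.h₁ = -(C.c 2 + C.c 2 + C.q) := by
  obtain ⟨y, hy⟩ := C.exists_lie_B_b₁
  obtain ⟨w, hw⟩ := C.exists_lie_B_a₁
  have h1 : C.θ 6 ⁅C.Z, C.b₁⁆ = C.h₁ := by
    rw [← C.lie_A_a₁, lie_lie_eq, C.lie_a₁_b₁, lie_self, C.lie_A_b₁]
    simp only [lie_add, lie_smul_derivation, lie_a₁_A, lie_a₁_b₁, lie_a₁_b₂, lie_a₁_a₂, lie_self]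
    rw [← lie_skew, hw]
    simp
  have h2 : C.Z = ⁅C.B, C.a₂⁆ - (C.m • C.A + C.n • C.B + C.l 0 • C.a₁ + C.l 1 • C.b₁ +
      C.l 2 • C.a₂ + C.l 3 • C.b₂) := by rw [C.lie_B_a₂]; abel
  rw [h2, sub_lie, lie_lie_eq, lie_a₂_b₁, hy] at h1
  simp only [lie_add, add_lie, lie_neg, lie_smul_derivation, smul_lie_derivation, C.lie_B_b₂,
    hw, hy, lie_A_b₁, C.lie_a₁_b₁, lie_a₂_b₁, lie_b₂_b₁, lie_self,
    lie_a₂_a₁, C.lie_a₂_b₂, C.lie_B_a₂, ← lie_skew C.a₂ C.B] at h1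
  simp at h1
  linear_combination -h1

theorem h₂_eq : C.h₂ = C.p - (C.e 0 + C.e 0) := by
  have := C.swap.h₁_eq
  simp [swap] at this
  linear_combination this

/-- The `A`-component of the Jacobi identity for A, b₁, b₂. -/
theorem c_mul_e_aux : C.u₁ * C.u₂ + C.h₁ * (C.p - C.e 0) - C.b₂ C.h₁ - C.h₁ * (C.p - C.e 0)
    + C.b₁ (C.p - C.e 0) - (C.b₁ (C.e 0) + C.e 2 * C.c 0 - C.q * C.e 0)
    = C.p * C.h₁ + C.q * (C.p - C.e 0) := by
  have h := lie_lie_eq C.A C.b₁ C.b₂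
  rw [C.lie_A_b₁, C.lie_b₁_b₂, C.lie_A_b₂] at h
  simp only [lie_add, add_lie, lie_smul_derivation, smul_lie_derivation, C.lie_B_b₂,
    lie_A_b₁, C.lie_A_b₂, ← lie_skew C.b₁ C.A, C.lie_a₁_b₂, C.lie_b₁_b₂, C.lie_a₂_b₂, lie_self,
    lie_b₁_a₁, C.lie_b₁_a₂] at h
  have h' := congrArg (C.θ 4) h
  simp at h' ⊢
  linear_combination h'

/-- After `h₁` and `h₂` are substituted, adding `c_mul_e_aux` to its mirror image cancels every
derivative term and leaves twice this identity. It turns nonvanishing of `u₁` and `u₂` into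
nonvanishing of `c 0` and `e 2`. -/
theorem c_mul_e : C.c 0 * C.e 2 = C.u₁ * C.u₂ := by
  have h := C.c_mul_e_aux
  have h' := C.swap.c_mul_e_aux
  simp [swap] at h'
  simp only [C.h₁_eq, C.h₂_eq] at h h'
  simp at h h'
  have h2 : (2:ℝ) • (C.c 0 * C.e 2) = (2:ℝ) • (C.u₁ * C.u₂) := by
    simp only [two_smul]
    linear_combination -h - h'
  exact smul_right_injective R (two_ne_zero) h2

/-- A derivation preserving the distribution `⟨a₁, b₁, a₂, b₂⟩`. -/
structure IsSymmetry (X : Derivation ℝ R R) (x : Fin 4 → Fin 4 → R) : Prop where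
  lie_a₁ : ⁅X, C.a₁⁆ = x 0 0 • C.a₁ + x 0 1 • C.b₁ + x 0 2 • C.a₂ + x 0 3 • C.b₂
  lie_b₁ : ⁅X, C.b₁⁆ = x 1 0 • C.a₁ + x 1 1 • C.b₁ + x 1 2 • C.a₂ + x 1 3 • C.b₂
  lie_a₂ : ⁅X, C.a₂⁆ = x 2 0 • C.a₁ + x 2 1 • C.b₁ + x 2 2 • C.a₂ + x 2 3 • C.b₂
  lie_b₂ : ⁅X, C.b₂⁆ = x 3 0 • C.a₁ + x 3 1 • C.b₁ + x 3 2 • C.a₂ + x 3 3 • C.b₂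

theorem IsSymmetry.swap {C : CharacteristicFrame R} {X : Derivation ℝ R R} {x : Fin 4 → Fin 4 → R}
    (h : C.IsSymmetry X x) : C.swap.IsSymmetry X fun i j => x (![2, 3, 0, 1] i) (![2, 3, 0, 1] j) where
  lie_a₁ := by simp [CharacteristicFrame.swap, h.lie_a₂]; module
  lie_b₁ := by simp [CharacteristicFrame.swap, h.lie_b₂]; module
  lie_a₂ := by simp [CharacteristicFrame.swap, h.lie_a₁]; module
  lie_b₂ := by simp [CharacteristicFrame.swap, h.lie_b₁]; module


theorem exists_lie_A_a₂ : ∃ y : Fin 4 → R, ⁅C.A, C.a₂⁆ = (C.c 1 + C.f 0) • C.A +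
    y 0 • C.a₁ + y 1 • C.b₁ + y 2 • C.a₂ + y 3 • C.b₂ := by
  have h : ⁅C.A, C.a₂⁆ = ⁅C.a₁, ⁅C.b₁, C.a₂⁆⁆ - ⁅C.b₁, ⁅C.a₁, C.a₂⁆⁆ := by
    rw [← C.lie_a₁_b₁, lie_lie_eq]
  simp only [C.lie_b₁_a₂, C.lie_a₁_a₂, lie_add, lie_smul_derivation, lie_a₁_b₁, lie_b₁_b₂,
    lie_a₁_b₂, lie_self, lie_b₁_a₁] at h
  refine ⟨fun i => C.θ (i.castLE (by norm_num)) ⁅C.A, C.a₂⁆, ?_⟩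
  rw [h]
  simp
  module


end CharacteristicFrame

end Algebra

/-! ### Infinitesimal symmetries and the closed system of nine functions -/

section Algebra

variable {R : Type*} [CommRing R] [Algebra ℝ R]

namespace CharacteristicFrame

variable (C : CharacteristicFrame R)

section Symmetry

variable {C} {X : Derivation ℝ R R} {x : Fin 4 → Fin 4 → R}

theorem IsSymmetry.exists_lie_A (h : C.IsSymmetry X x) : ∃ y : Fin 4 → R,
    ⁅X, C.A⁆ = (x 0 0 + x 1 1) • C.A
    + y 0 • C.a₁ + y 1 • C.b₁ + y 2 • C.a₂ + y 3 • C.b₂ := by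
  have h1 : ⁅X, C.A⁆ = ⁅⁅X, C.a₁⁆, C.b₁⁆ + ⁅C.a₁, ⁅X, C.b₁⁆⁆ := by
    rw [← C.lie_a₁_b₁, leibniz_lie]
  rw [h.lie_a₁, h.lie_b₁] at h1
  simp only [lie_add, add_lie, lie_smul_derivation, smul_lie_derivation, C.lie_a₁_b₁, C.lie_a₂_b₁,
    C.lie_b₂_b₁, lie_self, C.lie_a₁_a₂, C.lie_a₁_b₂] at h1
  refine ⟨fun i => C.θ (i.castLE (by norm_num)) ⁅X, C.A⁆, ?_⟩
  rw [h1]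
  simp
  module

/-- The vertical fields are the fields of D whose brackets with `A` and `B` have no `Z`-component.
This characterization is invariant under X, which preserves D and its derived distribution. -/
theorem IsSymmetry.vertical (h : C.IsSymmetry X x) : x 1 0 = 0 ∧ x 1 2 = 0 := by
  obtain ⟨y, hy⟩ := h.exists_lie_A
  obtain ⟨y', hy'⟩ := h.swap.exists_lie_A
  obtain ⟨v, hv⟩ := C.exists_lie_A_a₂
  obtain ⟨w, hw⟩ := C.exists_lie_B_a₁
  obtain ⟨w', hw'⟩ := C.exists_lie_B_b₁
  simp [CharacteristicFrame.swap] at hy'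
  have hA := congrArg (C.θ 6) (lie_lie_eq X C.b₁ C.A)
  have hB := congrArg (C.θ 6) (lie_lie_eq X C.b₁ C.B)
  rw [← lie_skew C.b₁ C.A, C.lie_A_b₁, h.lie_b₁, hy] at hA
  rw [← lie_skew C.b₁ C.B, hw', h.lie_b₁, hy'] at hB
  simp only [lie_add, lie_neg, lie_smul_derivation, hy, hy',
    h.lie_a₁, h.lie_b₁, h.lie_a₂, h.lie_b₂, ← lie_skew C.b₁ C.A, C.lie_A_b₁, hw', hv, hw,
    ← lie_skew _ C.A, ← lie_skew _ C.B, C.lie_A_b₂, C.lie_B_b₂, C.lie_B_a₂, C.lie_A_a₁] at hA hB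
  simp [lie_b₁_a₁, lie_b₁_b₂, lie_b₁_a₂] at hA hB
  exact ⟨hA, hB⟩

theorem IsSymmetry.vertical' (h : C.IsSymmetry X x) :
    x 1 0 = 0 ∧ x 1 2 = 0 ∧ x 3 0 = 0 ∧ x 3 2 = 0 := by
  have h' := h.swap.vertical
  simp at h'
  exact ⟨h.vertical.1, h.vertical.2, h'.2, h'.1⟩

/-- X maps [b₁, a₂], which lies in D, into D. In the Leibniz expansion the two unwanted coefficients
multiply [b₂, a₂] = -B and [b₁, a₁] = -A, and nothing else contributes to these components. -/
theorem IsSymmetry.mixed (h : C.IsSymmetry X x) : x 1 3 = 0 ∧ x 2 0 = 0 := by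
  obtain ⟨h10, h12, h30, h32⟩ := h.vertical'
  have hl := leibniz_lie X C.b₁ C.a₂
  rw [C.lie_b₁_a₂, h.lie_b₁, h.lie_a₂] at hl
  simp only [lie_add, add_lie, lie_smul_derivation, smul_lie_derivation, C.lie_b₁_a₂, lie_b₁_a₁,
    C.lie_b₁_b₂, lie_self, h.lie_a₁, h.lie_b₁, h.lie_a₂, h.lie_b₂, C.lie_a₁_a₂, lie_b₂_a₂] at hl
  have h4 := congrArg (C.θ 4) hl
  have h5 := congrArg (C.θ 5) hl
  simp at h4 h5
  exact ⟨h5, h4⟩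

theorem IsSymmetry.mixed' (h : C.IsSymmetry X x) : x 1 3 = 0 ∧ x 2 0 = 0 ∧ x 3 1 = 0 ∧ x 0 2 = 0 := by
  have h' := h.swap.mixed
  simp at h'
  exact ⟨h.mixed.1, h.mixed.2, h'.1, h'.2⟩

/-- The same argument with [a₁, a₂], which is also in D. -/
theorem IsSymmetry.mixed_a (h : C.IsSymmetry X x) : x 0 3 = 0 ∧ x 2 1 = 0 := by
  have hl := leibniz_lie X C.a₁ C.a₂
  rw [C.lie_a₁_a₂, h.lie_a₁, h.lie_a₂] at hl
  simp only [lie_add, add_lie, lie_smul_derivation, smul_lie_derivation, C.lie_b₁_a₂, C.lie_a₁_b₁,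
    C.lie_a₁_b₂, lie_self, h.lie_a₁, h.lie_b₁, h.lie_a₂, h.lie_b₂, C.lie_a₁_a₂, lie_b₂_a₂] at hl
  have h4 := congrArg (C.θ 4) hl
  have h5 := congrArg (C.θ 5) hl
  simp at h4 h5
  exact ⟨h5, h4.symm⟩

end Symmetry

/-- A derivation preserving the lines `⟨b₁⟩`, `⟨b₂⟩` and the planes `⟨a₁, b₁⟩`, `⟨a₂, b₂⟩`. -/
structure Preserves (X : Derivation ℝ R R) (α₁ κ₁ β₁ α₂ κ₂ β₂ : R) : Prop where
  lie_a₁ : ⁅X, C.a₁⁆ = α₁ • C.a₁ + κ₁ • C.b₁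
  lie_b₁ : ⁅X, C.b₁⁆ = β₁ • C.b₁
  lie_a₂ : ⁅X, C.a₂⁆ = α₂ • C.a₂ + κ₂ • C.b₂
  lie_b₂ : ⁅X, C.b₂⁆ = β₂ • C.b₂

theorem IsSymmetry.preserves {C : CharacteristicFrame R} {X : Derivation ℝ R R}
    {x : Fin 4 → Fin 4 → R} (h : C.IsSymmetry X x) :
    C.Preserves X (x 0 0) (x 0 1) (x 1 1) (x 2 2) (x 2 3) (x 3 3) := by
  obtain ⟨h10, h12, h30, h32⟩ := h.vertical'
  obtain ⟨h13, h20, h31, h02⟩ := h.mixed'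
  obtain ⟨h03, h21⟩ := h.mixed_a
  constructor
  · simp [h.lie_a₁, h02, h03]
  · simp [h.lie_b₁, h10, h12, h13]
  · simp [h.lie_a₂, h20, h21]
  · simp [h.lie_b₂, h30, h31, h32]

namespace Preserves

variable {C} {X : Derivation ℝ R R} {α₁ κ₁ β₁ α₂ κ₂ β₂ : R}

theorem swap (h : C.Preserves X α₁ κ₁ β₁ α₂ κ₂ β₂) : C.swap.Preserves X α₂ κ₂ β₂ α₁ κ₁ β₁ :=
  ⟨h.lie_a₂, h.lie_b₂, h.lie_a₁, h.lie_b₁⟩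

theorem lie_A (h : C.Preserves X α₁ κ₁ β₁ α₂ κ₂ β₂) : ⁅X, C.A⁆ = (α₁ + β₁) • C.A -
    C.b₁ α₁ • C.a₁ + (C.a₁ β₁ - C.b₁ κ₁) • C.b₁ := by
  have h1 : ⁅X, C.A⁆ = ⁅⁅X, C.a₁⁆, C.b₁⁆ + ⁅C.a₁, ⁅X, C.b₁⁆⁆ := by
    rw [← C.lie_a₁_b₁, leibniz_lie]
  rw [h1, h.lie_a₁, h.lie_b₁]
  simp only [add_lie, lie_smul_derivation, smul_lie_derivation, C.lie_a₁_b₁, lie_self]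
  module

theorem lie_B (h : C.Preserves X α₁ κ₁ β₁ α₂ κ₂ β₂) : ⁅X, C.B⁆ = (α₂ + β₂) • C.B -
    C.b₂ α₂ • C.a₂ + (C.a₂ β₂ - C.b₂ κ₂) • C.b₂ := h.swap.lie_A

/-- Modulo the derivation directions other than `B`, u₁ B = [A, b₁]; the left side has weight α₂ +
β₂ besides X u₁, the right side α₁ + 2β₁. -/
theorem apply_u₁ (h : C.Preserves X α₁ κ₁ β₁ α₂ κ₂ β₂) :
    X C.u₁ = C.u₁ * (α₁ + 2 * β₁ - α₂ - β₂) := by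
  have hl := leibniz_lie X C.A C.b₁
  rw [C.lie_A_b₁, h.lie_A, h.lie_b₁] at hl
  simp only [lie_add, add_lie, sub_lie, lie_smul_derivation, smul_lie_derivation, C.lie_A_b₁,
    C.lie_a₁_b₁, lie_self, h.lie_a₁, h.lie_b₁, h.lie_a₂, h.lie_b₂, h.lie_A, h.lie_B] at hl
  have h5 := congrArg (C.θ 5) hl
  simp at h5
  linear_combination h5

theorem apply_u₂ (h : C.Preserves X α₁ κ₁ β₁ α₂ κ₂ β₂) :
    X C.u₂ = C.u₂ * (α₂ + 2 * β₂ - α₁ - β₁) := h.swap.apply_u₁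

/-- Both [A, a₁] and [B, a₂] have `Z`-component 1, so their weights under X agree. -/
theorem weights (h : C.Preserves X α₁ κ₁ β₁ α₂ κ₂ β₂) : 2 * α₁ + β₁ = 2 * α₂ + β₂ := by
  have h1 := leibniz_lie X C.A C.a₁
  have h2 := leibniz_lie X C.B C.a₂
  have hZ : C.Z = ⁅C.A, C.a₁⁆ := C.lie_A_a₁.symm
  rw [C.lie_B_a₂, C.lie_A_a₁.symm, lie_add, lie_add, lie_add, lie_add, lie_add, lie_add, h1] at h2
  rw [h.lie_A, h.lie_B, h.lie_a₁, h.lie_a₂] at h2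
  simp only [lie_add, add_lie, sub_lie, lie_smul_derivation, smul_lie_derivation, C.lie_A_b₁,
    lie_self, h.lie_a₁, h.lie_b₁, h.lie_a₂, h.lie_b₂, h.lie_A, h.lie_B, C.lie_A_a₁,
    C.lie_B_a₂, C.lie_B_b₂, lie_b₁_a₁, lie_b₂_a₂] at h2
  have h6 := congrArg (C.θ 6) h2
  simp at h6
  linear_combination h6

/-- The components of `[X, [b₁, a₂]] = [[X, b₁], a₂] + [b₁, [X, a₂]]`. -/
theorem lie_b₁_a₂ (h : C.Preserves X α₁ κ₁ β₁ α₂ κ₂ β₂) :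
    C.c 0 * κ₁ = C.p * κ₂ + α₂ * C.c 1 - C.a₂ β₁ - X (C.c 1) ∧
    C.b₁ α₂ = X (C.c 2) - β₁ * C.c 2 ∧
    C.b₁ κ₂ = X (C.c 3) + C.c 2 * κ₂ + C.c 3 * β₂ - (β₁ + α₂) * C.c 3 - κ₂ * C.q := by
  have hl := leibniz_lie X C.b₁ C.a₂
  rw [C.lie_b₁_a₂, h.lie_b₁, h.lie_a₂] at hl
  simp only [lie_add, lie_smul_derivation, smul_lie_derivation, C.lie_b₁_a₂,
    C.lie_b₁_b₂, h.lie_a₁, h.lie_b₁, h.lie_a₂, h.lie_b₂] at hl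
  have h1 := congrArg (C.θ 1) hl
  have h2 := congrArg (C.θ 2) hl
  have h3 := congrArg (C.θ 3) hl
  simp at h1 h2 h3
  refine ⟨?_, ?_, ?_⟩
  · linear_combination h1
  · linear_combination -h2
  · linear_combination -h3

theorem lie_b₂_a₁ (h : C.Preserves X α₁ κ₁ β₁ α₂ κ₂ β₂) :
    C.e 2 * κ₂ = -C.q * κ₁ + α₁ * C.e 3 - C.a₁ β₂ - X (C.e 3) ∧
    C.b₂ α₁ = X (C.e 0) - β₂ * C.e 0 ∧
    C.b₂ κ₁ = X (C.e 1) + C.e 0 * κ₁ + C.e 1 * β₁ - (β₂ + α₁) * C.e 1 + κ₁ * C.p := by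
  have h' := h.swap.lie_b₁_a₂
  simp [CharacteristicFrame.swap] at h' ⊢
  exact h'

/-- The components of `[X, [a₁, a₂]] = [[X, a₁], a₂] + [a₁, [X, a₂]]`. -/
theorem lie_a₁_a₂ (h : C.Preserves X α₁ κ₁ β₁ α₂ κ₂ β₂) :
    C.a₂ α₁ = -X (C.f 0) + α₂ * C.f 0 + κ₁ * C.c 0 - κ₂ * C.e 0 ∧
    C.a₂ κ₁ = -X (C.f 1) + α₁ * C.f 1 + κ₁ * C.c 1 + α₂ * C.f 1 - κ₂ * C.e 1
      - C.f 0 * κ₁ - C.f 1 * β₁ ∧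
    C.a₁ α₂ = X (C.f 2) - α₁ * C.f 2 - κ₁ * C.c 2 + κ₂ * C.e 2 ∧
    C.a₁ κ₂ = X (C.f 3) - α₁ * C.f 3 - κ₁ * C.c 3 - α₂ * C.f 3 + κ₂ * C.e 3
      + C.f 2 * κ₂ + C.f 3 * β₂ := by
  have hl := leibniz_lie X C.a₁ C.a₂
  rw [C.lie_a₁_a₂, h.lie_a₁, h.lie_a₂] at hl
  simp only [lie_add, add_lie, lie_smul_derivation, smul_lie_derivation, C.lie_b₁_a₂,
    C.lie_a₁_b₂, C.lie_a₁_a₂, h.lie_a₁, h.lie_b₁, h.lie_a₂, h.lie_b₂] at hl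
  have h0 := congrArg (C.θ 0) hl
  have h1 := congrArg (C.θ 1) hl
  have h2 := congrArg (C.θ 2) hl
  have h3 := congrArg (C.θ 3) hl
  simp at h0 h1 h2 h3
  refine ⟨?_, ?_, ?_, ?_⟩
  · linear_combination h0
  · linear_combination h1
  · linear_combination -h2
  · linear_combination -h3

/-- The heart of the bound: membership in `J` plays the role of being a linear combination of the
components of X, α₁ and κ₂. All the other unknowns are shown to lie in `J`, and then the first
derivatives of the generators along D. -/
theorem apply_mem (h : C.Preserves X α₁ κ₁ β₁ α₂ κ₂ β₂) (hu₁ : IsUnit C.u₁) (hu₂ : IsUnit C.u₂)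
    (J : Ideal R) (hX : ∀ g, X g ∈ J) (hα : α₁ ∈ J) (hκ : κ₂ ∈ J) :
    ∀ Y ∈ ({C.a₁, C.b₁, C.a₂, C.b₂} : Set (Derivation ℝ R R)),
      Y α₁ ∈ J ∧ Y κ₂ ∈ J ∧ ∀ g, Y (X g) ∈ J := by
  obtain ⟨hc, hbα, hbκ⟩ := h.lie_b₁_a₂
  obtain ⟨he, hbα', hbκ'⟩ := h.lie_b₂_a₁
  obtain ⟨ha₂α₁, ha₂κ₁, ha₁α₂, ha₁κ₂⟩ := h.lie_a₁_a₂
  have hce : IsUnit (C.c 0 * C.e 2) := by rw [C.c_mul_e]; exact hu₁.mul hu₂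
  have hc0 : IsUnit (C.c 0) := isUnit_of_mul_isUnit_left hce
  have he2 : IsUnit (C.e 2) := isUnit_of_mul_isUnit_right hce
  obtain ⟨w₁, hw₁⟩ := hu₁.exists_right_inv
  obtain ⟨w₂, hw₂⟩ := hu₂.exists_right_inv
  -- The weight relations are solved by dividing by 4; a real constant serves as the inverse, so
  -- derivations kill it.
  obtain ⟨k, hk, hYk⟩ : ∃ k : R, 4 * k = 1 ∧ ∀ Y : Derivation ℝ R R, Y k = 0 := by
    refine ⟨algebraMap ℝ R (1 / 4), ?_, fun Y => Y.map_algebraMap _⟩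
    rw [← map_ofNat (algebraMap ℝ R) 4, ← map_mul]
    norm_num
  have e1 : w₁ * X C.u₁ = α₁ + 2 * β₁ - α₂ - β₂ := by
    rw [h.apply_u₁]; linear_combination (α₁ + 2 * β₁ - α₂ - β₂) * hw₁
  have e2 : w₂ * X C.u₂ = α₂ + 2 * β₂ - α₁ - β₁ := by
    rw [h.apply_u₂]; linear_combination (α₂ + 2 * β₂ - α₁ - β₁) * hw₂
  have e3 := h.weights
  -- Three relations for four weights: everything is expressed through α₁ and the logarithmic
  -- derivatives of `u₁` and `u₂` along X.
  have hα₂ : α₂ = α₁ + k * (w₁ * X C.u₁ - w₂ * X C.u₂) := by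
    rw [e1, e2]; linear_combination (-k * 3) * e3 + (α₁ - α₂) * hk
  have hβ₁ : β₁ = k * (3 * (w₁ * X C.u₁) + w₂ * X C.u₂) := by
    rw [e1, e2]; linear_combination (-β₁) * hk + (-k) * e3
  have hβ₂ : β₂ = k * (w₁ * X C.u₁ + 3 * (w₂ * X C.u₂)) := by
    rw [e1, e2]; linear_combination (-β₂) * hk + k * e3
  have mα₂ : α₂ ∈ J := by
    rw [hα₂]
    exact J.add_mem hα (J.mul_mem_left _ (J.sub_mem (J.mul_mem_left _ (hX _))
      (J.mul_mem_left _ (hX _))))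
  have mβ₁ : β₁ ∈ J := by
    rw [hβ₁]
    exact J.mul_mem_left _ (J.add_mem (J.mul_mem_left _ (J.mul_mem_left _ (hX _)))
      (J.mul_mem_left _ (hX _)))
  have mβ₂ : β₂ ∈ J := by
    rw [hβ₂]
    exact J.mul_mem_left _ (J.add_mem (J.mul_mem_left _ (hX _))
      (J.mul_mem_left _ (J.mul_mem_left _ (hX _))))
  have comm : ∀ Y : Derivation ℝ R R, ∀ g, Y (X g) = X (Y g) - ⁅X, Y⁆ g := fun Y g => by
    rw [Derivation.commutator_apply]; ring
  have a₂X : ∀ g, C.a₂ (X g) ∈ J := fun g => by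
    rw [comm, h.lie_a₂]
    exact J.sub_mem (hX _) (J.add_mem (J.mul_mem_right _ mα₂) (J.mul_mem_right _ hκ))
  have Ylin : ∀ Y : Derivation ℝ R R, (∀ g, Y (X g) ∈ J) → ∀ w g, Y (w * X g) ∈ J := by
    intro Y hY w g
    rw [Derivation.leibniz]
    exact J.add_mem (J.mul_mem_left _ (hY g)) (J.mul_mem_right _ (hX g))
  -- The factor 3 is spelled as a repeated sum, so that additivity alone moves the derivation past
  -- it.
  have Yβ₁ : ∀ Y : Derivation ℝ R R, Y β₁ = k * (3 * Y (w₁ * X C.u₁) + Y (w₂ * X C.u₂)) := by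
    intro Y
    rw [hβ₁, show (3 : R) * (w₁ * X C.u₁) + w₂ * X C.u₂ =
      w₁ * X C.u₁ + w₁ * X C.u₁ + w₁ * X C.u₁ + w₂ * X C.u₂ by ring, Derivation.leibniz, hYk]
    simp only [map_add, smul_eq_mul]
    ring
  have Yβ₂ : ∀ Y : Derivation ℝ R R, Y β₂ = k * (Y (w₁ * X C.u₁) + 3 * Y (w₂ * X C.u₂)) := by
    intro Y
    rw [hβ₂, show w₁ * X C.u₁ + (3 : R) * (w₂ * X C.u₂) =
      w₁ * X C.u₁ + w₂ * X C.u₂ + w₂ * X C.u₂ + w₂ * X C.u₂ by ring, Derivation.leibniz, hYk]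
    simp only [map_add, smul_eq_mul]
    ring
  have Yα₂ : ∀ Y : Derivation ℝ R R, Y α₂ = Y α₁ + k * (Y (w₁ * X C.u₁) - Y (w₂ * X C.u₂)) := by
    intro Y
    rw [hα₂, map_add, Derivation.leibniz, hYk]
    simp only [map_sub, smul_eq_mul]
    ring
  -- The equation for `c 0 * κ₁` involves only the derivative of β₁ along a₂, and that one is
  -- already controlled: commuting X past a₂ costs only α₂ and κ₂. Once κ₁ is in `J`, derivatives
  -- along a₁ are controlled too.
  have mκ₁ : κ₁ ∈ J := by
    rw [← J.unit_mul_mem_iff_mem hc0, hc, Yβ₁]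
    refine J.sub_mem (J.sub_mem (J.add_mem (J.mul_mem_left _ hκ) (J.mul_mem_right _ mα₂)) ?_) (hX _)
    exact J.mul_mem_left _ (J.add_mem (J.mul_mem_left _ (Ylin _ a₂X _ _)) (Ylin _ a₂X _ _))
  have a₁X : ∀ g, C.a₁ (X g) ∈ J := fun g => by
    rw [comm, h.lie_a₁]
    exact J.sub_mem (hX _) (J.add_mem (J.mul_mem_right _ hα) (J.mul_mem_right _ mκ₁))
  have b₁X : ∀ g, C.b₁ (X g) ∈ J := fun g => by
    rw [comm, h.lie_b₁]
    exact J.sub_mem (hX _) (J.mul_mem_right _ mβ₁)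
  have b₂X : ∀ g, C.b₂ (X g) ∈ J := fun g => by
    rw [comm, h.lie_b₂]
    exact J.sub_mem (hX _) (J.mul_mem_right _ mβ₂)
  have diff : ∀ Y : Derivation ℝ R R, (∀ g, Y (X g) ∈ J) → (Y α₁ ∈ J ↔ Y α₂ ∈ J) := by
    intro Y hY
    rw [Yα₂]
    exact (J.add_mem_iff_left (J.mul_mem_left _ (J.sub_mem (Ylin _ hY _ _) (Ylin _ hY _ _)))).symm
  have b₁α₁ : C.b₁ α₁ ∈ J := by
    rw [diff _ b₁X, hbα]
    exact J.sub_mem (hX _) (J.mul_mem_right _ mβ₁)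
  have b₂α₁ : C.b₂ α₁ ∈ J := by
    rw [hbα']
    exact J.sub_mem (hX _) (J.mul_mem_right _ mβ₂)
  have a₁α₁ : C.a₁ α₁ ∈ J := by
    rw [diff _ a₁X, ha₁α₂]
    exact J.add_mem (J.sub_mem (J.sub_mem (hX _) (J.mul_mem_right _ hα)) (J.mul_mem_right _ mκ₁))
      (J.mul_mem_right _ hκ)
  have a₂α₁ : C.a₂ α₁ ∈ J := by
    rw [ha₂α₁]
    exact J.sub_mem (J.add_mem (J.add_mem (J.neg_mem (hX _)) (J.mul_mem_right _ mα₂))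
      (J.mul_mem_right _ mκ₁)) (J.mul_mem_right _ hκ)
  have b₁κ₂ : C.b₁ κ₂ ∈ J := by
    rw [hbκ]
    exact J.sub_mem (J.sub_mem (J.add_mem (J.add_mem (hX _) (J.mul_mem_left _ hκ))
      (J.mul_mem_left _ mβ₂)) (J.mul_mem_right _ (J.add_mem mβ₁ mα₂))) (J.mul_mem_right _ hκ)
  have b₂κ₁ : C.b₂ κ₁ ∈ J := by
    rw [hbκ']
    exact J.add_mem (J.sub_mem (J.add_mem (J.add_mem (hX _) (J.mul_mem_left _ mκ₁))
      (J.mul_mem_left _ mβ₁)) (J.mul_mem_right _ (J.add_mem mβ₂ hα))) (J.mul_mem_right _ mκ₁)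
  have a₂κ₁ : C.a₂ κ₁ ∈ J := by
    rw [ha₂κ₁]
    exact J.sub_mem (J.sub_mem (J.sub_mem (J.add_mem (J.add_mem (J.add_mem (J.neg_mem (hX _))
      (J.mul_mem_right _ hα)) (J.mul_mem_right _ mκ₁)) (J.mul_mem_right _ mα₂))
      (J.mul_mem_right _ hκ)) (J.mul_mem_left _ mκ₁)) (J.mul_mem_left _ mβ₁)
  have a₁κ₂ : C.a₁ κ₂ ∈ J := by
    rw [ha₁κ₂]
    exact J.add_mem (J.add_mem (J.add_mem (J.sub_mem (J.sub_mem (J.sub_mem (hX _)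
      (J.mul_mem_right _ hα)) (J.mul_mem_right _ mκ₁)) (J.mul_mem_right _ mα₂))
      (J.mul_mem_right _ hκ)) (J.mul_mem_left _ hκ)) (J.mul_mem_left _ mβ₂)
  -- No bracket equation gives a₂κ₂ or b₂κ₂ directly. Instead the relation for `e 2 * κ₂` is
  -- differentiated; a₂κ₁ and b₂κ₁ are known, and `e 2` is a unit.
  have second : ∀ Y : Derivation ℝ R R, (∀ g, Y (X g) ∈ J) → Y α₁ ∈ J → Y κ₁ ∈ J → Y κ₂ ∈ J := by
    intro Y hY hYα hYκ
    have a₁v : ∀ w g, Y (C.a₁ (w * X g)) ∈ J := by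
      intro w g
      rw [Derivation.leibniz, comm C.a₁, h.lie_a₁]
      simp only [Derivation.add_apply, Derivation.smul_apply, smul_eq_mul, map_add, map_sub,
        Derivation.leibniz]
      refine J.add_mem (J.add_mem (J.mul_mem_left _ (J.sub_mem (hY _) (J.add_mem (J.add_mem
        (J.mul_mem_right _ hα) (J.mul_mem_left _ hYα)) (J.add_mem (J.mul_mem_right _ mκ₁)
        (J.mul_mem_left _ hYκ))))) (J.mul_mem_right _ (J.sub_mem (hX _) (J.add_mem
        (J.mul_mem_right _ hα) (J.mul_mem_right _ mκ₁))))) (J.add_mem (J.mul_mem_right _ (hX _))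
        (J.mul_mem_left _ (hY _)))
    have hd := congrArg Y he
    rw [Yβ₂, show C.a₁ (w₁ * X C.u₁) + 3 * C.a₁ (w₂ * X C.u₂) = C.a₁ (w₁ * X C.u₁) +
      C.a₁ (w₂ * X C.u₂) + C.a₁ (w₂ * X C.u₂) + C.a₁ (w₂ * X C.u₂) by ring] at hd
    have hP := a₁v w₁ C.u₁
    have hQ := a₁v w₂ C.u₂
    generalize C.a₁ (w₁ * X C.u₁) = P at hd hP
    generalize C.a₁ (w₂ * X C.u₂) = Q at hd hQ
    simp only [Derivation.leibniz, map_sub, map_add, map_neg, smul_eq_mul, hYk] at hd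
    rw [← J.unit_mul_mem_iff_mem he2, eq_sub_of_add_eq hd]
    refine J.sub_mem (J.sub_mem (J.sub_mem (J.add_mem (J.add_mem (J.mul_mem_left _ hYκ)
      (J.mul_mem_right _ mκ₁)) (J.add_mem (J.mul_mem_right _ hα) (J.mul_mem_left _ hYα)))
      (J.add_mem (J.mul_mem_left _ (J.add_mem (J.add_mem (J.add_mem hP hQ) hQ) hQ))
      (by simp))) (hY _)) (J.mul_mem_right _ hκ)
  rintro Y (rfl | rfl | rfl | rfl)
  · exact ⟨a₁α₁, a₁κ₂, a₁X⟩
  · exact ⟨b₁α₁, b₁κ₂, b₁X⟩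
  · exact ⟨a₂α₁, second _ a₂X a₂α₁ a₂κ₁, a₂X⟩
  · exact ⟨b₂α₁, second _ b₂X b₂α₁ b₂κ₁, b₂X⟩

end Preserves

end CharacteristicFrame

end Algebra

/-! ### Smooth functions and vector fields on an open set, as a ring with derivations -/

section SmoothRing

open TopologicalSpace

theorem two_le_infty : (2 : WithTop ℕ∞) ≤ ∞ := WithTop.coe_le_coe.2 le_top

/-- The ring of smooth functions on an open subset of `ℝ⁷`. -/
def smoothRing (W : Opens R7) : Subalgebra ℝ (W → ℝ) where
  carrier := {f | ∃ F : R7 → ℝ, ContDiffOn ℝ ∞ F W ∧ ∀ u : W, F u = f u}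
  mul_mem' := by
    rintro f g ⟨F, hF, hf⟩ ⟨G, hG, hg⟩
    exact ⟨fun u => F u * G u, hF.mul hG, fun u => by simp [hf, hg]⟩
  add_mem' := by
    rintro f g ⟨F, hF, hf⟩ ⟨G, hG, hg⟩
    exact ⟨fun u => F u + G u, hF.add hG, fun u => by simp [hf, hg]⟩
  algebraMap_mem' c := ⟨fun _ => c, contDiffOn_const, fun _ => rfl⟩

namespace smoothRing

variable {W : Opens R7}

instance : CoeFun (smoothRing W) fun _ => W → ℝ := ⟨fun f => f.1⟩

/-- The restriction to `W` of a function that is smooth on `W`. -/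
def mk (F : R7 → ℝ) (hF : ContDiffOn ℝ ∞ F W) : smoothRing W := ⟨fun u => F u, F, hF, fun _ => rfl⟩

@[simp] theorem mk_apply (F : R7 → ℝ) (hF : ContDiffOn ℝ ∞ F W) (u : W) :
    (mk F hF : W → ℝ) u = F u :=
  rfl

@[ext] theorem ext {f g : smoothRing W} (h : ∀ u, f u = g u) : f = g := Subtype.ext (funext h)

@[simp] theorem add_apply (f g : smoothRing W) (u : W) : (f + g) u = f u + g u := rfl
@[simp] theorem sub_apply (f g : smoothRing W) (u : W) : (f - g) u = f u - g u := rfl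
@[simp] theorem mul_apply (f g : smoothRing W) (u : W) : (f * g) u = f u * g u := rfl
@[simp] theorem one_apply (u : W) : (1 : smoothRing W) u = 1 := rfl
@[simp] theorem smul_apply (c : ℝ) (f : smoothRing W) (u : W) : (c • f) u = c * f u := rfl

/-- Evaluation at a point. -/
def eval (u : W) : smoothRing W →ₐ[ℝ] ℝ := (Pi.evalAlgHom ℝ (fun _ : W => ℝ) u).comp (smoothRing W).val

@[simp] theorem eval_apply (u : W) (f : smoothRing W) : eval u f = f u := rfl

@[simp] theorem sum_apply {ι : Type*} (s : Finset ι) (f : ι → smoothRing W) (u : W) :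
    (∑ i ∈ s, f i) u = ∑ i ∈ s, f i u := map_sum (eval u) f s

/-- The extension by zero to `ℝ⁷`. -/
noncomputable def extend (f : smoothRing W) : R7 → ℝ := Function.extend Subtype.val f 0

@[simp] theorem extend_apply (f : smoothRing W) (u : W) : (extend f) u = f u :=
  Subtype.val_injective.extend_apply _ _ _

theorem extend_apply' (f : smoothRing W) {u : R7} (hu : u ∈ W) : (extend f) u = f ⟨u, hu⟩ :=
  extend_apply f ⟨u, hu⟩

theorem contDiffOn_extend (f : smoothRing W) : ContDiffOn ℝ ∞ (extend f) W := by
  obtain ⟨F, hF, h⟩ := f.2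
  exact hF.congr fun u hu => by rw [extend_apply' f hu, ← h]

theorem contDiffAt_extend (f : smoothRing W) (u : W) : ContDiffAt ℝ ∞ (extend f) u :=
  (contDiffOn_extend f).contDiffAt (W.isOpen.mem_nhds u.2)

theorem differentiableAt_extend (f : smoothRing W) (u : W) : DifferentiableAt ℝ (extend f) u :=
  (contDiffAt_extend f u).differentiableAt (by simp)

theorem extend_eventuallyEq (f : smoothRing W) {F : R7 → ℝ} (h : ∀ u : W, F u = f u) (u : W) :
    (extend f) =ᶠ[nhds (u : R7)] F := by
  filter_upwards [W.isOpen.mem_nhds u.2] with v hv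
  rw [extend_apply' f hv, ← h]

theorem isUnit {f : smoothRing W} (h : ∀ u, f u ≠ 0) : IsUnit f := by
  have hs : ContDiffOn ℝ ∞ (fun u => ((extend f) u)⁻¹) W :=
    (contDiffOn_extend f).inv fun u hu => by rw [extend_apply' f hu]; exact h _
  refine IsUnit.of_mul_eq_one (mk _ hs) (ext fun u => ?_)
  simp [h u]

theorem contDiffOn_fderiv_apply (f : smoothRing W) (k : Fin 7) :
    ContDiffOn ℝ ∞ (fun u => fderiv ℝ (extend f) u (Pi.single k 1)) W :=
  ((contDiffOn_extend f).fderiv_of_isOpen W.isOpen (by simp)).clm_apply contDiffOn_const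

/-- The coordinate vector fields. -/
noncomputable def partialD (k : Fin 7) : Derivation ℝ (smoothRing W) (smoothRing W) :=
  Derivation.mk'
    { toFun := fun f => mk _ ((contDiffOn_fderiv_apply f) k)
      map_add' := fun f g => ext fun u => by
        have h : (extend (f + g)) =ᶠ[nhds (u : R7)] (extend f) + (extend g) :=
          extend_eventuallyEq _ (fun u => by simp) u
        simp [h.fderiv_eq, fderiv_add ((differentiableAt_extend f) u) ((differentiableAt_extend g) u)]
      map_smul' := fun c f => ext fun u => by
        have h : (extend (c • f)) =ᶠ[nhds (u : R7)] c • (extend f) :=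
          extend_eventuallyEq _ (fun u => by simp) u
        simp [h.fderiv_eq, fderiv_const_smul ((differentiableAt_extend f) u)] }
    fun f g => ext fun u => by
      have h : (extend (f * g)) =ᶠ[nhds (u : R7)] (extend f) * (extend g) :=
        extend_eventuallyEq _ (fun u => by simp) u
      simp [h.fderiv_eq, fderiv_mul ((differentiableAt_extend f) u) ((differentiableAt_extend g) u)]

theorem partialD_apply (k : Fin 7) (f : smoothRing W) (u : W) :
    (partialD k f : smoothRing W) u = fderiv ℝ (extend f) u (Pi.single k 1) := rfl

theorem partialD_mk (k : Fin 7) (F : R7 → ℝ) (hF : ContDiffOn ℝ ∞ F W) (u : W) :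
    (partialD k (mk F hF) : smoothRing W) u = fderiv ℝ F u (Pi.single k 1) := by
  rw [partialD_apply, (extend_eventuallyEq (mk F hF) (F := F) (fun _ => rfl) u).fderiv_eq]

theorem partialD_comm (j k : Fin 7) (f : smoothRing W) :
    partialD j (partialD k f) = partialD k (partialD j f) := by
  ext u
  have key : ∀ i l : Fin 7, (partialD i (partialD l f) : smoothRing W) u =
      fderiv ℝ (fderiv ℝ (extend f)) u (Pi.single i 1) (Pi.single l 1) := by
    intro i l
    have hd : DifferentiableAt ℝ (fderiv ℝ (extend f)) u :=
      ((contDiffAt_extend f u).fderiv_right (m := 1) (one_add_one_eq_two.trans_le two_le_infty)).differentiableAt (by simp)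
    change (partialD i (mk _ ((contDiffOn_fderiv_apply f) l)) : smoothRing W) u = _
    rw [partialD_mk, fderiv_clm_apply hd (differentiableAt_const _)]
    simp
  rw [key, key]
  exact (contDiffAt_extend f u).isSymmSndFDerivAt (by simpa using two_le_infty) _ _

/-- The coordinate functions. -/
def coord (k : Fin 7) : smoothRing W := mk (fun u => u k) (by fun_prop)

@[simp] theorem coord_apply (k : Fin 7) (u : W) : (coord k : smoothRing W) u = u.1 k := rfl

theorem partialD_coord (j k : Fin 7) :
    partialD j (coord k : smoothRing W) = if j = k then 1 else 0 := by
  ext u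
  rw [coord, partialD_mk]
  have h : (fun u : R7 => u k) = dR k := rfl
  rw [h, ContinuousLinearMap.fderiv]
  by_cases hjk : j = k
  · subst hjk; simp [dR]
  · simp [dR, hjk, Ne.symm hjk]

theorem derivation_sum_apply {R ι : Type*} [CommRing R] [Algebra ℝ R] (s : Finset ι)
    (D : ι → Derivation ℝ R R) (f : R) : (∑ i ∈ s, D i) f = ∑ i ∈ s, D i f := by
  have h := map_sum (Derivation.coeFnAddMonoidHom (R := ℝ) (A := R) (M := R)) D s
  have h' := congrFun h f
  rw [Finset.sum_apply] at h'
  exact h'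

/-- The derivations given by vector fields. -/
def IsVectorField (Y : Derivation ℝ (smoothRing W) (smoothRing W)) : Prop :=
  Y = ∑ k, Y (coord k) • partialD k

theorem IsVectorField.apply {Y : Derivation ℝ (smoothRing W) (smoothRing W)}
    (h : IsVectorField Y) (f : smoothRing W) : Y f = ∑ k, Y (coord k) * partialD k f := by
  conv_lhs => rw [h]
  simp [derivation_sum_apply]

theorem isVectorField_iff {Y : Derivation ℝ (smoothRing W) (smoothRing W)} :
    IsVectorField Y ↔ ∀ f, Y f = ∑ k, Y (coord k) * partialD k f :=
  ⟨fun h => h.apply, fun h => Derivation.ext fun f => by simp [h f, derivation_sum_apply]⟩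

theorem isVectorField_sum (v : Fin 7 → smoothRing W) :
    IsVectorField (∑ k, v k • (partialD k : Derivation ℝ (smoothRing W) (smoothRing W))) := by
  rw [isVectorField_iff]
  intro f
  simp [derivation_sum_apply, partialD_coord]

theorem sum_apply_coord (v : Fin 7 → smoothRing W) (j : Fin 7) :
    (∑ k, v k • partialD k : Derivation ℝ (smoothRing W) (smoothRing W)) (coord j) = v j := by
  simp [derivation_sum_apply, partialD_coord]

namespace IsVectorField

variable {Y Z : Derivation ℝ (smoothRing W) (smoothRing W)}

theorem add (hY : IsVectorField Y) (hZ : IsVectorField Z) : IsVectorField (Y + Z) := by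
  rw [isVectorField_iff] at *
  intro f
  simp [hY f, hZ f, add_mul, Finset.sum_add_distrib]

theorem smul (g : smoothRing W) (hY : IsVectorField Y) : IsVectorField (g • Y) := by
  rw [isVectorField_iff] at *
  intro f
  simp [hY f, Finset.mul_sum, mul_assoc]

/-- The second order parts of Y Z and Z Y agree because coordinate derivatives commute, so the
commutator is again of first order. -/
theorem lie (hY : IsVectorField Y) (hZ : IsVectorField Z) : IsVectorField ⁅Y, Z⁆ := by
  rw [isVectorField_iff]
  intro f
  have key : ∀ {Y Z : Derivation ℝ (smoothRing W) (smoothRing W)}, IsVectorField Y →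
      IsVectorField Z → Y (Z f) = (∑ k, Y (Z (coord k)) * partialD k f) +
        ∑ k, ∑ j, Z (coord k) * Y (coord j) * partialD j (partialD k f) := by
    intro Y Z hY hZ
    rw [hZ.apply f, map_sum, ← Finset.sum_add_distrib]
    refine Finset.sum_congr rfl fun k _ => ?_
    rw [Derivation.leibniz, hY.apply (partialD k f)]
    simp [Finset.mul_sum, mul_assoc]
    ring
  rw [Derivation.commutator_apply, key hY hZ, key hZ hY,
    Finset.sum_comm (f := fun k j => Y (coord k) * Z (coord j) * partialD j (partialD k f))]
  simp only [Derivation.commutator_apply, sub_mul, Finset.sum_sub_distrib]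
  have : ∀ k j, Z (coord k) * Y (coord j) * partialD j (partialD k f) =
      Y (coord j) * Z (coord k) * partialD k (partialD j f) := fun k j => by
    rw [partialD_comm, mul_comm (Z _)]
  simp only [this]
  ring

/-- The vector of a vector field at a point. -/
theorem apply_mk (hY : IsVectorField Y) (F : R7 → ℝ) (hF : ContDiffOn ℝ ∞ F W) (u : W) :
    (Y (mk F hF) : smoothRing W) u = fderiv ℝ F u (fun k => (Y (coord k) : smoothRing W) u) := by
  rw [hY.apply]
  have : (fun k => (Y (coord k) : smoothRing W) u) =
      ∑ k, (Y (coord k) : smoothRing W) u • (Pi.single k 1 : R7) := by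
    ext j
    simp [Pi.single_apply]
  rw [this, map_sum]
  simp [partialD_mk]

end IsVectorField

end smoothRing

end SmoothRing

/-! ### The adapted frame of a hyperbolic equation in jet coordinates -/

section JetFrame

/-- The three conditions on (r, s, t) kill, respectively, the direction (ν², ν, 1), the direction
(1, μ, μ²), and both. When 1 - μν is invertible they are independent. -/
theorem vertical_eq_zero {R : Type*} [CommRing R] {μ ν i r s t : R} (inv : (1 - μ * ν) * i = 1)
    (hr : r - 2 * ν * s + ν ^ 2 * t = 0) (ht : μ ^ 2 * r - 2 * μ * s + t = 0)
    (rel : μ * r - (1 + μ * ν) * s + ν * t = 0) : r = 0 ∧ s = 0 ∧ t = 0 := by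
  have inv_sq : i ^ 2 * (1 - μ * ν) ^ 2 = 1 := by
    rw [← mul_pow, mul_comm, inv, one_pow]
  have hs : s = 0 := by
    linear_combination (i ^ 2) * (μ * hr + ν * ht - (1 + μ * ν) * rel) - s * inv_sq
  have e1 : r + ν ^ 2 * t = 0 := by linear_combination hr + 2 * ν * hs
  have e2 : μ ^ 2 * r + t = 0 := by linear_combination ht + 2 * μ * hs
  have e3 : μ * r + ν * t = 0 := by linear_combination rel + (1 + μ * ν) * hs
  refine ⟨?_, hs, ?_⟩
  · linear_combination i * (e1 - ν * e3) - r * inv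
  · linear_combination i * (e2 - μ * e3) - t * inv

/-- The data of a hyperbolic equation in terms of the ring of functions: the jet coordinates, the
characteristic slopes `μ` and `ν`, and lifts of total derivatives and of the characteristic
vertical directions. -/
structure JetFrame (R : Type*) [CommRing R] [Algebra ℝ R] where
  VF : Derivation ℝ R R → Prop
  add : ∀ {Y Y'}, VF Y → VF Y' → VF (Y + Y')
  smul : ∀ (g : R) {Y}, VF Y → VF (g • Y)
  lie : ∀ {Y Y'}, VF Y → VF Y' → VF ⁅Y, Y'⁆
  x : R
  y : R
  z : R
  p : R
  q : R
  r : R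
  s : R
  t : R
  μ : R
  ν : R
  i : R
  inv : (1 - μ * ν) * i = 1
  h : Fin 5 → R
  rel : ∀ Y, VF Y → μ * Y r - (1 + μ * ν) * Y s + ν * Y t =
    h 0 * Y x + h 1 * Y y + h 2 * Y z + h 3 * Y p + h 4 * Y q
  faithful : ∀ Y, VF Y → Y x = 0 → Y y = 0 → Y z = 0 → Y p = 0 → Y q = 0 → Y r = 0 → Y s = 0 →
    Y t = 0 → Y = 0
  ex : Derivation ℝ R R
  ey : Derivation ℝ R R
  b₁ : Derivation ℝ R R
  b₂ : Derivation ℝ R R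
  vf_ex : VF ex
  vf_ey : VF ey
  vf_b₁ : VF b₁
  vf_b₂ : VF b₂
  ex_table : ex x = 1 ∧ ex y = 0 ∧ ex z = p ∧ ex p = r ∧ ex q = s
  ey_table : ey x = 0 ∧ ey y = 1 ∧ ey z = q ∧ ey p = s ∧ ey q = t
  b₁_table : b₁ x = 0 ∧ b₁ y = 0 ∧ b₁ z = 0 ∧ b₁ p = 0 ∧ b₁ q = 0 ∧ b₁ r = 1 ∧ b₁ s = μ ∧
    b₁ t = μ ^ 2
  b₂_table : b₂ x = 0 ∧ b₂ y = 0 ∧ b₂ z = 0 ∧ b₂ p = 0 ∧ b₂ q = 0 ∧ b₂ r = ν ^ 2 ∧ b₂ s = ν ∧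
    b₂ t = 1

namespace JetFrame

variable {R : Type*} [CommRing R] [Algebra ℝ R] (F : JetFrame R)

/-- The differential of a function, as a linear form on derivations. -/
def diff (g : R) : Derivation ℝ R R →ₗ[R] R where
  toFun Y := Y g
  map_add' _ _ := rfl
  map_smul' _ _ := rfl

@[simp] theorem diff_apply (g : R) (Y : Derivation ℝ R R) : diff g Y = Y g := rfl

/-- The contact forms. -/
def ω₁ : Derivation ℝ R R →ₗ[R] R := diff F.z - F.p • diff F.x - F.q • diff F.y
def ω₂ : Derivation ℝ R R →ₗ[R] R := diff F.p - F.r • diff F.x - F.s • diff F.y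
def ω₃ : Derivation ℝ R R →ₗ[R] R := diff F.q - F.s • diff F.x - F.t • diff F.y

theorem ω₁_apply (Y) : F.ω₁ Y = Y F.z - F.p * Y F.x - F.q * Y F.y := rfl
theorem ω₂_apply (Y) : F.ω₂ Y = Y F.p - F.r * Y F.x - F.s * Y F.y := rfl
theorem ω₃_apply (Y) : F.ω₃ Y = Y F.q - F.s * Y F.x - F.t * Y F.y := rfl

theorem ω₁_lie (Y Y' : Derivation ℝ R R) : F.ω₁ ⁅Y, Y'⁆ = Y (F.ω₁ Y') - Y' (F.ω₁ Y) +
    (F.ω₂ Y * Y' F.x - F.ω₂ Y' * Y F.x) + (F.ω₃ Y * Y' F.y - F.ω₃ Y' * Y F.y) := by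
  simp only [ω₁_apply, ω₂_apply, ω₃_apply, Derivation.commutator_apply, map_sub,
    Derivation.leibniz, smul_eq_mul]
  ring

theorem ω₂_lie (Y Y' : Derivation ℝ R R) : F.ω₂ ⁅Y, Y'⁆ = Y (F.ω₂ Y') - Y' (F.ω₂ Y) +
    (Y F.r * Y' F.x - Y' F.r * Y F.x) + (Y F.s * Y' F.y - Y' F.s * Y F.y) := by
  simp only [ω₂_apply, Derivation.commutator_apply, map_sub,
    Derivation.leibniz, smul_eq_mul]
  ring

theorem ω₃_lie (Y Y' : Derivation ℝ R R) : F.ω₃ ⁅Y, Y'⁆ = Y (F.ω₃ Y') - Y' (F.ω₃ Y) +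
    (Y F.s * Y' F.x - Y' F.s * Y F.x) + (Y F.t * Y' F.y - Y' F.t * Y F.y) := by
  simp only [ω₃_apply, Derivation.commutator_apply, map_sub,
    Derivation.leibniz, smul_eq_mul]
  ring

theorem vf_neg {Y : Derivation ℝ R R} (h : F.VF Y) : F.VF (-Y) := by
  simpa using F.smul (-1) h

theorem vf_sub {Y Y' : Derivation ℝ R R} (h : F.VF Y) (h' : F.VF Y') : F.VF (Y - Y') := by
  rw [sub_eq_add_neg]; exact F.add h (F.vf_neg h')

/-- Horizontal characteristic directions, before normalization. -/
def a₁' : Derivation ℝ R R := F.ν • F.ey - F.ex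
def a₂' : Derivation ℝ R R := F.ey - F.μ • F.ex
-- The multiple of b₂ here, and that of b₁ in `a₂`, alter [a₁, a₂] modulo D by multiples of [b₂, a₂]
-- and [a₁, b₁]. They are chosen to cancel the part of that bracket outside D.
def a₁ : Derivation ℝ R R :=
  F.a₁' - ((F.ω₃ ⁅F.a₁', F.a₂'⁆ - F.μ * F.ω₂ ⁅F.a₁', F.a₂'⁆) * F.i ^ 2) • F.b₂
def a₂ : Derivation ℝ R R :=
  F.a₂' - ((F.ω₂ ⁅F.a₁', F.a₂'⁆ - F.ν * F.ω₃ ⁅F.a₁', F.a₂'⁆) * F.i ^ 2) • F.b₁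
def A : Derivation ℝ R R := ⁅F.a₁, F.b₁⁆
def B : Derivation ℝ R R := ⁅F.a₂, F.b₂⁆
def Z : Derivation ℝ R R := ⁅F.A, F.a₁⁆

theorem vf_a₁ : F.VF F.a₁ :=
  F.vf_sub (F.vf_sub (F.smul _ F.vf_ey) F.vf_ex) (F.smul _ F.vf_b₂)
theorem vf_a₂ : F.VF F.a₂ :=
  F.vf_sub (F.vf_sub F.vf_ey (F.smul _ F.vf_ex)) (F.smul _ F.vf_b₁)
theorem vf_A : F.VF F.A := F.lie F.vf_a₁ F.vf_b₁
theorem vf_B : F.VF F.B := F.lie F.vf_a₂ F.vf_b₂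
theorem vf_Z : F.VF F.Z := F.lie F.vf_A F.vf_a₁

@[simp] theorem b₁_x : F.b₁ F.x = 0 := F.b₁_table.1
@[simp] theorem b₁_y : F.b₁ F.y = 0 := F.b₁_table.2.1
@[simp] theorem b₁_z : F.b₁ F.z = 0 := F.b₁_table.2.2.1
@[simp] theorem b₁_p : F.b₁ F.p = 0 := F.b₁_table.2.2.2.1
@[simp] theorem b₁_q : F.b₁ F.q = 0 := F.b₁_table.2.2.2.2.1
@[simp] theorem b₁_r : F.b₁ F.r = 1 := F.b₁_table.2.2.2.2.2.1
@[simp] theorem b₁_s : F.b₁ F.s = F.μ := F.b₁_table.2.2.2.2.2.2.1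
@[simp] theorem b₁_t : F.b₁ F.t = F.μ ^ 2 := F.b₁_table.2.2.2.2.2.2.2
@[simp] theorem b₂_x : F.b₂ F.x = 0 := F.b₂_table.1
@[simp] theorem b₂_y : F.b₂ F.y = 0 := F.b₂_table.2.1
@[simp] theorem b₂_z : F.b₂ F.z = 0 := F.b₂_table.2.2.1
@[simp] theorem b₂_p : F.b₂ F.p = 0 := F.b₂_table.2.2.2.1
@[simp] theorem b₂_q : F.b₂ F.q = 0 := F.b₂_table.2.2.2.2.1
@[simp] theorem b₂_r : F.b₂ F.r = F.ν ^ 2 := F.b₂_table.2.2.2.2.2.1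
@[simp] theorem b₂_s : F.b₂ F.s = F.ν := F.b₂_table.2.2.2.2.2.2.1
@[simp] theorem b₂_t : F.b₂ F.t = 1 := F.b₂_table.2.2.2.2.2.2.2

theorem a_table : (F.a₁ F.x = -1 ∧ F.a₁ F.y = F.ν ∧ F.ω₁ F.a₁ = 0 ∧ F.ω₂ F.a₁ = 0 ∧ F.ω₃ F.a₁ = 0) ∧
    (F.a₂ F.x = -F.μ ∧ F.a₂ F.y = 1 ∧ F.ω₁ F.a₂ = 0 ∧ F.ω₂ F.a₂ = 0 ∧ F.ω₃ F.a₂ = 0) := by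
  simp only [a₁, a₂, a₁', a₂', ω₁_apply, ω₂_apply, ω₃_apply]
  generalize F.ω₃ _ = g
  generalize F.ω₂ _ = g'
  simp [F.ex_table, F.ey_table]
  ring_nf
  simp

@[simp] theorem a₁_x : F.a₁ F.x = -1 := F.a_table.1.1
@[simp] theorem a₁_y : F.a₁ F.y = F.ν := F.a_table.1.2.1
@[simp] theorem ω₁_a₁ : F.ω₁ F.a₁ = 0 := F.a_table.1.2.2.1
@[simp] theorem ω₂_a₁ : F.ω₂ F.a₁ = 0 := F.a_table.1.2.2.2.1
@[simp] theorem ω₃_a₁ : F.ω₃ F.a₁ = 0 := F.a_table.1.2.2.2.2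
@[simp] theorem a₂_x : F.a₂ F.x = -F.μ := F.a_table.2.1
@[simp] theorem a₂_y : F.a₂ F.y = 1 := F.a_table.2.2.1
@[simp] theorem ω₁_a₂ : F.ω₁ F.a₂ = 0 := F.a_table.2.2.2.1
@[simp] theorem ω₂_a₂ : F.ω₂ F.a₂ = 0 := F.a_table.2.2.2.2.1
@[simp] theorem ω₃_a₂ : F.ω₃ F.a₂ = 0 := F.a_table.2.2.2.2.2
@[simp] theorem ω₁_b₁ : F.ω₁ F.b₁ = 0 := by simp [ω₁_apply]
@[simp] theorem ω₂_b₁ : F.ω₂ F.b₁ = 0 := by simp [ω₂_apply]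
@[simp] theorem ω₃_b₁ : F.ω₃ F.b₁ = 0 := by simp [ω₃_apply]
@[simp] theorem ω₁_b₂ : F.ω₁ F.b₂ = 0 := by simp [ω₁_apply]
@[simp] theorem ω₂_b₂ : F.ω₂ F.b₂ = 0 := by simp [ω₂_apply]
@[simp] theorem ω₃_b₂ : F.ω₃ F.b₂ = 0 := by simp [ω₃_apply]
@[simp] theorem ω₁_A : F.ω₁ F.A = 0 := by simp [A, ω₁_lie]
@[simp] theorem ω₂_A : F.ω₂ F.A = 1 - F.μ * F.ν := by simp [A, ω₂_lie]; ring
@[simp] theorem ω₃_A : F.ω₃ F.A = F.μ * (1 - F.μ * F.ν) := by simp [A, ω₃_lie]; ring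
@[simp] theorem ω₁_B : F.ω₁ F.B = 0 := by simp [B, ω₁_lie]
@[simp] theorem ω₂_B : F.ω₂ F.B = -F.ν * (1 - F.μ * F.ν) := by simp [B, ω₂_lie]; ring
@[simp] theorem ω₃_B : F.ω₃ F.B = -(1 - F.μ * F.ν) := by simp [B, ω₃_lie]; ring
@[simp] theorem ω₁_Z : F.ω₁ F.Z = -(1 - F.μ * F.ν) ^ 2 := by simp [Z, ω₁_lie]; ring

theorem inv_sq : F.i ^ 2 * (1 - F.μ * F.ν) ^ 2 = 1 := by
  rw [← mul_pow, mul_comm, F.inv, one_pow]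

theorem a'_table : (F.a₁' F.x = -1 ∧ F.a₁' F.y = F.ν ∧ F.ω₂ F.a₁' = 0 ∧ F.ω₃ F.a₁' = 0) ∧
    (F.a₂' F.x = -F.μ ∧ F.a₂' F.y = 1 ∧ F.ω₂ F.a₂' = 0 ∧ F.ω₃ F.a₂' = 0) := by
  simp only [a₁', a₂', ω₂_apply, ω₃_apply]
  simp [F.ex_table, F.ey_table]
  ring_nf
  simp

theorem contact_a₁_a₂ : F.ω₁ ⁅F.a₁, F.a₂⁆ = 0 ∧ F.ω₂ ⁅F.a₁, F.a₂⁆ = 0 ∧ F.ω₃ ⁅F.a₁, F.a₂⁆ = 0 := by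
  have h2 := F.ω₂_lie F.a₁' F.a₂'
  have h3 := F.ω₃_lie F.a₁' F.a₂'
  simp [F.a'_table] at h2 h3
  refine ⟨by simp [ω₁_lie], ?_, ?_⟩
  · rw [ω₂_lie]
    simp
    simp only [a₁, a₂]
    generalize F.ω₂ ⁅F.a₁', F.a₂'⁆ = m at *
    generalize F.ω₃ ⁅F.a₁', F.a₂'⁆ = n at *
    simp
    linear_combination -h2 - m * F.inv_sq
  · rw [ω₃_lie]
    simp
    simp only [a₁, a₂]
    generalize F.ω₂ ⁅F.a₁', F.a₂'⁆ = m at *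
    generalize F.ω₃ ⁅F.a₁', F.a₂'⁆ = n at *
    simp
    linear_combination -h3 - n * F.inv_sq

/-- The coframe dual to `a₁, b₁, a₂, b₂, A, B, Z`. -/
def θ₆ : Derivation ℝ R R →ₗ[R] R := -(F.i ^ 2 • F.ω₁)
def θ₄ : Derivation ℝ R R →ₗ[R] R :=
  F.i ^ 2 • (F.ω₂ - F.ν • F.ω₃ - (F.ω₂ F.Z - F.ν * F.ω₃ F.Z) • F.θ₆)
def θ₅ : Derivation ℝ R R →ₗ[R] R :=
  F.i ^ 2 • (F.μ • F.ω₂ - F.ω₃ - (F.μ * F.ω₂ F.Z - F.ω₃ F.Z) • F.θ₆)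
/-- The part of a linear form that vanishes on `A`, `B` and `Z`. -/
def reduce (η : Derivation ℝ R R →ₗ[R] R) : Derivation ℝ R R →ₗ[R] R :=
  η - η F.A • F.θ₄ - η F.B • F.θ₅ - η F.Z • F.θ₆
def θ₀ : Derivation ℝ R R →ₗ[R] R := -(F.i • F.reduce (diff F.x + F.μ • diff F.y))
def θ₂ : Derivation ℝ R R →ₗ[R] R := F.i • F.reduce (F.ν • diff F.x + diff F.y)
def θ₁ : Derivation ℝ R R →ₗ[R] R :=
  F.i ^ 2 • (F.reduce (diff F.r - (2 * F.ν) • diff F.s + F.ν ^ 2 • diff F.t) -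
    (F.reduce (diff F.r - (2 * F.ν) • diff F.s + F.ν ^ 2 • diff F.t) F.a₁) • F.θ₀ -
    (F.reduce (diff F.r - (2 * F.ν) • diff F.s + F.ν ^ 2 • diff F.t) F.a₂) • F.θ₂)
def θ₃ : Derivation ℝ R R →ₗ[R] R :=
  F.i ^ 2 • (F.reduce (F.μ ^ 2 • diff F.r - (2 * F.μ) • diff F.s + diff F.t) -
    (F.reduce (F.μ ^ 2 • diff F.r - (2 * F.μ) • diff F.s + diff F.t) F.a₁) • F.θ₀ -
    (F.reduce (F.μ ^ 2 • diff F.r - (2 * F.μ) • diff F.s + diff F.t) F.a₂) • F.θ₂)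

theorem θ₆_frame : F.θ₆ F.a₁ = 0 ∧ F.θ₆ F.b₁ = 0 ∧ F.θ₆ F.a₂ = 0 ∧ F.θ₆ F.b₂ = 0 ∧ F.θ₆ F.A = 0 ∧
    F.θ₆ F.B = 0 ∧ F.θ₆ F.Z = 1 := by
  simp [θ₆, F.inv_sq]

theorem θ₄_frame : F.θ₄ F.a₁ = 0 ∧ F.θ₄ F.b₁ = 0 ∧ F.θ₄ F.a₂ = 0 ∧ F.θ₄ F.b₂ = 0 ∧ F.θ₄ F.A = 1 ∧
    F.θ₄ F.B = 0 ∧ F.θ₄ F.Z = 0 := by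
  simp [θ₄, F.θ₆_frame]
  constructor
  · linear_combination F.inv_sq
  · ring

theorem θ₅_frame : F.θ₅ F.a₁ = 0 ∧ F.θ₅ F.b₁ = 0 ∧ F.θ₅ F.a₂ = 0 ∧ F.θ₅ F.b₂ = 0 ∧ F.θ₅ F.A = 0 ∧
    F.θ₅ F.B = 1 ∧ F.θ₅ F.Z = 0 := by
  simp [θ₅, F.θ₆_frame]
  linear_combination F.inv_sq

theorem reduce_frame (η : Derivation ℝ R R →ₗ[R] R) : F.reduce η F.a₁ = η F.a₁ ∧
    F.reduce η F.b₁ = η F.b₁ ∧ F.reduce η F.a₂ = η F.a₂ ∧ F.reduce η F.b₂ = η F.b₂ ∧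
    F.reduce η F.A = 0 ∧ F.reduce η F.B = 0 ∧ F.reduce η F.Z = 0 := by
  simp [reduce, F.θ₆_frame, F.θ₅_frame, F.θ₄_frame]

theorem θ₀_frame : F.θ₀ F.a₁ = 1 ∧ F.θ₀ F.b₁ = 0 ∧ F.θ₀ F.a₂ = 0 ∧ F.θ₀ F.b₂ = 0 ∧ F.θ₀ F.A = 0 ∧
    F.θ₀ F.B = 0 ∧ F.θ₀ F.Z = 0 := by
  simp [θ₀, F.reduce_frame]
  linear_combination F.inv

theorem θ₂_frame : F.θ₂ F.a₁ = 0 ∧ F.θ₂ F.b₁ = 0 ∧ F.θ₂ F.a₂ = 1 ∧ F.θ₂ F.b₂ = 0 ∧ F.θ₂ F.A = 0 ∧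
    F.θ₂ F.B = 0 ∧ F.θ₂ F.Z = 0 := by
  simp [θ₂, F.reduce_frame]
  linear_combination F.inv

theorem θ₁_frame : F.θ₁ F.a₁ = 0 ∧ F.θ₁ F.b₁ = 1 ∧ F.θ₁ F.a₂ = 0 ∧ F.θ₁ F.b₂ = 0 ∧ F.θ₁ F.A = 0 ∧
    F.θ₁ F.B = 0 ∧ F.θ₁ F.Z = 0 := by
  simp [θ₁, F.reduce_frame, F.θ₀_frame, F.θ₂_frame]
  constructor
  · linear_combination F.inv_sq
  · ring

theorem θ₃_frame : F.θ₃ F.a₁ = 0 ∧ F.θ₃ F.b₁ = 0 ∧ F.θ₃ F.a₂ = 0 ∧ F.θ₃ F.b₂ = 1 ∧ F.θ₃ F.A = 0 ∧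
    F.θ₃ F.B = 0 ∧ F.θ₃ F.Z = 0 := by
  simp [θ₃, F.reduce_frame, F.θ₀_frame, F.θ₂_frame]
  constructor
  · ring
  · linear_combination F.inv_sq


/-- The contact forms reduce Y to a vertical field; the linearized equation then supplies the third
of the conditions in `vertical_eq_zero`. -/
theorem eq_zero_of_forms {Y : Derivation ℝ R R} (hY : F.VF Y) (hx : Y F.x = 0) (hy : Y F.y = 0)
    (h₁ : F.ω₁ Y = 0) (h₂ : F.ω₂ Y = 0) (h₃ : F.ω₃ Y = 0)
    (hr : Y F.r - 2 * F.ν * Y F.s + F.ν ^ 2 * Y F.t = 0)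
    (ht : F.μ ^ 2 * Y F.r - 2 * F.μ * Y F.s + Y F.t = 0) : Y = 0 := by
  simp only [ω₁_apply, ω₂_apply, ω₃_apply, hx, hy, mul_zero, sub_zero] at h₁ h₂ h₃
  have rel := F.rel Y hY
  simp only [hx, hy, h₁, h₂, h₃, mul_zero, add_zero] at rel
  obtain ⟨hr', hs, ht'⟩ := vertical_eq_zero F.inv hr ht (rel.trans (by ring))
  exact F.faithful Y hY hx hy h₁ h₂ h₃ hr' hs ht'

/-- The difference of the two sides is killed by the whole coframe. Solving back, with 1 - μν
invertible, gives the hypotheses of `eq_zero_of_forms`. -/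
theorem expand {Y : Derivation ℝ R R} (hY : F.VF Y) : Y = F.θ₀ Y • F.a₁ + F.θ₁ Y • F.b₁ +
    F.θ₂ Y • F.a₂ + F.θ₃ Y • F.b₂ + F.θ₄ Y • F.A + F.θ₅ Y • F.B + F.θ₆ Y • F.Z := by
  rw [← sub_eq_zero]
  set Y' := Y - (F.θ₀ Y • F.a₁ + F.θ₁ Y • F.b₁ + F.θ₂ Y • F.a₂ + F.θ₃ Y • F.b₂ + F.θ₄ Y • F.A +
    F.θ₅ Y • F.B + F.θ₆ Y • F.Z) with hY'
  have vf : F.VF Y' := F.vf_sub hY (F.add (F.add (F.add (F.add (F.add (F.add (F.smul _ F.vf_a₁)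
    (F.smul _ F.vf_b₁)) (F.smul _ F.vf_a₂)) (F.smul _ F.vf_b₂)) (F.smul _ F.vf_A))
    (F.smul _ F.vf_B)) (F.smul _ F.vf_Z))
  have k0 : F.θ₀ Y' = 0 := by simp [hY', F.θ₀_frame]
  have k1 : F.θ₁ Y' = 0 := by simp [hY', F.θ₁_frame]
  have k2 : F.θ₂ Y' = 0 := by simp [hY', F.θ₂_frame]
  have k3 : F.θ₃ Y' = 0 := by simp [hY', F.θ₃_frame]
  have k4 : F.θ₄ Y' = 0 := by simp [hY', F.θ₄_frame]
  have k5 : F.θ₅ Y' = 0 := by simp [hY', F.θ₅_frame]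
  have k6 : F.θ₆ Y' = 0 := by simp [hY', F.θ₆_frame]
  clear_value Y'
  have red : ∀ η, F.reduce η Y' = η Y' := fun η => by simp [reduce, k4, k5, k6]
  have hi := F.inv
  have hi2 := F.inv_sq
  have h1 : F.ω₁ Y' = 0 := by
    simp [θ₆] at k6
    linear_combination (1 - F.μ * F.ν) ^ 2 * k6 - F.ω₁ Y' * hi2
  simp [θ₄, k6] at k4
  simp [θ₅, k6] at k5
  simp [θ₀, red] at k0
  simp [θ₂, red] at k2
  have h2 : F.ω₂ Y' = 0 := by
    linear_combination (1 - F.μ * F.ν) * (k4 - F.ν * k5) - F.ω₂ Y' * hi2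
  have h3 : F.ω₃ Y' = 0 := by
    linear_combination (1 - F.μ * F.ν) * (F.μ * k4 - k5) - F.ω₃ Y' * hi2
  have hx : Y' F.x = 0 := by linear_combination k0 - F.μ * k2 - Y' F.x * hi
  have hy : Y' F.y = 0 := by linear_combination k2 - F.ν * k0 - Y' F.y * hi
  have z0 : F.θ₀ Y' = 0 := by simp [θ₀, red, hx, hy]
  have z2 : F.θ₂ Y' = 0 := by simp [θ₂, red, hx, hy]
  simp only [θ₁, LinearMap.smul_apply, LinearMap.sub_apply, red, z0, z2, smul_eq_mul] at k1
  simp only [θ₃, LinearMap.smul_apply, LinearMap.sub_apply, red, z0, z2, smul_eq_mul] at k3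
  simp at k1 k3
  refine F.eq_zero_of_forms vf hx hy h1 h2 h3 ?_ ?_
  · linear_combination (1 - F.μ * F.ν) ^ 2 * k1 -
      (Y' F.r - 2 * F.ν * Y' F.s + F.ν ^ 2 * Y' F.t) * hi2
  · linear_combination (1 - F.μ * F.ν) ^ 2 * k3 -
      (F.μ ^ 2 * Y' F.r - 2 * F.μ * Y' F.s + Y' F.t) * hi2

/-- Vector fields annihilated by the contact forms. -/
structure IsContact (Y : Derivation ℝ R R) : Prop where
  vf : F.VF Y
  ω₁ : F.ω₁ Y = 0
  ω₂ : F.ω₂ Y = 0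
  ω₃ : F.ω₃ Y = 0

theorem isContact_a₁ : F.IsContact F.a₁ := ⟨F.vf_a₁, by simp, by simp, by simp⟩
theorem isContact_b₁ : F.IsContact F.b₁ := ⟨F.vf_b₁, by simp, by simp, by simp⟩
theorem isContact_a₂ : F.IsContact F.a₂ := ⟨F.vf_a₂, by simp, by simp, by simp⟩
theorem isContact_b₂ : F.IsContact F.b₂ := ⟨F.vf_b₂, by simp, by simp, by simp⟩

variable {F} in
theorem IsContact.expand {Y : Derivation ℝ R R} (hY : F.IsContact Y) :
    Y = F.θ₀ Y • F.a₁ + F.θ₁ Y • F.b₁ + F.θ₂ Y • F.a₂ + F.θ₃ Y • F.b₂ := by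
  have h := F.expand hY.vf
  have h6 : F.θ₆ Y = 0 := by simp [θ₆, hY.ω₁]
  have h4 : F.θ₄ Y = 0 := by simp [θ₄, hY.ω₂, hY.ω₃, h6]
  have h5 : F.θ₅ Y = 0 := by simp [θ₅, hY.ω₂, hY.ω₃, h6]
  simpa [h4, h5, h6] using h

theorem θ₄_of_ω₁ {Y : Derivation ℝ R R} (h : F.ω₁ Y = 0) :
    F.θ₄ Y = F.i ^ 2 * (F.ω₂ Y - F.ν * F.ω₃ Y) := by simp [θ₄, θ₆, h]

theorem θ₅_of_ω₁ {Y : Derivation ℝ R R} (h : F.ω₁ Y = 0) :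
    F.θ₅ Y = F.i ^ 2 * (F.μ * F.ω₂ Y - F.ω₃ Y) := by simp [θ₅, θ₆, h]

theorem isContact_lie_b₁_b₂ : F.IsContact ⁅F.b₁, F.b₂⁆ :=
  ⟨F.lie F.vf_b₁ F.vf_b₂, by simp [ω₁_lie], by simp [ω₂_lie], by simp [ω₃_lie]⟩

theorem isContact_lie_b₁_a₂ : F.IsContact ⁅F.b₁, F.a₂⁆ :=
  ⟨F.lie F.vf_b₁ F.vf_a₂, by simp [ω₁_lie], by simp [ω₂_lie], by simp [ω₃_lie]; ring⟩

theorem isContact_lie_b₂_a₁ : F.IsContact ⁅F.b₂, F.a₁⁆ :=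
  ⟨F.lie F.vf_b₂ F.vf_a₁, by simp [ω₁_lie], by simp [ω₂_lie]; ring, by simp [ω₃_lie]⟩

theorem isContact_lie_a₁_a₂ : F.IsContact ⁅F.a₁, F.a₂⁆ :=
  ⟨F.lie F.vf_a₁ F.vf_a₂, F.contact_a₁_a₂.1, F.contact_a₁_a₂.2.1, F.contact_a₁_a₂.2.2⟩

/-- The bracket kills x and y along with b₁ and b₂, which excludes components along a₁ and a₂. -/
theorem lie_b₁_b₂_eq : ⁅F.b₁, F.b₂⁆ = F.θ₁ ⁅F.b₁, F.b₂⁆ • F.b₁ + F.θ₃ ⁅F.b₁, F.b₂⁆ • F.b₂ := by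
  have h := F.isContact_lie_b₁_b₂.expand
  have hv : ∀ η, F.reduce η ⁅F.b₁, F.b₂⁆ = η ⁅F.b₁, F.b₂⁆ := by
    intro η
    have h := F.isContact_lie_b₁_b₂
    simp [reduce, F.θ₄_of_ω₁ h.ω₁, F.θ₅_of_ω₁ h.ω₁, h.ω₂, h.ω₃, θ₆, h.ω₁]
  have h0 : F.θ₀ ⁅F.b₁, F.b₂⁆ = 0 := by simp [θ₀, hv, Derivation.commutator_apply]
  have h2 : F.θ₂ ⁅F.b₁, F.b₂⁆ = 0 := by simp [θ₂, hv, Derivation.commutator_apply]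
  simpa [h0, h2] using h

/-- The form μω² - ω³ vanishes on D and on `A`, so on [A, b₁] it sees only the variation of μ along
b₁. This identifies the invariant `u₁` of the frame. -/
theorem θ₅_lie_A_b₁ : F.θ₆ ⁅F.A, F.b₁⁆ = 0 ∧ F.θ₅ ⁅F.A, F.b₁⁆ = F.i * F.b₁ F.μ := by
  have h : F.ω₁ ⁅F.A, F.b₁⁆ = 0 := by simp [ω₁_lie]
  refine ⟨by simp [θ₆, h], ?_⟩
  rw [F.θ₅_of_ω₁ h, ω₂_lie, ω₃_lie]
  simp
  linear_combination (F.i * F.b₁ F.μ) * F.inv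

theorem θ₄_lie_B_b₂ : F.θ₆ ⁅F.B, F.b₂⁆ = 0 ∧ F.θ₄ ⁅F.B, F.b₂⁆ = F.i * F.b₂ F.ν := by
  have h : F.ω₁ ⁅F.B, F.b₂⁆ = 0 := by simp [ω₁_lie]
  refine ⟨by simp [θ₆, h], ?_⟩
  rw [F.θ₄_of_ω₁ h, ω₂_lie, ω₃_lie]
  simp
  linear_combination (F.i * F.b₂ F.ν) * F.inv

theorem θ₆_lie_B_a₂ : F.θ₆ ⁅F.B, F.a₂⁆ = 1 := by
  simp [θ₆, ω₁_lie]
  linear_combination F.inv_sq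

/-- The adapted frame of a hyperbolic equation. -/
def frame : CharacteristicFrame R where
  a₁ := F.a₁
  b₁ := F.b₁
  a₂ := F.a₂
  b₂ := F.b₂
  A := F.A
  B := F.B
  Z := F.Z
  θ := ![F.θ₀, F.θ₁, F.θ₂, F.θ₃, F.θ₄, F.θ₅, F.θ₆]
  dual := by
    simp only [Fin.forall_fin_succ]
    simp [F.θ₀_frame, F.θ₁_frame, F.θ₂_frame, F.θ₃_frame, F.θ₄_frame, F.θ₅_frame, F.θ₆_frame]
  p := F.θ₁ ⁅F.b₁, F.b₂⁆
  q := F.θ₃ ⁅F.b₁, F.b₂⁆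
  c := fun i => ![F.θ₀, F.θ₁, F.θ₂, F.θ₃] i ⁅F.b₁, F.a₂⁆
  e := fun i => ![F.θ₀, F.θ₁, F.θ₂, F.θ₃] i ⁅F.b₂, F.a₁⁆
  f := fun i => ![F.θ₀, F.θ₁, F.θ₂, F.θ₃] i ⁅F.a₁, F.a₂⁆
  j := fun i => ![F.θ₀, F.θ₁, F.θ₂, F.θ₃] i ⁅F.A, F.b₁⁆
  k := fun i => ![F.θ₀, F.θ₁, F.θ₂, F.θ₃] i ⁅F.B, F.b₂⁆
  l := fun i => ![F.θ₀, F.θ₁, F.θ₂, F.θ₃] i ⁅F.B, F.a₂⁆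
  u₁ := F.i * F.b₁ F.μ
  u₂ := F.i * F.b₂ F.ν
  h₁ := F.θ₄ ⁅F.A, F.b₁⁆
  h₂ := F.θ₅ ⁅F.B, F.b₂⁆
  m := F.θ₄ ⁅F.B, F.a₂⁆
  n := F.θ₅ ⁅F.B, F.a₂⁆
  lie_a₁_b₁ := rfl
  lie_a₂_b₂ := rfl
  lie_A_a₁ := rfl
  lie_b₁_b₂ := F.lie_b₁_b₂_eq
  lie_b₁_a₂ := F.isContact_lie_b₁_a₂.expand
  lie_b₂_a₁ := F.isContact_lie_b₂_a₁.expand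
  lie_a₁_a₂ := F.isContact_lie_a₁_a₂.expand
  lie_A_b₁ := by
    have h := F.expand (F.lie F.vf_A F.vf_b₁)
    rw [F.θ₅_lie_A_b₁.1, F.θ₅_lie_A_b₁.2] at h
    refine h.trans ?_
    simp
    abel
  lie_B_b₂ := by
    have h := F.expand (F.lie F.vf_B F.vf_b₂)
    rw [F.θ₄_lie_B_b₂.1, F.θ₄_lie_B_b₂.2] at h
    refine h.trans ?_
    simp
    abel
  lie_B_a₂ := by
    have h := F.expand (F.lie F.vf_B F.vf_a₂)
    rw [F.θ₆_lie_B_a₂] at h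
    refine h.trans ?_
    simp
    abel

theorem apply_mem_ideal {X : Derivation ℝ R R} (hX : ∀ Y, F.IsContact Y → F.IsContact ⁅X, Y⁆)
    (hμ : IsUnit (F.b₁ F.μ)) (hν : IsUnit (F.b₂ F.ν)) (S : Set R)
    (hS : ∀ g ∈ S, g ∈ Set.range X ∨ g = F.θ₀ ⁅X, F.a₁⁆ ∨ g = F.θ₃ ⁅X, F.a₂⁆)
    (hXS : ∀ g, X g ∈ Ideal.span S) (hα : F.θ₀ ⁅X, F.a₁⁆ ∈ Ideal.span S)
    (hκ : F.θ₃ ⁅X, F.a₂⁆ ∈ Ideal.span S) {Y : Derivation ℝ R R} (hY : F.VF Y) :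
    ∀ g ∈ Ideal.span S, Y g ∈ Ideal.span S := by
  set J := Ideal.span S
  have hsym : F.frame.IsSymmetry X fun i j => ![F.θ₀, F.θ₁, F.θ₂, F.θ₃] j
      ⁅X, ![F.a₁, F.b₁, F.a₂, F.b₂] i⁆ :=
    ⟨(hX _ F.isContact_a₁).expand, (hX _ F.isContact_b₁).expand, (hX _ F.isContact_a₂).expand,
      (hX _ F.isContact_b₂).expand⟩
  have hi : IsUnit F.i := IsUnit.of_mul_eq_one _ ((mul_comm _ _).trans F.inv)
  have key := hsym.preserves.apply_mem (hi.mul hμ) (hi.mul hν) J hXS hα hκ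
  have gen : ∀ Y ∈ ({F.a₁, F.b₁, F.a₂, F.b₂} : Set (Derivation ℝ R R)), ∀ g ∈ J, Y g ∈ J := by
    intro Y hY g hg
    obtain ⟨k1, k2, k3⟩ := key Y hY
    -- By the Leibniz rule it suffices to differentiate the generators.
    refine Submodule.span_induction (p := fun g _ => Y g ∈ J) ?_ (by simp) ?_ ?_ hg
    · intro g hg
      rcases hS g hg with ⟨f, rfl⟩ | rfl | rfl
      · exact k3 f
      · exact k1
      · exact k2
    · intro a b _ _ ha hb
      rw [map_add]
      exact J.add_mem ha hb
    · intro c a ha' ha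
      rw [smul_eq_mul, Derivation.leibniz]
      exact J.add_mem (J.mul_mem_left _ ha) (J.mul_mem_right _ ha')
  have lie : ∀ Y Y' : Derivation ℝ R R, (∀ g ∈ J, Y g ∈ J) → (∀ g ∈ J, Y' g ∈ J) →
      ∀ g ∈ J, ⁅Y, Y'⁆ g ∈ J := fun Y Y' h h' g hg => by
    rw [Derivation.commutator_apply]
    exact J.sub_mem (h _ (h' _ hg)) (h' _ (h _ hg))
  have ha₁ := gen F.a₁ (by simp)
  have hb₁ := gen F.b₁ (by simp)
  have ha₂ := gen F.a₂ (by simp)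
  have hb₂ := gen F.b₂ (by simp)
  -- The derivations preserving `J` are closed under brackets, and the four fields of D generate the
  -- whole frame by brackets.
  have hA := lie _ _ ha₁ hb₁
  have hB := lie _ _ ha₂ hb₂
  have hZ := lie _ _ hA ha₁
  intro g hg
  rw [F.expand hY]
  exact J.add_mem (J.add_mem (J.add_mem (J.add_mem (J.add_mem (J.add_mem
    (J.mul_mem_left _ (ha₁ g hg)) (J.mul_mem_left _ (hb₁ g hg))) (J.mul_mem_left _ (ha₂ g hg)))
    (J.mul_mem_left _ (hb₂ g hg))) (J.mul_mem_left _ (hA g hg))) (J.mul_mem_left _ (hB g hg)))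
    (J.mul_mem_left _ (hZ g hg))

end JetFrame

end JetFrame

/-! ### Exterior algebra and the conformal pairing on the contact system -/

section Exterior

/-- The exterior product of two covectors, as a skew bilinear form. -/
noncomputable def wedge (α β : R7 →L[ℝ] ℝ) : R7 →L[ℝ] R7 →L[ℝ] ℝ :=
  α.smulRight β - β.smulRight α

@[simp] theorem wedge_apply (α β : R7 →L[ℝ] ℝ) (X Y : R7) :
    wedge α β X Y = α X * β Y - β X * α Y := by
  simp [wedge]

theorem eq_sum_dR (α : R7 →L[ℝ] ℝ) : α = ∑ i, α (Pi.single i 1) • dR i := by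
  ext v
  have : v = ∑ i, v i • (Pi.single i 1 : R7) := by
    ext j
    simp [Pi.single_apply]
  conv_lhs => rw [this]
  simp [dR, mul_comm]

theorem covec_sub (α β : R7 →L[ℝ] ℝ) : covec (α - β) = covec α - covec β := map_sub _ _ _
theorem covec_smul (c : ℝ) (α : R7 →L[ℝ] ℝ) : covec (c • α) = c • covec α := map_smul _ _ _

theorem covec_sq (α : R7 →L[ℝ] ℝ) : covec α * covec α = 0 := ExteriorAlgebra.ι_sq_zero _

theorem covec_swap (α β : R7 →L[ℝ] ℝ) : covec α * covec β = -(covec β * covec α) :=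
  eq_neg_of_add_eq_zero_left (ExteriorAlgebra.ι_add_mul_swap _ _)

theorem covec_sq_mul (α : R7 →L[ℝ] ℝ) (c : Ext) : covec α * (covec α * c) = 0 := by
  rw [← mul_assoc, covec_sq, zero_mul]

theorem covec_swap_mul (α β : R7 →L[ℝ] ℝ) (c : Ext) :
    covec α * (covec β * c) = -(covec β * (covec α * c)) := by
  rw [← mul_assoc, covec_swap, neg_mul, mul_assoc]

theorem covec_eq_sum (α : R7 →L[ℝ] ℝ) : covec α = ∑ i, α (Pi.single i 1) • covec (dR i) := by
  conv_lhs => rw [eq_sum_dR α]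
  simp [covec]

theorem twoForm_add (B B' : R7 →L[ℝ] R7 →L[ℝ] ℝ) : twoForm (B + B') = twoForm B + twoForm B' := by
  simp [twoForm, add_div, add_smul, Finset.sum_add_distrib]

theorem twoForm_smul (c : ℝ) (B : R7 →L[ℝ] R7 →L[ℝ] ℝ) : twoForm (c • B) = c • twoForm B := by
  simp [twoForm, Finset.smul_sum, mul_div_assoc, mul_smul]

/-- The factor ½ in `twoForm` compensates for each pair of indices occurring in both orders. -/
theorem twoForm_wedge (α β : R7 →L[ℝ] ℝ) : twoForm (wedge α β) = covec α * covec β := by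
  have h : ∀ α β : R7 →L[ℝ] ℝ, covec α * covec β = ∑ i : Fin 7, ∑ j : Fin 7,
      (α (Pi.single i 1) * β (Pi.single j 1)) • (covec (dR i) * covec (dR j)) := by
    intro α β
    conv_lhs => rw [covec_eq_sum α, covec_eq_sum β]
    rw [Finset.sum_mul_sum]
    exact Finset.sum_congr rfl fun i _ => Finset.sum_congr rfl fun j _ => smul_mul_smul_comm _ _ _ _
  have h2 : twoForm (wedge α β) = (1 / 2 : ℝ) • (covec α * covec β) -
      (1 / 2 : ℝ) • (covec β * covec α) := by
    rw [h, h]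
    simp only [twoForm, wedge_apply, Finset.smul_sum, ← Finset.sum_sub_distrib, smul_smul, ← sub_smul]
    refine Finset.sum_congr rfl fun i _ => Finset.sum_congr rfl fun j _ => ?_
    congr 1
    ring
  rw [h2, covec_swap β α, smul_neg, sub_neg_eq_add, ← add_smul]
  norm_num

section ExteriorDerivative

variable {φ ψ : OneForm} {u : R7}

theorem extD_congr (h : φ =ᶠ[nhds u] ψ) : extD φ u = extD ψ u := by
  rw [extD, extD, h.fderiv_eq]

theorem extD_apply (φ : OneForm) (u X Y : R7) :
    extD φ u X Y = fderiv ℝ φ u X Y - fderiv ℝ φ u Y X := rfl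

theorem extD_sub (hφ : DifferentiableAt ℝ φ u) (hψ : DifferentiableAt ℝ ψ u) :
    extD (φ - ψ) u = extD φ u - extD ψ u := by
  ext X Y
  simp [extD_apply, fderiv_sub hφ hψ]
  ring

theorem extD_add (hφ : DifferentiableAt ℝ φ u) (hψ : DifferentiableAt ℝ ψ u) :
    extD (φ + ψ) u = extD φ u + extD ψ u := by
  ext X Y
  simp [extD_apply, fderiv_add hφ hψ]
  ring

theorem extD_smul {f : R7 → ℝ} (hf : DifferentiableAt ℝ f u) (hφ : DifferentiableAt ℝ φ u) :
    extD (f • φ) u = f u • extD φ u + wedge (fderiv ℝ f u) (φ u) := by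
  ext X Y
  simp [extD_apply, fderiv_smul hf hφ]
  ring

theorem extD_fderiv {f : R7 → ℝ} (hf : ContDiffAt ℝ ∞ f u) : extD (fderiv ℝ f) u = 0 := by
  ext X Y
  have := hf.isSymmSndFDerivAt (by simpa using two_le_infty) X Y
  simp [extD_apply, this]

end ExteriorDerivative

namespace Equation

variable {E : Equation} {u : R7}

/-- The components of the parametrization. -/
def comp (E : Equation) (k : Fin 8) : R7 → ℝ := fun u => E.par u k

theorem contDiffAt_par (hu : u ∈ E.Sig) : ContDiffAt ℝ ∞ E.par u :=
  E.smooth_par.contDiffAt (E.isOpen_Sig.mem_nhds hu)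

theorem contDiffAt_comp (hu : u ∈ E.Sig) (k : Fin 8) : ContDiffAt ℝ ∞ (E.comp k) u :=
  contDiffAt_pi.1 (contDiffAt_par hu) k

theorem contDiffOn_comp (k : Fin 8) : ContDiffOn ℝ ∞ (E.comp k) E.Sig :=
  fun _ hu => (contDiffAt_comp hu k).contDiffWithinAt

theorem fderiv_comp (hu : u ∈ E.Sig) (k : Fin 8) (v : R7) :
    fderiv ℝ (E.comp k) u v = fderiv ℝ E.par u v k := by
  have h := (contDiffAt_par hu).differentiableAt (by simp)
  have := fderiv_apply h k
  change fderiv ℝ (fun u => E.par u k) u v = _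
  rw [this]
  rfl

theorem differentiableAt_comp (hu : u ∈ E.Sig) (k : Fin 8) : DifferentiableAt ℝ (E.comp k) u :=
  (contDiffAt_comp hu k).differentiableAt (by simp)

theorem contDiffAt_fderiv_comp (hu : u ∈ E.Sig) (k : Fin 8) :
    ContDiffAt ℝ ∞ (fderiv ℝ (E.comp k)) u :=
  (contDiffAt_comp hu k).fderiv_right (by simp)

/-- The expression of the contact forms in terms of the components of the parametrization. -/
noncomputable def formAux (E : Equation) : Fin 3 → OneForm :=
  ![fderiv ℝ (E.comp 2) - E.comp 3 • fderiv ℝ (E.comp 0) - E.comp 4 • fderiv ℝ (E.comp 1),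
    fderiv ℝ (E.comp 3) - E.comp 5 • fderiv ℝ (E.comp 0) - E.comp 6 • fderiv ℝ (E.comp 1),
    fderiv ℝ (E.comp 4) - E.comp 6 • fderiv ℝ (E.comp 0) - E.comp 7 • fderiv ℝ (E.comp 1)]

theorem form_eq (hu : u ∈ E.Sig) (a : Fin 3) : E.form a u = E.formAux a u := by
  ext v
  fin_cases a <;> simp [form, formAux, contactForm, dJ, fderiv_comp hu] <;> rfl

theorem form_eventuallyEq (hu : u ∈ E.Sig) (a : Fin 3) : E.form a =ᶠ[nhds u] E.formAux a := by
  filter_upwards [E.isOpen_Sig.mem_nhds hu] with v hv using form_eq hv a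

theorem contDiffAt_form (hu : u ∈ E.Sig) (a : Fin 3) : ContDiffAt ℝ ∞ (E.form a) u := by
  refine ContDiffAt.congr_of_eventuallyEq ?_ (form_eventuallyEq hu a)
  have h1 := contDiffAt_comp hu
  have h2 := contDiffAt_fderiv_comp hu
  fin_cases a
  · exact ((h2 2).sub ((h1 3).smul (h2 0))).sub ((h1 4).smul (h2 1))
  · exact ((h2 3).sub ((h1 5).smul (h2 0))).sub ((h1 6).smul (h2 1))
  · exact ((h2 4).sub ((h1 6).smul (h2 0))).sub ((h1 7).smul (h2 1))

theorem differentiableAt_form (hu : u ∈ E.Sig) (a : Fin 3) : DifferentiableAt ℝ (E.form a) u :=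
  (contDiffAt_form hu a).differentiableAt (by simp)

theorem extD_form (hu : u ∈ E.Sig) (a : Fin 3) : extD (E.form a) u =
    (![wedge (fderiv ℝ (E.comp 0) u) (fderiv ℝ (E.comp 3) u) +
        wedge (fderiv ℝ (E.comp 1) u) (fderiv ℝ (E.comp 4) u),
      wedge (fderiv ℝ (E.comp 0) u) (fderiv ℝ (E.comp 5) u) +
        wedge (fderiv ℝ (E.comp 1) u) (fderiv ℝ (E.comp 6) u),
      wedge (fderiv ℝ (E.comp 0) u) (fderiv ℝ (E.comp 6) u) +
        wedge (fderiv ℝ (E.comp 1) u) (fderiv ℝ (E.comp 7) u)] :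
      Fin 3 → R7 →L[ℝ] R7 →L[ℝ] ℝ) a := by
  rw [extD_congr (form_eventuallyEq hu a)]
  have d1 := differentiableAt_comp hu
  have d2 := fun k => (contDiffAt_fderiv_comp hu k).differentiableAt (by simp)
  have h0 := fun k => extD_fderiv (contDiffAt_comp hu k)
  have key : ∀ i j k : Fin 8, extD (fderiv ℝ (E.comp i) - E.comp j • fderiv ℝ (E.comp 0) -
      E.comp k • fderiv ℝ (E.comp 1)) u = wedge (fderiv ℝ (E.comp 0) u) (fderiv ℝ (E.comp j) u) +
        wedge (fderiv ℝ (E.comp 1) u) (fderiv ℝ (E.comp k) u) := by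
    intro i j k
    rw [extD_sub ((d2 i).sub ((d1 j).smul (d2 0))) ((d1 k).smul (d2 1)),
      extD_sub (d2 i) ((d1 j).smul (d2 0)), extD_smul (d1 j) (d2 0), extD_smul (d1 k) (d2 1),
      h0, h0, h0]
    ext X Y
    simp
    ring
  fin_cases a <;> exact key _ _ _

/-- The differentials of the jet coordinates in the exterior algebra. -/
noncomputable def dc (E : Equation) (u : R7) (k : Fin 8) : Ext := covec (fderiv ℝ (E.comp k) u)

theorem covec_form (hu : u ∈ E.Sig) (a : Fin 3) : covec (E.form a u) =
    (![E.dc u 2 - E.comp 3 u • E.dc u 0 - E.comp 4 u • E.dc u 1,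
      E.dc u 3 - E.comp 5 u • E.dc u 0 - E.comp 6 u • E.dc u 1,
      E.dc u 4 - E.comp 6 u • E.dc u 0 - E.comp 7 u • E.dc u 1] : Fin 3 → Ext) a := by
  rw [form_eq hu]
  fin_cases a <;> simp [formAux, covec_sub, covec_smul, dc]

/-- The product `ω¹ ∧ ω² ∧ ω³`. -/
noncomputable def vol (E : Equation) (u : R7) : Ext :=
  covec (E.form 0 u) * (covec (E.form 1 u) * covec (E.form 2 u))

theorem covec_form_mul_vol (a : Fin 3) : covec (E.form a u) * E.vol u = 0 := by
  rw [vol]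
  fin_cases a
  · exact covec_sq_mul _ _
  · change covec (E.form 1 u) * _ = 0
    rw [covec_swap_mul, covec_sq_mul, mul_zero, neg_zero]
  · change covec (E.form 2 u) * _ = 0
    rw [covec_swap_mul, covec_swap_mul (E.form 2 u), covec_sq]
    simp

/-- The quadratic part of `d(c₁ ω² + c₂ ω³)` modulo the contact forms. -/
noncomputable def symbolForm (E : Equation) (u : R7) (c₁ c₂ : ℝ) : Ext :=
  E.dc u 0 * (c₁ • E.dc u 5 + c₂ • E.dc u 6) + E.dc u 1 * (c₁ • E.dc u 6 + c₂ • E.dc u 7)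

/-- Against a factor killed by the contact forms, differentials of the coefficients drop out. So
does dω¹ = dx ∧ dp + dy ∧ dq, because dp and dq become combinations of dx and dy whose contributions
cancel by symmetry in s. -/
theorem twoForm_extD_mul (hu : u ∈ E.Sig) {c : Fin 3 → R7 → ℝ} {σ : OneForm}
    (hσ : σ =ᶠ[nhds u] c 0 • E.form 0 + c 1 • E.form 1 + c 2 • E.form 2)
    (hc : ∀ a, DifferentiableAt ℝ (c a) u) {ζ : Ext} (hζ : ∀ a, covec (E.form a u) * ζ = 0) :
    twoForm (extD σ u) * ζ = E.symbolForm u (c 1 u) (c 2 u) * ζ := by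
  have hf := fun a => differentiableAt_form hu a
  rw [extD_congr hσ, extD_add (((hc 0).smul (hf 0)).add ((hc 1).smul (hf 1))) ((hc 2).smul (hf 2)),
    extD_add ((hc 0).smul (hf 0)) ((hc 1).smul (hf 1)), extD_smul (hc 0) (hf 0),
    extD_smul (hc 1) (hf 1), extD_smul (hc 2) (hf 2), extD_form hu, extD_form hu, extD_form hu]
  simp only [twoForm_add, twoForm_smul, twoForm_wedge, add_mul, mul_assoc, hζ, mul_zero, add_zero,
    Matrix.cons_val]
  have h1 := hζ 1
  have h2 := hζ 2
  rw [covec_form hu] at h1 h2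
  simp only [Matrix.cons_val, sub_mul, smul_mul_assoc] at h1 h2
  have e3 : E.dc u 3 * ζ = E.comp 5 u • (E.dc u 0 * ζ) + E.comp 6 u • (E.dc u 1 * ζ) := by
    rw [← sub_eq_zero, ← h1]; abel
  have e4 : E.dc u 4 * ζ = E.comp 6 u • (E.dc u 0 * ζ) + E.comp 7 u • (E.dc u 1 * ζ) := by
    rw [← sub_eq_zero, ← h2]; abel
  change (c 0 u • (E.dc u 0 * E.dc u 3 + E.dc u 1 * E.dc u 4)) * ζ +
    (c 1 u • (E.dc u 0 * E.dc u 5 + E.dc u 1 * E.dc u 6)) * ζ +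
    (c 2 u • (E.dc u 0 * E.dc u 6 + E.dc u 1 * E.dc u 7)) * ζ = _
  have e01 : E.dc u 1 * (E.dc u 0 * ζ) = -(E.dc u 0 * (E.dc u 1 * ζ)) := covec_swap_mul _ _ _
  have e00 : E.dc u 0 * (E.dc u 0 * ζ) = 0 := covec_sq_mul _ _
  have e11 : E.dc u 1 * (E.dc u 1 * ζ) = 0 := covec_sq_mul _ _
  have z : (E.dc u 0 * E.dc u 3 + E.dc u 1 * E.dc u 4) * ζ = 0 := by
    rw [add_mul, mul_assoc, mul_assoc, e3, e4]
    simp only [mul_add, mul_smul_comm, e01, e00, e11, smul_zero, smul_neg]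
    abel
  rw [smul_mul_assoc, z, symbolForm]
  simp only [smul_mul_assoc, add_mul, mul_add, mul_smul_comm, mul_assoc, smul_zero, smul_add]
  abel

/-- The ω¹-coefficients disappear: ω¹ is in the radical of the pairing, which descends to a form on
the span of ω² and ω³. -/
theorem pairing_eq (hu : u ∈ E.Sig) {c c' : Fin 3 → R7 → ℝ} {σ σ' : OneForm}
    (hσ : σ =ᶠ[nhds u] c 0 • E.form 0 + c 1 • E.form 1 + c 2 • E.form 2)
    (hc : ∀ a, DifferentiableAt ℝ (c a) u)
    (hσ' : σ' =ᶠ[nhds u] c' 0 • E.form 0 + c' 1 • E.form 1 + c' 2 • E.form 2)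
    (hc' : ∀ a, DifferentiableAt ℝ (c' a) u) :
    E.pairing σ σ' u = -((2 * c 1 u * c' 1 u) •
        (E.dc u 0 * (E.dc u 1 * (E.dc u 5 * (E.dc u 6 * E.vol u)))) +
      (c 1 u * c' 2 u + c 2 u * c' 1 u) •
        (E.dc u 0 * (E.dc u 1 * (E.dc u 5 * (E.dc u 7 * E.vol u)))) +
      (2 * c 2 u * c' 2 u) •
        (E.dc u 0 * (E.dc u 1 * (E.dc u 6 * (E.dc u 7 * E.vol u))))) := by
  have sw : ∀ (j k : Fin 8) (ζ : Ext), E.dc u j * (E.dc u k * ζ) = -(E.dc u k * (E.dc u j * ζ)) :=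
    fun j k ζ => covec_swap_mul _ _ _
  have sq : ∀ (k : Fin 8) (ζ : Ext), E.dc u k * (E.dc u k * ζ) = 0 := fun k ζ => covec_sq_mul _ _
  have h1 : E.pairing σ σ' u = twoForm (extD σ u) * (twoForm (extD σ' u) * E.vol u) := by
    rw [pairing, vol]
    simp only [mul_assoc]
  rw [h1, twoForm_extD_mul hu hσ' hc' covec_form_mul_vol, twoForm_extD_mul hu hσ hc]
  · simp only [symbolForm, add_mul, mul_add, smul_mul_assoc, mul_smul_comm, mul_assoc,
      sw 1 0, sw 5 0, sw 6 0, sw 7 0, sw 5 1, sw 6 1, sw 7 1, sw 6 5, sw 7 5, sw 7 6, sq, smul_zero,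
      mul_zero, mul_neg, neg_neg, smul_neg, neg_zero, add_zero, zero_add]
    module
  · intro a
    have sw' : ∀ (k : Fin 8) (ζ : Ext), covec (E.form a u) * (E.dc u k * ζ) =
      -(E.dc u k * (covec (E.form a u) * ζ)) := fun k ζ => covec_swap_mul _ _ _
    simp only [symbolForm, add_mul, mul_add, smul_mul_assoc, mul_smul_comm, mul_assoc, sw',
      covec_form_mul_vol, mul_zero, neg_zero, smul_zero, add_zero]

end Equation

end Exterior

/-! ### Characteristic systems, their class, and vertical Cauchy characteristics -/

theorem finrank_dual_R7 : Module.finrank ℝ (R7 →L[ℝ] ℝ) = 7 := by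
  rw [← (LinearMap.toContinuousLinearMap (𝕜 := ℝ) (E := R7) (F' := ℝ)).finrank_eq,
    Module.finrank_linearMap]
  simp

theorem pfaffClass_eq_iff (σ : Fin 2 → OneForm) (u : R7) :
    pfaffClass σ u = 7 ↔ ∀ X ∈ cauchyChar σ u, X = 0 := by
  constructor
  · intro h X hX
    have htop : cartanSystem σ u = ⊤ :=
      Submodule.eq_top_of_finrank_eq (h.trans finrank_dual_R7.symm)
    funext k
    have : dR k ∈ cartanSystem σ u := htop ▸ Submodule.mem_top
    exact this X hX
  · intro h
    have htop : cartanSystem σ u = ⊤ := by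
      rw [eq_top_iff]
      intro α _ X hX
      rw [h X hX, map_zero]
    rw [pfaffClass, htop, finrank_top, finrank_dual_R7]

namespace Equation

variable {E : Equation} {u : R7}

theorem par_mem (hu : u ∈ E.Sig) : E.par u ∈ E.dom ∧ E.F (E.par u) = 0 := by
  have : E.par u ∈ E.par '' E.Sig := Set.mem_image_of_mem _ hu
  rwa [E.image_par] at this

theorem differentiableAt_F (hu : u ∈ E.Sig) : DifferentiableAt ℝ E.F (E.par u) :=
  (E.smooth_F.contDiffAt (E.isOpen_dom.mem_nhds (par_mem hu).1)).differentiableAt (by simp)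

theorem differentiableAt_par (hu : u ∈ E.Sig) : DifferentiableAt ℝ E.par u :=
  (contDiffAt_par hu).differentiableAt (by simp)

theorem sum_partialF (hu : u ∈ E.Sig) (v : R7) :
    ∑ k, E.partialF k (E.par u) * fderiv ℝ E.par u v k = 0 := by
  have h0 : E.F ∘ E.par =ᶠ[nhds u] fun _ => 0 := by
    filter_upwards [E.isOpen_Sig.mem_nhds hu] with w hw using (par_mem hw).2
  have h1 := ((differentiableAt_F hu).hasFDerivAt.comp u
    (differentiableAt_par hu).hasFDerivAt).fderiv.symm.trans h0.fderiv_eq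
  have h2 := congrArg (fun L : R7 →L[ℝ] ℝ => L v) h1
  simp at h2
  have h3 : fderiv ℝ E.par u v = ∑ k, fderiv ℝ E.par u v k • (Pi.single k 1 : J2) := by
    ext j
    simp [Pi.single_apply]
  rw [h3, map_sum] at h2
  simpa [partialF, mul_comm] using h2

theorem sum_partialF_dc (hu : u ∈ E.Sig) : ∑ k, E.partialF k (E.par u) • E.dc u k = 0 := by
  have h : ∑ k, E.partialF k (E.par u) • fderiv ℝ (E.comp k) u = 0 := by
    ext v
    simp [fderiv_comp hu, sum_partialF hu v]
  have h2 := congrArg covec h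
  simp only [covec, map_sum, map_smul, map_zero] at h2
  exact h2

theorem exists_lift (hu : u ∈ E.Sig) (w : J1) :
    ∃ v : R7, ∀ k : Fin 5, fderiv ℝ E.par u v (k.castLE (by norm_num)) = w k := by
  have h := E.transverse u hu
  set w' : J2 := fun k => if h : (k : ℕ) < 5 then w ⟨k, h⟩ else 0 with hw'
  have hmem : w' ∈ LinearMap.range (fderiv ℝ E.par u).toLinearMap ⊔
      LinearMap.ker projJ1.toLinearMap := h ▸ Submodule.mem_top
  obtain ⟨a, ⟨v, rfl⟩, b, hb, hab⟩ := Submodule.mem_sup.1 hmem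
  refine ⟨v, fun k => ?_⟩
  have hbk : b (k.castLE (by norm_num)) = 0 := congrFun (show projJ1 b = 0 from hb) k
  have := congrFun hab (k.castLE (by norm_num))
  simp only [Pi.add_apply, hbk, add_zero] at this
  rw [hw'] at this
  simpa using this

theorem form_apply (E : Equation) (u v : R7) : 
    E.form 0 u v = fderiv ℝ E.par u v 2 - E.par u 3 * fderiv ℝ E.par u v 0 -
      E.par u 4 * fderiv ℝ E.par u v 1 ∧
    E.form 1 u v = fderiv ℝ E.par u v 3 - E.par u 5 * fderiv ℝ E.par u v 0 -
      E.par u 6 * fderiv ℝ E.par u v 1 ∧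
    E.form 2 u v = fderiv ℝ E.par u v 4 - E.par u 6 * fderiv ℝ E.par u v 0 -
      E.par u 7 * fderiv ℝ E.par u v 1 := by
  simp [form, contactForm, dJ]

/-- Vectors dual to the contact forms. -/
theorem exists_dual (hu : u ∈ E.Sig) (w : Fin 3 → ℝ) : ∃ v : R7, ∀ a, E.form a u v = w a := by
  obtain ⟨v, hv⟩ := exists_lift hu ![0, 0, w 0, w 1, w 2]
  have h0 := hv 0
  have h1 := hv 1
  have h2 := hv 2
  have h3 := hv 3
  have h4 := hv 4
  simp at h0 h1 h2 h3 h4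
  obtain ⟨f0, f1, f2⟩ := E.form_apply u v
  refine ⟨v, fun a => ?_⟩
  fin_cases a
  · exact f0.trans (by rw [h0, h1, h2]; simp)
  · exact f1.trans (by rw [h0, h1, h3]; simp)
  · exact f2.trans (by rw [h0, h1, h4]; simp)

/-- Along the equation dr, ds, dt are dependent modulo dx, dy and the contact forms, with
coefficients F_r, F_s, F_t. Hence the three products are tied together, and the pairing of αω² + βω³
with itself becomes a multiple of the symbol quadratic in (α, β). -/
theorem pairing_symbol_eq_zero (hE : E.IsHyperbolic) (hu : u ∈ E.Sig) {α β : ℝ}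
    (hαβ : α ^ 2 * E.partialF 7 (E.par u) - α * β * E.partialF 6 (E.par u) +
      β ^ 2 * E.partialF 5 (E.par u) = 0) :
    (2 * α * α) • (E.dc u 0 * (E.dc u 1 * (E.dc u 5 * (E.dc u 6 * E.vol u)))) +
      (α * β + β * α) • (E.dc u 0 * (E.dc u 1 * (E.dc u 5 * (E.dc u 7 * E.vol u)))) +
      (2 * β * β) • (E.dc u 0 * (E.dc u 1 * (E.dc u 6 * (E.dc u 7 * E.vol u)))) = 0 := by
  have sw : ∀ (j k : Fin 8) (ζ : Ext), E.dc u j * (E.dc u k * ζ) = -(E.dc u k * (E.dc u j * ζ)) :=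
    fun j k ζ => covec_swap_mul _ _ _
  have sq : ∀ (k : Fin 8) (ζ : Ext), E.dc u k * (E.dc u k * ζ) = 0 := fun k ζ => covec_sq_mul _ _
  have hz := fun a => covec_form_mul_vol (E := E) (u := u) a
  have h0 := hz 0
  have h1 := hz 1
  have h2 := hz 2
  rw [covec_form hu] at h0 h1 h2
  simp only [Matrix.cons_val, sub_mul, sub_sub, sub_eq_zero] at h0 h1 h2
  -- This is dF = 0 multiplied by the remaining factors; the terms in dx, dy, dz, dp, dq vanish
  -- against dx ∧ dy and the contact forms.
  have rel : ∀ j, E.partialF 5 (E.par u) • (E.dc u 0 * (E.dc u 1 * (E.dc u j * (E.dc u 5 * E.vol u)))) +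
      E.partialF 6 (E.par u) • (E.dc u 0 * (E.dc u 1 * (E.dc u j * (E.dc u 6 * E.vol u)))) +
      E.partialF 7 (E.par u) • (E.dc u 0 * (E.dc u 1 * (E.dc u j * (E.dc u 7 * E.vol u)))) = 0 := by
    intro j
    have h := congrArg (fun ζ => E.dc u 0 * (E.dc u 1 * (E.dc u j * (ζ * E.vol u))))
      (sum_partialF_dc hu)
    simp only [Fin.sum_univ_eight, add_mul, smul_mul_assoc, h0, h1, h2, zero_mul, mul_zero,
      mul_add, mul_smul_comm, sw j 0, sw j 1, sw 1 0, sq, mul_neg, neg_zero, smul_zero, zero_add,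
      add_zero] at h
    exact h
  have r5 := rel 5
  have r6 := rel 6
  have r7 := rel 7
  simp only [sw 6 5, sw 7 5, sw 7 6, sq, mul_zero, smul_zero, mul_neg, smul_neg, zero_add,
    add_zero] at r5 r6 r7
  have hyp := hE u hu
  generalize E.partialF 5 (E.par u) = f5 at *
  generalize E.partialF 6 (E.par u) = f6 at *
  generalize E.partialF 7 (E.par u) = f7 at *
  generalize E.dc u 0 * (E.dc u 1 * (E.dc u 5 * (E.dc u 6 * E.vol u))) = K56 at *
  generalize E.dc u 0 * (E.dc u 1 * (E.dc u 5 * (E.dc u 7 * E.vol u))) = K57 at *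
  generalize E.dc u 0 * (E.dc u 1 * (E.dc u 6 * (E.dc u 7 * E.vol u))) = K67 at *
  have hq : ∀ K : Ext, (α ^ 2 * f7 - α * β * f6 + β ^ 2 * f5) • K = 0 := fun K => by
    rw [hαβ, zero_smul]
  set S := (2 * α * α) • K56 + (α * β + β * α) • K57 + (2 * β * β) • K67 with hS
  have s5 : f5 • S = 0 := by
    rw [hS]
    linear_combination (norm := module) (2 : ℝ) • hq K67 - (2 * α ^ 2) • r6 - (2 * α * β) • r7
  have s6 : f6 • S = 0 := by
    rw [hS]
    linear_combination (norm := module) (-2 : ℝ) • hq K57 + (2 * α ^ 2) • r5 - (2 * β ^ 2) • r7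
  have s7 : f7 • S = 0 := by
    rw [hS]
    linear_combination (norm := module) (2 : ℝ) • hq K56 + (2 * α * β) • r5 + (2 * β ^ 2) • r6
  -- Each of F_r, F_s, F_t annihilates `S`; were `S` nonzero, all three would vanish, against
  -- hyperbolicity.
  by_contra hne
  rw [smul_eq_zero_iff_left hne] at s5 s6 s7
  rw [s5, s6, s7] at hyp
  norm_num at hyp

/-- Null covectors define characteristic systems. -/
theorem isCharacteristicSystem (hE : E.IsHyperbolic) {W : Set R7} (hW : IsOpen W)
    (hWE : W ⊆ E.Sig) {α β : R7 → ℝ} (hα : ContDiffOn ℝ ∞ α W) (hβ : ContDiffOn ℝ ∞ β W)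
    (hne : ∀ u ∈ W, α u ≠ 0 ∨ β u ≠ 0)
    (hnull : ∀ u ∈ W, α u ^ 2 * E.partialF 7 (E.par u) - α u * β u * E.partialF 6 (E.par u) +
      β u ^ 2 * E.partialF 5 (E.par u) = 0) :
    E.IsCharacteristicSystem W ![E.form 0, α • E.form 1 + β • E.form 2] where
  isOpen := hW
  subset := hWE
  smooth := by
    have hf : ∀ a, ContDiffOn ℝ ∞ (E.form a) W :=
      fun a u hu => (contDiffAt_form (hWE hu) a).contDiffWithinAt
    intro b
    fin_cases b
    · exact hf 0
    · exact (hα.smul (hf 1)).add (hβ.smul (hf 2))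
  mem := by
    have hf : ∀ a u, E.form a u ∈ E.system u := fun a u => Submodule.subset_span ⟨a, rfl⟩
    intro b u _
    fin_cases b
    · exact hf 0 u
    · exact add_mem (Submodule.smul_mem _ _ (hf 1 u)) (Submodule.smul_mem _ _ (hf 2 u))
  independent := by
    intro u hu
    rw [Fintype.linearIndependent_iff]
    intro g h
    rw [Fin.sum_univ_two] at h
    have hv : ∀ v : R7, g 0 * E.form 0 u v + g 1 * (α u * E.form 1 u v + β u * E.form 2 u v) = 0 :=
      fun v => congrArg (fun L : R7 →L[ℝ] ℝ => L v) h
    obtain ⟨v, hv1⟩ := exists_dual (hWE hu) ![1, 0, 0]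
    obtain ⟨v', hv2⟩ := exists_dual (hWE hu) ![0, 1, 0]
    obtain ⟨v'', hv3⟩ := exists_dual (hWE hu) ![0, 0, 1]
    have e1 := hv v
    have e2 := hv v'
    have e3 := hv v''
    simp [hv1] at e1
    simp [hv2] at e2
    simp [hv3] at e3
    have e4 : g 1 = 0 := (hne u hu).elim e2.resolve_right e3.resolve_right
    intro i
    fin_cases i
    · exact e1
    · exact e4
  isotropic := by
    intro b c u hu
    have dα := (hα.contDiffAt (hW.mem_nhds hu)).differentiableAt (by simp)
    have dβ := (hβ.contDiffAt (hW.mem_nhds hu)).differentiableAt (by simp)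
    have hc : ∀ b : Fin 2, ∀ a, DifferentiableAt ℝ ((![![1, 0, 0], ![0, α, β]] :
        Fin 2 → Fin 3 → R7 → ℝ) b a) u := by
      intro b a
      fin_cases b <;> fin_cases a
      · exact differentiableAt_const (1 : ℝ)
      · exact differentiableAt_const (0 : ℝ)
      · exact differentiableAt_const (0 : ℝ)
      · exact differentiableAt_const (0 : ℝ)
      · exact dα
      · exact dβ
    have hσ : ∀ b : Fin 2, (![E.form 0, α • E.form 1 + β • E.form 2] : Fin 2 → OneForm) b =ᶠ[nhds u]
        (![![1, 0, 0], ![0, α, β]] : Fin 2 → Fin 3 → R7 → ℝ) b 0 • E.form 0 +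
        (![![1, 0, 0], ![0, α, β]] : Fin 2 → Fin 3 → R7 → ℝ) b 1 • E.form 1 +
        (![![1, 0, 0], ![0, α, β]] : Fin 2 → Fin 3 → R7 → ℝ) b 2 • E.form 2 := by
      intro b
      refine Filter.Eventually.of_forall fun v => ?_
      fin_cases b <;> simp
    rw [pairing_eq (hWE hu) (hσ b) (hc b) (hσ c) (hc c), neg_eq_zero]
    fin_cases b <;> fin_cases c
    · simp
    · simp
    · simp
    · exact pairing_symbol_eq_zero hE (hWE hu) (hnull u hu)

/-- For a generic equation the characteristic systems have no Cauchy characteristics. -/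
theorem eq_zero_of_cauchy (hE : E.IsHyperbolic) (hG : E.IsGeneric) {W : Set R7} (hW : IsOpen W)
    (hWE : W ⊆ E.Sig) {α β : R7 → ℝ} (hα : ContDiffOn ℝ ∞ α W) (hβ : ContDiffOn ℝ ∞ β W)
    (hne : ∀ u ∈ W, α u ≠ 0 ∨ β u ≠ 0)
    (hnull : ∀ u ∈ W, α u ^ 2 * E.partialF 7 (E.par u) - α u * β u * E.partialF 6 (E.par u) +
      β u ^ 2 * E.partialF 5 (E.par u) = 0) {u : R7} (hu : u ∈ W) {b : R7}
    (hb : ∀ k : Fin 5, fderiv ℝ E.par u b (k.castLE (by norm_num)) = 0)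
    (hb₁ : α u * fderiv ℝ E.par u b 5 + β u * fderiv ℝ E.par u b 6 = 0)
    (hb₂ : α u * fderiv ℝ E.par u b 6 + β u * fderiv ℝ E.par u b 7 = 0)
    (hbα : fderiv ℝ α u b = 0) (hbβ : fderiv ℝ β u b = 0) : b = 0 := by
  have hu' := hWE hu
  have hchar := isCharacteristicSystem hE hW hWE hα hβ hne hnull
  refine (pfaffClass_eq_iff _ u).1 (hG W _ hchar u hu) b ?_
  have h0 := hb 0
  have h1 := hb 1
  have h2 := hb 2
  have h3 := hb 3
  have h4 := hb 4
  simp at h0 h1 h2 h3 h4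
  obtain ⟨f0, f1, f2⟩ := E.form_apply u b
  simp only [h0, h1, h2, h3, h4, mul_zero, sub_zero] at f0 f1 f2
  have dα := (hα.contDiffAt (hW.mem_nhds hu)).differentiableAt (by simp)
  have dβ := (hβ.contDiffAt (hW.mem_nhds hu)).differentiableAt (by simp)
  intro c
  fin_cases c
  · refine ⟨f0, ?_⟩
    have : extD (E.form 0) u b = 0 := by
      rw [extD_form hu']
      ext X
      simp [fderiv_comp hu', h0, h1, h3, h4]
    change extD (E.form 0) u b ∈ _
    rw [this]
    exact zero_mem _
  · refine ⟨?_, ?_⟩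
    · change α u * E.form 1 u b + β u * E.form 2 u b = 0
      rw [f1, f2]
      simp
    -- Since b is vertical, its contraction with the differential has only dx- and dy-components,
    -- and these are the expressions in `hb₁` and `hb₂`. The variations of α and β along b vanish by
    -- assumption.
    · have : extD (α • E.form 1 + β • E.form 2) u b = 0 := by
        have d := fun a => differentiableAt_form hu' a
        rw [extD_add (dα.smul (d 1)) (dβ.smul (d 2)), extD_smul dα (d 1), extD_smul dβ (d 2),
          extD_form hu', extD_form hu']
        ext X
        simp [fderiv_comp hu', h0, h1, f1, f2, hbα, hbβ]
        linear_combination (-fderiv ℝ E.par u X 0) * hb₁ - (fderiv ℝ E.par u X 1) * hb₂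
      change extD (α • E.form 1 + β • E.form 2) u b ∈ _
      rw [this]
      exact zero_mem _

end Equation

/-! ### Construction of the frame for a concrete hyperbolic equation -/

section Equations

open TopologicalSpace
open smoothRing hiding mk

namespace smoothRing

variable {W : Opens R7}

/-- The vector of a derivation at a point. -/
def vec (Y : Derivation ℝ (smoothRing W) (smoothRing W)) (u : W) : R7 := fun k => Y (coord k) u

end smoothRing

namespace Equation

variable {E : Equation} {W : Opens R7}

/-- The jet coordinates as elements of the ring of smooth functions. -/
def jet (hW : (W : Set R7) ⊆ E.Sig) (k : Fin 8) : smoothRing W :=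
  smoothRing.mk (E.comp k) ((contDiffOn_comp k).mono hW)

theorem apply_jet (hW : (W : Set R7) ⊆ E.Sig) {Y : Derivation ℝ (smoothRing W) (smoothRing W)}
    (hY : IsVectorField Y) (k : Fin 8) (u : W) :
    (Y (jet hW k) : smoothRing W) u = fderiv ℝ E.par u (vec Y u) k := by
  rw [jet, hY.apply_mk, fderiv_comp (hW u.2)]
  rfl

/-- The coefficients of the differential of `F` along the equation. -/
noncomputable def coeff (E : Equation) (k : Fin 8) : R7 → ℝ := fun u => E.partialF k (E.par u)

theorem contDiffOn_coeff (k : Fin 8) : ContDiffOn ℝ ∞ (E.coeff k) E.Sig := by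
  have h1 : ContDiffOn ℝ ∞ (E.partialF k) E.dom :=
    (E.smooth_F.fderiv_of_isOpen E.isOpen_dom (by simp)).clm_apply contDiffOn_const
  exact h1.comp E.smooth_par fun u hu => (par_mem hu).1

/-- A smooth choice of one of the two roots of the characteristic equation. -/
structure IsRoot (E : Equation) (W : Opens R7) (w : R7 → ℝ) : Prop where
  subset : (W : Set R7) ⊆ E.Sig
  smooth : ContDiffOn ℝ ∞ w W
  ne_zero : ∀ u ∈ W, w u ≠ 0
  ne : ∀ u ∈ W, w u ≠ E.coeff 6 u
  root : ∀ u ∈ W, w u ^ 2 - 2 * E.coeff 6 u * w u + 4 * E.coeff 5 u * E.coeff 7 u = 0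

/-- The roots are F_s ± √Δ with Δ > 0, so at least one is nonzero at the given point and stays
nonzero on a ball. A ball is taken because convexity is needed for integration along segments. -/
theorem exists_isRoot (hE : E.IsHyperbolic) {U : Set R7} (hU : IsOpen U) (hUE : U ⊆ E.Sig)
    {u₀ : R7} (hu₀ : u₀ ∈ U) : ∃ (W : Opens R7) (w : R7 → ℝ), u₀ ∈ W ∧ (W : Set R7) ⊆ U ∧
      Convex ℝ (W : Set R7) ∧ E.IsRoot W w := by
  set Δ : R7 → ℝ := fun u => E.coeff 6 u ^ 2 - 4 * E.coeff 5 u * E.coeff 7 u with hΔ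
  have hpos : ∀ u ∈ E.Sig, 0 < Δ u := fun u hu => by
    have := hE u hu
    simp only [hΔ, coeff]
    linarith
  have hsqrt : ContDiffOn ℝ ∞ (fun u => Real.sqrt (Δ u)) E.Sig := by
    refine ContDiffOn.sqrt ?_ fun u hu => (hpos u hu).ne'
    exact ((contDiffOn_coeff 6).pow 2).sub ((contDiffOn_const.mul (contDiffOn_coeff 5)).mul
      (contDiffOn_coeff 7))
  obtain ⟨ε, hε, hε0⟩ : ∃ ε : ℝ, ε ^ 2 = 1 ∧ E.coeff 6 u₀ + ε * Real.sqrt (Δ u₀) ≠ 0 := by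
    have hs := Real.sqrt_pos.2 (hpos u₀ (hUE hu₀))
    by_cases h : E.coeff 6 u₀ + Real.sqrt (Δ u₀) = 0
    · exact ⟨-1, by norm_num, fun h' => by linarith⟩
    · exact ⟨1, by norm_num, by simpa using h⟩
  have hw : ContDiffOn ℝ ∞ (fun u => E.coeff 6 u + ε * Real.sqrt (Δ u)) E.Sig :=
    (contDiffOn_coeff 6).add (contDiffOn_const.mul hsqrt)
  have hnhds : {u | E.coeff 6 u + ε * Real.sqrt (Δ u) ≠ 0} ∩ U ∈ nhds u₀ := by
    refine Filter.inter_mem ?_ (hU.mem_nhds hu₀)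
    exact (hw.continuousOn.continuousAt (E.isOpen_Sig.mem_nhds (hUE hu₀))).eventually_ne hε0
  obtain ⟨δ, hδ, hball⟩ := Metric.mem_nhds_iff.1 hnhds
  refine ⟨⟨Metric.ball u₀ δ, Metric.isOpen_ball⟩, fun u => E.coeff 6 u + ε * Real.sqrt (Δ u),
    Metric.mem_ball_self hδ, fun u hu => (hball hu).2, convex_ball _ _,
    fun u hu => hUE (hball hu).2, hw.mono fun u hu => hUE (hball hu).2,
    fun u hu => (hball hu).1, fun u hu h => ?_, fun u hu => ?_⟩
  · have hs := Real.sqrt_pos.2 (hpos u (hUE (hball hu).2))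
    have h' : ε * Real.sqrt (Δ u) = 0 := by simpa using h
    have : ε = 0 := (mul_eq_zero.1 h').resolve_right hs.ne'
    rw [this] at hε
    norm_num at hε
  · have hs := Real.sq_sqrt (hpos u (hUE (hball hu).2)).le
    simp only [hΔ] at hs ⊢
    linear_combination ε ^ 2 * hs + (E.coeff 6 u ^ 2 - 4 * E.coeff 5 u * E.coeff 7 u) * hε

namespace IsRoot

variable {w : R7 → ℝ}

theorem contDiffOn_slope (h : E.IsRoot W w) (k : Fin 8) :
    ContDiffOn ℝ ∞ (fun u => E.coeff k u / w u) W :=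
  ((contDiffOn_coeff k).mono h.subset).div h.smooth h.ne_zero

/-- The quotient of a coefficient by the root. -/
noncomputable def slope (h : E.IsRoot W w) (k : Fin 8) : smoothRing W :=
  smoothRing.mk _ (h.contDiffOn_slope k)

/-- The characteristic slopes. -/
noncomputable def μ (h : E.IsRoot W w) : smoothRing W := (-2 : ℝ) • h.slope 5
noncomputable def ν (h : E.IsRoot W w) : smoothRing W := (-2 : ℝ) • h.slope 7

theorem one_sub_μ_ν (h : E.IsRoot W w) (u : W) :
    (1 - h.μ * h.ν : smoothRing W) u = 2 * (w u - E.coeff 6 u) / w u := by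
  have h0 := h.ne_zero u u.2
  have h1 := h.root u u.2
  simp only [μ, ν, slope, sub_apply, mul_apply, one_apply, smul_apply, mk_apply]
  field_simp
  linear_combination -h1

theorem exists_inv (h : E.IsRoot W w) : ∃ i, (1 - h.μ * h.ν) * i = 1 := by
  refine (smoothRing.isUnit fun u => ?_).exists_right_inv
  rw [h.one_sub_μ_ν]
  exact div_ne_zero (mul_ne_zero two_ne_zero (sub_ne_zero.2 (h.ne u u.2))) (h.ne_zero u u.2)

/-- This is dF = 0 multiplied by -2/w; the root equation gives 1 + μν = 2F_s/w. -/
theorem rel (h : E.IsRoot W w) (u : W) (v : R7) :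
    h.μ u * fderiv ℝ E.par u v 5 - (1 + h.μ u * h.ν u) * fderiv ℝ E.par u v 6 +
      h.ν u * fderiv ℝ E.par u v 7 =
    2 * (h.slope 0 u * fderiv ℝ E.par u v 0 + h.slope 1 u * fderiv ℝ E.par u v 1 +
      h.slope 2 u * fderiv ℝ E.par u v 2 + h.slope 3 u * fderiv ℝ E.par u v 3 +
      h.slope 4 u * fderiv ℝ E.par u v 4) := by
  have h0 := h.ne_zero u u.2
  have h1 := h.root u u.2
  have h2 := sum_partialF (h.subset u.2) v
  simp only [Fin.sum_univ_eight] at h2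
  change E.coeff 0 u * _ + E.coeff 1 u * _ + E.coeff 2 u * _ + E.coeff 3 u * _ + E.coeff 4 u * _ +
    E.coeff 5 u * _ + E.coeff 6 u * _ + E.coeff 7 u * _ = 0 at h2
  simp only [μ, ν, slope, smul_apply, mk_apply]
  field_simp
  linear_combination (-2 * w u) * h2 - fderiv ℝ E.par u v 6 * h1

/-- The forms `dx, dy, dz, dp, dq` and the two vertical characteristic forms. -/
noncomputable def forms (h : E.IsRoot W w) :
    Fin 7 → Derivation ℝ (smoothRing W) (smoothRing W) →ₗ[smoothRing W] smoothRing W :=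
  let d := fun k => JetFrame.diff (jet h.subset k)
  ![d 0, d 1, d 2, d 3, d 4, d 5 - (2 * h.ν) • d 6 + h.ν ^ 2 • d 7,
    h.μ ^ 2 • d 5 - (2 * h.μ) • d 6 + d 7]

theorem vec_eq_zero (h : E.IsRoot W w) {Y : Derivation ℝ (smoothRing W) (smoothRing W)}
    (hY : IsVectorField Y) (u : W) (hu : ∀ j, h.forms j Y u = 0) : vec Y u = 0 := by
  obtain ⟨i, hi⟩ := h.exists_inv
  have hi' : (1 - h.μ u * h.ν u) * i u = 1 := congrArg (fun f : smoothRing W => f u) hi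
  have h0 := hu 0
  have h1 := hu 1
  have h2 := hu 2
  have h3 := hu 3
  have h4 := hu 4
  have h5 := hu 5
  have h6 := hu 6
  have hj := fun k => apply_jet h.subset hY k u
  have e2 : (2 : smoothRing W) u = 2 := rfl
  have ep : ∀ f : smoothRing W, (f ^ 2 : smoothRing W) u = f u ^ 2 := fun f => rfl
  simp only [forms, Matrix.cons_val, LinearMap.add_apply, LinearMap.sub_apply,
    LinearMap.smul_apply, JetFrame.diff_apply, smul_eq_mul, add_apply, sub_apply, mul_apply, hj,
    e2, ep] at h0 h1 h2 h3 h4 h5 h6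
  have hrel := h.rel u (vec Y u)
  simp only [h0, h1, h2, h3, h4, mul_zero, add_zero] at hrel
  obtain ⟨hr, hs, ht⟩ := vertical_eq_zero hi' h5 h6 hrel
  apply E.maximal_rank u (h.subset u.2)
  rw [map_zero]
  ext k
  fin_cases k <;> assumption

/-- By `vec_eq_zero` the seven forms are independent at each point, so the matrix of their values on
the coordinate fields has nowhere vanishing determinant and is invertible over the ring of smooth
functions. -/
theorem exists_vectorField (h : E.IsRoot W w) (c : Fin 7 → smoothRing W) :
    ∃ Y, IsVectorField Y ∧ ∀ j, h.forms j Y = c j := by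
  set M : Matrix (Fin 7) (Fin 7) (smoothRing W) :=
    Matrix.of fun k j => h.forms j (partialD k) with hM
  have hsum : ∀ (v : Fin 7 → smoothRing W) (j : Fin 7),
      h.forms j (∑ k, v k • partialD k) = (Matrix.vecMul v M) j := by
    intro v j
    simp [Matrix.vecMul, dotProduct, hM]
  have hdet : IsUnit M.det := by
    refine smoothRing.isUnit fun u hu => ?_
    have h1 : (M.map (eval u)).det = 0 := by
      rw [← hu]
      exact (RingHom.map_det (eval u).toRingHom M).symm
    obtain ⟨v, hv, hv0⟩ := Matrix.exists_vecMul_eq_zero_iff.2 h1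
    apply hv
    set Y : Derivation ℝ (smoothRing W) (smoothRing W) :=
      ∑ k, (algebraMap ℝ (smoothRing W) (v k)) • partialD k with hY
    have hvec : vec Y u = v := by
      funext k
      rw [vec, hY, sum_apply_coord]
      rfl
    rw [← hvec]
    refine h.vec_eq_zero (isVectorField_sum _) u fun j => ?_
    rw [hsum]
    have := congrFun hv0 j
    simp only [Matrix.vecMul, dotProduct, sum_apply, mul_apply, Matrix.map_apply] at this ⊢
    exact this
  refine ⟨∑ k, (Matrix.vecMul c M⁻¹) k • partialD k, isVectorField_sum _, fun j => ?_⟩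
  rw [hsum, Matrix.vecMul_vecMul, Matrix.nonsing_inv_mul _ hdet, Matrix.vecMul_one]

theorem rel_ring (h : E.IsRoot W w) {Y : Derivation ℝ (smoothRing W) (smoothRing W)}
    (hY : IsVectorField Y) : h.μ * Y (jet h.subset 5) - (1 + h.μ * h.ν) * Y (jet h.subset 6) +
      h.ν * Y (jet h.subset 7) = 2 * h.slope 0 * Y (jet h.subset 0) +
      2 * h.slope 1 * Y (jet h.subset 1) + 2 * h.slope 2 * Y (jet h.subset 2) +
      2 * h.slope 3 * Y (jet h.subset 3) + 2 * h.slope 4 * Y (jet h.subset 4) := by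
  ext u
  have := h.rel u (vec Y u)
  have e2 : (2 : smoothRing W) u = 2 := rfl
  simp only [add_apply, sub_apply, mul_apply, one_apply, e2, apply_jet h.subset hY]
  linear_combination this

theorem exists_vertical (h : E.IsRoot W w) {r s t : smoothRing W}
    (hrel : h.μ * r - (1 + h.μ * h.ν) * s + h.ν * t = 0) : ∃ Y, IsVectorField Y ∧
    Y (jet h.subset 0) = 0 ∧ Y (jet h.subset 1) = 0 ∧ Y (jet h.subset 2) = 0 ∧
    Y (jet h.subset 3) = 0 ∧ Y (jet h.subset 4) = 0 ∧ Y (jet h.subset 5) = r ∧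
    Y (jet h.subset 6) = s ∧ Y (jet h.subset 7) = t := by
  obtain ⟨i, hi⟩ := h.exists_inv
  obtain ⟨Y, hY, hj⟩ := h.exists_vectorField ![0, 0, 0, 0, 0, r - 2 * h.ν * s + h.ν ^ 2 * t,
    h.μ ^ 2 * r - 2 * h.μ * s + t]
  have h0 : Y (jet h.subset 0) = 0 := hj 0
  have h1 : Y (jet h.subset 1) = 0 := hj 1
  have h2 : Y (jet h.subset 2) = 0 := hj 2
  have h3 : Y (jet h.subset 3) = 0 := hj 3
  have h4 : Y (jet h.subset 4) = 0 := hj 4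
  have h5 : Y (jet h.subset 5) - 2 * h.ν * Y (jet h.subset 6) + h.ν ^ 2 * Y (jet h.subset 7) =
    r - 2 * h.ν * s + h.ν ^ 2 * t := hj 5
  have h6 : h.μ ^ 2 * Y (jet h.subset 5) - 2 * h.μ * Y (jet h.subset 6) + Y (jet h.subset 7) =
    h.μ ^ 2 * r - 2 * h.μ * s + t := hj 6
  have h7 := h.rel_ring hY
  simp only [h0, h1, h2, h3, h4, mul_zero, add_zero] at h7
  obtain ⟨e1, e2, e3⟩ := vertical_eq_zero (r := Y (jet h.subset 5) - r)
    (s := Y (jet h.subset 6) - s) (t := Y (jet h.subset 7) - t) hi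
    (by linear_combination h5) (by linear_combination h6) (by linear_combination h7 - hrel)
  exact ⟨Y, hY, h0, h1, h2, h3, h4, sub_eq_zero.1 e1, sub_eq_zero.1 e2, sub_eq_zero.1 e3⟩

theorem exists_jetFrame (h : E.IsRoot W w) : ∃ F : JetFrame (smoothRing W),
    F.VF = IsVectorField ∧ F.x = jet h.subset 0 ∧ F.y = jet h.subset 1 ∧ F.z = jet h.subset 2 ∧
    F.p = jet h.subset 3 ∧ F.q = jet h.subset 4 ∧ F.r = jet h.subset 5 ∧ F.s = jet h.subset 6 ∧
    F.t = jet h.subset 7 ∧ F.μ = h.μ ∧ F.ν = h.ν := by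
  set j := jet h.subset with hj
  obtain ⟨i, hi⟩ := h.exists_inv
  obtain ⟨ex, hex, hexj⟩ := h.exists_vectorField ![1, 0, j 3, j 5, j 6, 0, 0]
  obtain ⟨ey, hey, heyj⟩ := h.exists_vectorField ![0, 1, j 4, j 6, j 7, 0, 0]
  obtain ⟨b₁, hb₁, hb₁j⟩ := h.exists_vertical (r := 1) (s := h.μ) (t := h.μ ^ 2) (by ring)
  obtain ⟨b₂, hb₂, hb₂j⟩ := h.exists_vertical (r := h.ν ^ 2) (s := h.ν) (t := 1) (by ring)
  refine ⟨{ VF := IsVectorField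
            add := fun h h' => h.add h'
            smul := fun g _ h => h.smul g
            lie := fun h h' => h.lie h'
            x := j 0
            y := j 1
            z := j 2
            p := j 3
            q := j 4
            r := j 5
            s := j 6
            t := j 7
            μ := h.μ
            ν := h.ν
            i := i
            inv := hi
            h := fun k => 2 * h.slope (k.castLE (by norm_num))
            rel := fun Y hY => h.rel_ring hY
            faithful := ?_
            ex := ex
            ey := ey
            b₁ := b₁
            b₂ := b₂
            vf_ex := hex
            vf_ey := hey
            vf_b₁ := hb₁
            vf_b₂ := hb₂
            ex_table := ⟨hexj 0, hexj 1, hexj 2, hexj 3, hexj 4⟩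
            ey_table := ⟨heyj 0, heyj 1, heyj 2, heyj 3, heyj 4⟩
            b₁_table := hb₁j
            b₂_table := hb₂j }, rfl, rfl, rfl, rfl, rfl, rfl, rfl, rfl, rfl, rfl, rfl⟩
  intro Y hY h0 h1 h2 h3 h4 h5 h6 h7
  have hvec : ∀ u, vec Y u = 0 := fun u => h.vec_eq_zero hY u fun k => by
    fin_cases k <;> simp [forms, ← hj, h0, h1, h2, h3, h4, h5, h6, h7]
  rw [hY]
  refine Finset.sum_eq_zero fun k _ => ?_
  have : Y (coord k) = 0 := smoothRing.ext fun u => congrFun (hvec u) k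
  rw [this, zero_smul]

/-- At a zero of b₁μ the nonzero vector b₁ would be a Cauchy characteristic of {ω¹, μω² - ω³}. At a
zero of b₂ν the same would hold for b₂ and {ω¹, ω² - νω³}. Class 7 forbids both. -/
theorem isUnit_slopes (h : E.IsRoot W w) (hE : E.IsHyperbolic) (hG : E.IsGeneric)
    {F : JetFrame (smoothRing W)} (hF : F.VF = IsVectorField ∧ F.x = jet h.subset 0 ∧
    F.y = jet h.subset 1 ∧ F.z = jet h.subset 2 ∧
    F.p = jet h.subset 3 ∧ F.q = jet h.subset 4 ∧ F.r = jet h.subset 5 ∧ F.s = jet h.subset 6 ∧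
    F.t = jet h.subset 7 ∧ F.μ = h.μ ∧ F.ν = h.ν) :
    IsUnit (F.b₁ F.μ) ∧ IsUnit (F.b₂ F.ν) := by
  obtain ⟨hvf, hx, hy, hz, hp, hq, hr, hs, ht, hμ, hν⟩ := hF
  have v₁ := F.vf_b₁
  have v₂ := F.vf_b₂
  have t₁ := F.b₁_table
  have t₂ := F.b₂_table
  rw [hvf] at v₁ v₂
  rw [hx, hy, hz, hp, hq, hr, hs, ht, hμ] at t₁
  rw [hx, hy, hz, hp, hq, hr, hs, ht, hν] at t₂
  have dJ₁ := fun k u => apply_jet h.subset v₁ k u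
  have dJ₂ := fun k u => apply_jet h.subset v₂ k u
  have hsm : ∀ f : smoothRing W, ContDiffOn ℝ ∞ (extend f) W := contDiffOn_extend
  have hd : ∀ {Y : Derivation ℝ (smoothRing W) (smoothRing W)}, IsVectorField Y →
      ∀ (f : smoothRing W) (u : W), fderiv ℝ (extend f) u (vec Y u) = Y f u := by
    intro Y hY f u
    have : f = smoothRing.mk (extend f) (hsm f) := smoothRing.ext fun u => (extend_apply f u).symm
    conv_rhs => rw [this, hY.apply_mk]
    rfl
  rw [hμ, hν]
  constructor
  · refine smoothRing.isUnit fun u hu => ?_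
    have hb := eq_zero_of_cauchy hE hG W.isOpen h.subset (α := extend h.μ) (β := fun _ => -1)
      (hsm _) contDiffOn_const (fun _ _ => Or.inr (by norm_num)) (fun v hv => ?_) u.2
      (b := vec F.b₁ u) (fun k => ?_) ?_ ?_ ((hd v₁ _ u).trans hu) (by simp)
    · have := dJ₁ 5 u
      rw [hb, t₁.2.2.2.2.2.1] at this
      simp at this
    · have h0 := h.ne_zero v hv
      have h1 := h.root v hv
      rw [extend_apply' _ hv]
      change _ ^ 2 * E.coeff 7 v - _ * E.coeff 6 v + _ * E.coeff 5 v = 0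
      simp only [μ, slope, smul_apply, mk_apply]
      field_simp
      linear_combination E.coeff 5 v * h1
    · fin_cases k
      · exact (dJ₁ 0 u).symm.trans (by rw [t₁.1]; rfl)
      · exact (dJ₁ 1 u).symm.trans (by rw [t₁.2.1]; rfl)
      · exact (dJ₁ 2 u).symm.trans (by rw [t₁.2.2.1]; rfl)
      · exact (dJ₁ 3 u).symm.trans (by rw [t₁.2.2.2.1]; rfl)
      · exact (dJ₁ 4 u).symm.trans (by rw [t₁.2.2.2.2.1]; rfl)
    · rw [← dJ₁ 5 u, ← dJ₁ 6 u, t₁.2.2.2.2.2.1, t₁.2.2.2.2.2.2.1, extend_apply]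
      simp
    · rw [← dJ₁ 6 u, ← dJ₁ 7 u, t₁.2.2.2.2.2.2.1, t₁.2.2.2.2.2.2.2, extend_apply, pow_two]
      simp
  · refine smoothRing.isUnit fun u hu => ?_
    have hneg : ∀ v, fderiv ℝ (fun x => -extend h.ν x) v = -fderiv ℝ (extend h.ν) v :=
      fun v => fderiv_neg
    have hb := eq_zero_of_cauchy hE hG W.isOpen h.subset (α := fun _ => 1)
      (β := fun x => -extend h.ν x) contDiffOn_const (hsm _).neg
      (fun _ _ => Or.inl one_ne_zero) (fun v hv => ?_) u.2
      (b := vec F.b₂ u) (fun k => ?_) ?_ ?_ (by simp) (by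
        rw [hneg, _root_.neg_apply, hd v₂, hu, neg_zero])
    · have := dJ₂ 7 u
      rw [hb, t₂.2.2.2.2.2.2.2] at this
      simp at this
    · have h0 := h.ne_zero v hv
      have h1 := h.root v hv
      rw [extend_apply' _ hv]
      change _ ^ 2 * E.coeff 7 v - _ * E.coeff 6 v + _ * E.coeff 5 v = 0
      simp only [ν, slope, smul_apply, mk_apply]
      field_simp
      linear_combination E.coeff 7 v * h1
    · fin_cases k
      · exact (dJ₂ 0 u).symm.trans (by rw [t₂.1]; rfl)
      · exact (dJ₂ 1 u).symm.trans (by rw [t₂.2.1]; rfl)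
      · exact (dJ₂ 2 u).symm.trans (by rw [t₂.2.2.1]; rfl)
      · exact (dJ₂ 3 u).symm.trans (by rw [t₂.2.2.2.1]; rfl)
      · exact (dJ₂ 4 u).symm.trans (by rw [t₂.2.2.2.2.1]; rfl)
    · rw [← dJ₂ 5 u, ← dJ₂ 6 u, t₂.2.2.2.2.2.1, t₂.2.2.2.2.2.2.1, extend_apply, pow_two]
      simp
    · rw [← dJ₂ 6 u, ← dJ₂ 7 u, t₂.2.2.2.2.2.2.1, t₂.2.2.2.2.2.2.2, extend_apply]
      simp

end IsRoot

end Equation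

end Equations

/-! ### From the closed linear system to the dimension bound -/

section Reduction

open TopologicalSpace
open smoothRing hiding mk

namespace smoothRing

variable {W : Opens R7}

theorem fderiv_extend_vec {Y : Derivation ℝ (smoothRing W) (smoothRing W)} (hY : IsVectorField Y)
    (f : smoothRing W) (u : W) : fderiv ℝ (extend f) u (vec Y u) = Y f u := by
  have : f = smoothRing.mk (extend f) (contDiffOn_extend f) :=
    smoothRing.ext fun u => (extend_apply f u).symm
  conv_rhs => rw [this, hY.apply_mk]
  rfl

/-- The derivation given by a smooth vector field. -/
noncomputable def ofField (X : R7 → R7) (hX : ContDiffOn ℝ ∞ X W) :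
    Derivation ℝ (smoothRing W) (smoothRing W) :=
  ∑ k, smoothRing.mk (fun u => X u k) (contDiffOn_pi.1 hX k) • partialD k

theorem isVectorField_ofField (X : R7 → R7) (hX : ContDiffOn ℝ ∞ X W) :
    IsVectorField (ofField X hX) := isVectorField_sum _

theorem ofField_coord (X : R7 → R7) (hX : ContDiffOn ℝ ∞ X W) (k : Fin 7) :
    ofField X hX (coord k) = smoothRing.mk (fun u => X u k) (contDiffOn_pi.1 hX k) :=
  sum_apply_coord _ _

theorem vec_ofField (X : R7 → R7) (hX : ContDiffOn ℝ ∞ X W) (u : W) :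
    vec (ofField X hX) u = X u := by
  funext k
  rw [vec, ofField_coord]
  rfl

/-- The coefficients of a derivation, extended by zero to `ℝ⁷`. -/
noncomputable def field (Y : Derivation ℝ (smoothRing W) (smoothRing W)) : R7 → R7 :=
  fun v k => extend (Y (coord k)) v

theorem field_apply (Y : Derivation ℝ (smoothRing W) (smoothRing W)) {v : R7} (hv : v ∈ W) :
    field Y v = vec Y ⟨v, hv⟩ := funext fun _ => extend_apply' _ hv

theorem differentiableAt_field (Y : Derivation ℝ (smoothRing W) (smoothRing W)) (u : W) :
    DifferentiableAt ℝ (field Y) u :=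
  differentiableAt_pi.2 fun _ => differentiableAt_extend _ u

theorem vec_ofField_lie (X : R7 → R7) (hX : ContDiffOn ℝ ∞ X W)
    {Y : Derivation ℝ (smoothRing W) (smoothRing W)} (hY : IsVectorField Y) (u : W) :
    vec ⁅ofField X hX, Y⁆ u = fderiv ℝ (field Y) u (X u) - fderiv ℝ X u (vec Y u) := by
  have dX := (hX.contDiffAt (W.isOpen.mem_nhds u.2)).differentiableAt (by simp)
  funext k
  have h1 := fderiv_extend_vec (isVectorField_ofField X hX) (Y (coord k)) u
  rw [vec_ofField] at h1
  have h2 : (Y (ofField X hX (coord k)) : smoothRing W) u =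
      fderiv ℝ (fun u => X u k) u (vec Y u) := by
    rw [ofField_coord, hY.apply_mk]
    rfl
  have h3 := fderiv_apply dX k
  have h4 := fderiv_apply (differentiableAt_field Y u) k
  rw [vec, Derivation.commutator_apply, sub_apply, ← h1, h2, h3]
  change fderiv ℝ (fun v => field Y v k) u (X u) - _ = _
  rw [h4]
  rfl

theorem apply_eq_zero_of_vec {Y : Derivation ℝ (smoothRing W) (smoothRing W)}
    (hY : IsVectorField Y)
    (θ : Derivation ℝ (smoothRing W) (smoothRing W) →ₗ[smoothRing W] smoothRing W) {u : W}
    (hu : vec Y u = 0) : θ Y u = 0 := by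
  rw [hY, map_sum, sum_apply]
  refine Finset.sum_eq_zero fun k _ => ?_
  rw [map_smul, smul_eq_mul, mul_apply]
  have : (Y (coord k) : smoothRing W) u = 0 := congrFun hu k
  rw [this, zero_mul]

theorem ofField_add {X X' : R7 → R7} (hX : ContDiffOn ℝ ∞ X W) (hX' : ContDiffOn ℝ ∞ X' W)
    (h : ContDiffOn ℝ ∞ (X + X') W) : ofField (X + X') h = ofField X hX + ofField X' hX' := by
  simp only [ofField, ← Finset.sum_add_distrib, ← add_smul]
  rfl

theorem ofField_smul {X : R7 → R7} (c : ℝ) (hX : ContDiffOn ℝ ∞ X W)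
    (h : ContDiffOn ℝ ∞ (c • X) W) : ofField (c • X) h = c • ofField X hX := by
  simp only [ofField, Finset.smul_sum, ← smul_assoc]
  rfl

theorem add_lie_derivation (X X' Y : Derivation ℝ (smoothRing W) (smoothRing W)) :
    ⁅X + X', Y⁆ = ⁅X, Y⁆ + ⁅X', Y⁆ := Derivation.ext fun f => by
  simp only [Derivation.commutator_apply, Derivation.add_apply, map_add]
  ring

theorem smul_lie_real (c : ℝ) (X Y : Derivation ℝ (smoothRing W) (smoothRing W)) :
    ⁅c • X, Y⁆ = c • ⁅X, Y⁆ := Derivation.ext fun f => by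
  simp only [Derivation.commutator_apply, Derivation.smul_apply, smul_sub]
  rw [Derivation.map_smul]

/-- Solutions of a total linear system of differential equations on a convex set are determined
by their value at one point. -/
theorem eq_zero_of_partialD_eq (hW : Convex ℝ (W : Set R7)) {n : ℕ} (f : Fin n → smoothRing W)
    (Γ : Fin 7 → Fin n → Fin n → smoothRing W)
    (h : ∀ k i, partialD k (f i) = ∑ j, Γ k i j * f j) {u : W} (hu : ∀ i, f i u = 0) (v : W)
    (i : Fin n) : f i v = 0 := by
  -- Restricted to a segment, the total system becomes a linear ordinary differential equation with
  -- coefficient matrix `M`, and a Grönwall estimate with a bound for `M` gives uniqueness.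
  set γ : ℝ → R7 := fun s => u.1 + s • (v.1 - u.1) with hγ
  have hγW : ∀ s ∈ Set.Icc (0 : ℝ) 1, γ s ∈ W := fun s hs =>
    hW.add_smul_sub_mem u.2 v.2 hs
  have hγd : ∀ s, HasDerivAt γ (v.1 - u.1) s := fun s => by
    have := ((hasDerivAt_id s).smul_const (v.1 - u.1)).const_add u.1
    rwa [one_smul] at this
  have hγc : Continuous γ := by fun_prop
  set g : ℝ → Fin n → ℝ := fun s i => extend (f i) (γ s) with hg
  set M : ℝ → Fin n → Fin n → ℝ := fun s i j => ∑ k, (v.1 - u.1) k * extend (Γ k i j) (γ s)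
    with hM
  have hcomp : ∀ a : smoothRing W, ContinuousOn (fun s => extend a (γ s)) (Set.Icc 0 1) :=
    fun a => (contDiffOn_extend a).continuousOn.comp hγc.continuousOn hγW
  have hgd : ∀ s ∈ Set.Icc (0 : ℝ) 1, HasDerivAt g (fun i => ∑ j, M s i j * g s j) s := by
    intro s hs
    rw [hasDerivAt_pi]
    intro i
    have h1 := (differentiableAt_extend (f i) ⟨γ s, hγW s hs⟩).hasFDerivAt.comp_hasDerivAt s
      (hγd s)
    refine h1.congr_deriv ?_
    have e : (v.1 - u.1) = ∑ k, (v.1 - u.1) k • (Pi.single k 1 : R7) := by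
      ext j
      simp [Pi.single_apply]
    symm
    rw [e, map_sum]
    have h2 : ∀ k, fderiv ℝ (extend (f i)) (γ s) (Pi.single k 1) =
        ∑ j, extend (Γ k i j) (γ s) * g s j := by
      intro k
      have := congrArg (fun a : smoothRing W => a ⟨γ s, hγW s hs⟩) (h k i)
      simp only [partialD_apply, sum_apply, mul_apply] at this
      rw [this]
      refine Finset.sum_congr rfl fun j _ => ?_
      rw [hg]
      simp only [extend_apply' _ (hγW s hs)]
    simp only [map_smul, h2, smul_eq_mul, hM, Finset.sum_mul, Finset.mul_sum]
    rw [Finset.sum_comm]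
    simp only [mul_assoc]
  have hB : ContinuousOn (fun s => ∑ i, ∑ j, |M s i j|) (Set.Icc 0 1) := by
    refine continuousOn_finsetSum _ fun i _ => continuousOn_finsetSum _ fun j _ =>
      ContinuousOn.abs (continuousOn_finsetSum _ fun k _ => continuousOn_const.mul (hcomp _))
  obtain ⟨K, hK⟩ := (isCompact_Icc.image_of_continuousOn hB).bddAbove
  have key := eq_zero_of_abs_deriv_le_mul_abs_self_of_eq_zero_right (f := g)
    (f' := fun s i => ∑ j, M s i j * g s j) (K := K) (a := 0) (b := 1)
    (fun s hs => (hgd s hs).continuousAt.continuousWithinAt)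
    (fun s hs => (hgd s (Set.Ico_subset_Icc_self hs)).hasDerivWithinAt)
    (funext fun i => by simp [hg, hγ, hu]) (fun s hs => ?_) 1 (by simp)
  · have := congrFun key i
    simpa [hg, hγ] using this
  · have hKs := hK ⟨s, Set.Ico_subset_Icc_self hs, rfl⟩
    have hK0 : 0 ≤ K := (Finset.sum_nonneg fun i _ => Finset.sum_nonneg fun j _ =>
      abs_nonneg (M s i j)).trans hKs
    refine (pi_norm_le_iff_of_nonneg (mul_nonneg hK0 (norm_nonneg _))).2 fun i => ?_
    calc ‖∑ j, M s i j * g s j‖ ≤ ∑ j, ‖M s i j * g s j‖ := norm_sum_le _ _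
      _ ≤ ∑ j, |M s i j| * ‖g s‖ := Finset.sum_le_sum fun j _ => by
          rw [norm_mul]
          exact mul_le_mul_of_nonneg_left (norm_le_pi_norm _ _) (abs_nonneg _)
      _ = (∑ j, |M s i j|) * ‖g s‖ := (Finset.sum_mul ..).symm
      _ ≤ K * ‖g s‖ := by
          refine mul_le_mul_of_nonneg_right (le_trans ?_ hKs) (norm_nonneg _)
          exact Finset.single_le_sum (f := fun i => ∑ j, |M s i j|)
            (fun i _ => Finset.sum_nonneg fun j _ => abs_nonneg _) (Finset.mem_univ i)

end smoothRing

namespace Equation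

variable {E : Equation} {W : Opens R7}

/-- Differentiating ω(Y) = 0 along X gives (L_X ω)(Y) + ω([X, Y]) = 0, and the first term vanishes
since L_X ω lies in the contact system. -/
theorem form_lie_eq_zero {U : Opens R7} (hU : (U : Set R7) ⊆ E.Sig) (hWU : W ≤ U)
    {X : R7 → R7} (hX : X ∈ E.symmetryAlgebra U)
    {Y : Derivation ℝ (smoothRing W) (smoothRing W)} (hY : IsVectorField Y)
    (h : ∀ a (u : W), E.form a u (vec Y u) = 0) (a : Fin 3) (u : W) :
    E.form a u (vec ⁅ofField X (hX.1.mono hWU), Y⁆ u) = 0 := by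
  rw [vec_ofField_lie _ _ hY]
  have h0 : (fun v => E.form a v (field Y v)) =ᶠ[nhds u.1] fun _ => 0 := by
    filter_upwards [W.isOpen.mem_nhds u.2] with v hv
    rw [field_apply Y hv]
    exact h a ⟨v, hv⟩
  have h1 := (differentiableAt_form (hU (hWU u.2)) a).hasFDerivAt.clm_apply
    (differentiableAt_field Y u).hasFDerivAt
  have h2 := congrArg (fun l => l (X u)) (h1.fderiv.symm.trans h0.fderiv_eq)
  simp [field_apply Y u.2] at h2
  have h3 := hX.2.2 u (hWU u.2) a
  have h4 : ∀ σ ∈ E.system u, σ (vec Y u) = 0 := fun σ hσ => by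
    refine Submodule.span_induction ?_ (by simp) (fun _ _ _ _ h h' => by simp [h, h'])
      (fun c _ _ h => by simp [h]) hσ
    rintro _ ⟨b, rfl⟩
    exact h b u
  have h5 := h4 _ h3
  simp only [lieD, _root_.add_apply, ContinuousLinearMap.comp_apply] at h5
  rw [map_sub]
  linear_combination h2 - h5

set_option maxHeartbeats 800000 in
/-- Evaluation of nine functions determining a contact symmetry. -/
theorem exists_determining_map (hE : E.IsHyperbolic) (hG : E.IsGeneric) {U : Opens R7}
    (hU : (U : Set R7) ⊆ E.Sig) {u₀ : R7} (hu₀ : u₀ ∈ U) : ∃ W : Opens R7, u₀ ∈ W ∧ W ≤ U ∧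
    ∃ Λ : W → E.symmetryAlgebra U →ₗ[ℝ] (Fin 9 → ℝ), ∀ (X : E.symmetryAlgebra U) (v : W),
      (Λ v X = 0 → ∀ w ∈ W, X.1 w = 0) ∧ (X.1 =ᶠ[nhds v.1] 0 → Λ v X = 0) := by
  obtain ⟨W, w, hu₀W, hWU, hconv, hroot⟩ := exists_isRoot hE U.isOpen hU hu₀
  obtain ⟨F, hF⟩ := hroot.exists_jetFrame
  obtain ⟨hμ, hν⟩ := hroot.isUnit_slopes hE hG hF
  obtain ⟨hvf, hx, hy, hz, hp, hq, hr, hs, ht, -, -⟩ := hF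
  have hcontact : ∀ Y, F.IsContact Y ↔ IsVectorField Y ∧
      ∀ a (u : W), E.form a u (vec Y u) = 0 := by
    intro Y
    have hform : IsVectorField Y → ∀ u : W, E.form 0 u (vec Y u) = F.ω₁ Y u ∧
        E.form 1 u (vec Y u) = F.ω₂ Y u ∧ E.form 2 u (vec Y u) = F.ω₃ Y u := by
      intro hY u
      obtain ⟨f0, f1, f2⟩ := E.form_apply u (vec Y u)
      rw [f0, f1, f2, F.ω₁_apply, F.ω₂_apply, F.ω₃_apply, hx, hy, hz, hp, hq, hr, hs, ht]
      simp only [smoothRing.sub_apply, smoothRing.mul_apply, apply_jet hroot.subset hY]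
      exact ⟨rfl, rfl, rfl⟩
    constructor
    · rintro ⟨h, h1, h2, h3⟩
      rw [hvf] at h
      refine ⟨h, fun a u => ?_⟩
      obtain ⟨f0, f1, f2⟩ := hform h u
      fin_cases a
      · exact f0.trans (by rw [h1]; rfl)
      · exact f1.trans (by rw [h2]; rfl)
      · exact f2.trans (by rw [h3]; rfl)
    · rintro ⟨h, h'⟩
      refine ⟨by rwa [hvf], smoothRing.ext fun u => ?_, smoothRing.ext fun u => ?_,
        smoothRing.ext fun u => ?_⟩
      · exact (hform h u).1.symm.trans (h' 0 u)
      · exact (hform h u).2.1.symm.trans (h' 1 u)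
      · exact (hform h u).2.2.symm.trans (h' 2 u)
  have ha₁ : IsVectorField F.a₁ := hvf ▸ F.vf_a₁
  have ha₂ : IsVectorField F.a₂ := hvf ▸ F.vf_a₂
  set D : E.symmetryAlgebra U → Derivation ℝ (smoothRing W) (smoothRing W) :=
    fun X => ofField X.1 (X.2.1.mono hWU) with hD
  have hDvf : ∀ X, IsVectorField (D X) := fun X => isVectorField_ofField _ _
  have hDadd : ∀ X Y, D (X + Y) = D X + D Y := fun X Y => ofField_add _ _ _
  have hDsmul : ∀ (c : ℝ) X, D (c • X) = c • D X := fun c X => ofField_smul c _ _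
  -- The nine functions: seven components of X, then α₁ and κ₂.
  let T : E.symmetryAlgebra U → Fin 9 → smoothRing W := fun X =>
    Fin.append (m := 7) (n := 2) (fun k => D X (coord k))
      ![F.θ₀ ⁅D X, F.a₁⁆, F.θ₃ ⁅D X, F.a₂⁆]
  have hTl : ∀ X (k : Fin 7), T X (Fin.castAdd 2 k) = D X (coord k) :=
    fun X k => Fin.append_left _ _ _
  have hT7 : ∀ X, T X (Fin.natAdd 7 (0 : Fin 2)) = F.θ₀ ⁅D X, F.a₁⁆ :=
    fun X => Fin.append_right _ _ _
  have hT8 : ∀ X, T X (Fin.natAdd 7 (1 : Fin 2)) = F.θ₃ ⁅D X, F.a₂⁆ :=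
    fun X => Fin.append_right _ _ _
  have hcases : ∀ P : Fin 9 → Prop, (∀ k : Fin 7, P (Fin.castAdd 2 k)) →
      P (Fin.natAdd 7 (0 : Fin 2)) → P (Fin.natAdd 7 (1 : Fin 2)) → ∀ i, P i := by
    intro P h1 h2 h3 i
    refine Fin.addCases (m := 7) (n := 2) (motive := P) h1 (fun j => ?_) i
    fin_cases j
    · exact h2
    · exact h3
  have hθs : ∀ (θ : Derivation ℝ (smoothRing W) (smoothRing W) →ₗ[smoothRing W] smoothRing W)
      (c : ℝ) Y, θ (c • Y) = c • θ Y := fun θ c Y => by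
    rw [← IsScalarTower.algebraMap_smul (smoothRing W) c Y, map_smul,
      IsScalarTower.algebraMap_smul]
  have hTadd : ∀ X Y i, T (X + Y) i = T X i + T Y i := by
    intro X Y
    refine hcases _ (fun k => ?_) ?_ ?_
    · simp only [hTl, hDadd, Derivation.add_apply]
    · simp only [hT7, hDadd, add_lie_derivation, map_add]
    · simp only [hT8, hDadd, add_lie_derivation, map_add]
  have hTsmul : ∀ (c : ℝ) X i, T (c • X) i = c • T X i := by
    intro c X
    refine hcases _ (fun k => ?_) ?_ ?_
    · simp only [hTl, hDsmul, Derivation.smul_apply]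
    · simp only [hT7, hDsmul, smul_lie_real, hθs]
    · simp only [hT8, hDsmul, smul_lie_real, hθs]
  refine ⟨W, hu₀W, hWU, fun v => { toFun := fun X i => T X i v
                                   map_add' := fun X Y => funext fun i => by
                                    simp only [hTadd, smoothRing.add_apply, Pi.add_apply]
                                   map_smul' := fun c X => funext fun i => by
                                    simp only [hTsmul, smoothRing.smul_apply, Pi.smul_apply, smul_eq_mul,
                                      RingHom.id_apply] }, fun X v => ⟨fun h => ?_, fun h => ?_⟩⟩
  · have hmem : ∀ i, T X i ∈ Ideal.span (Set.range (T X)) := fun i =>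
      Ideal.subset_span ⟨i, rfl⟩
    have hder : ∀ k i, partialD k (T X i) ∈ Ideal.span (Set.range (T X)) := by
      intro k i
      have hk : IsVectorField (partialD k : Derivation ℝ (smoothRing W) (smoothRing W)) := by
        rw [isVectorField_iff]
        intro f
        simp [partialD_coord]
      refine F.apply_mem_ideal (X := D X) (fun Y hY => ?_) hμ hν (Set.range (T X)) ?_
        (fun g => ?_) (hT7 X ▸ hmem _) (hT8 X ▸ hmem _) (Y := partialD k) (by rwa [hvf]) _ (hmem i)
      · rw [hcontact] at hY ⊢
        exact ⟨(hDvf X).lie hY.1, form_lie_eq_zero hU hWU X.2 hY.1 hY.2⟩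
      · rintro _ ⟨i, rfl⟩
        revert i
        refine hcases _ (fun k => Or.inl ?_) (Or.inr (Or.inl (hT7 X))) (Or.inr (Or.inr (hT8 X)))
        exact ⟨coord k, (hTl X k).symm⟩
      · rw [(hDvf X).apply g]
        refine Ideal.sum_mem _ fun k _ => Ideal.mul_mem_right _ _ ?_
        rw [← hTl]
        exact hmem _
    -- Ideal membership of the derivatives yields coefficients of the total linear system. They may
    -- depend on X, which is harmless for uniqueness.
    have hΓ := fun k i => Ideal.mem_span_range_iff_exists_fun.1 (hder k i)
    choose Γ hΓ using hΓ
    have hzero := smoothRing.eq_zero_of_partialD_eq hconv (T X) Γ (fun k i => (hΓ k i).symm)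
      (u := v) (fun i => congrFun h i)
    intro w hw
    funext k
    have h1 := hzero ⟨w, hw⟩ (Fin.castAdd 2 k)
    rw [hTl] at h1
    have h2 := congrFun (vec_ofField X.1 (X.2.1.mono hWU) ⟨w, hw⟩) k
    exact h2.symm.trans h1
  · have hlie : ∀ Y : Derivation ℝ (smoothRing W) (smoothRing W), IsVectorField Y →
        vec ⁅D X, Y⁆ v = 0 := fun Y hY => by
      rw [vec_ofField_lie _ _ hY, h.fderiv_eq, h.eq_of_nhds]
      simp
    funext i
    change T X i v = 0
    revert i
    refine hcases _ (fun k => ?_) ?_ ?_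
    · rw [hTl]
      have h2 := congrFun (vec_ofField X.1 (X.2.1.mono hWU) v) k
      rw [h.eq_of_nhds] at h2
      exact h2
    · rw [hT7]
      exact apply_eq_zero_of_vec ((hDvf X).lie ha₁) _ (hlie _ ha₁)
    · rw [hT8]
      exact apply_eq_zero_of_vec ((hDvf X).lie ha₂) _ (hlie _ ha₂)

/-- Evaluating the nine functions at one point is injective: the open set of points near which X
vanishes is also closed in U. -/
theorem finrank_symmetryAlgebra_le (hE : E.IsHyperbolic) (hG : E.IsGeneric) {U : Opens R7}
    (hU : (U : Set R7) ⊆ E.Sig) (hconn : IsConnected (U : Set R7)) :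
    Module.Finite ℝ (E.symmetryAlgebra U) ∧ Module.finrank ℝ (E.symmetryAlgebra U) ≤ 9 := by
  obtain ⟨u₀, hu₀⟩ := hconn.nonempty
  obtain ⟨W, huW, -, Λ, hΛ⟩ := exists_determining_map hE hG hU hu₀
  have hinj : Function.Injective (Λ ⟨u₀, huW⟩) := by
    rw [injective_iff_map_eq_zero]
    intro X hX
    have hopen : IsOpen {u | X.1 =ᶠ[nhds u] 0} := isOpen_setOfPred_eventually_nhds
    have hmem : u₀ ∈ {u | X.1 =ᶠ[nhds u] 0} := by
      filter_upwards [W.isOpen.mem_nhds huW] with v hv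
      exact (hΛ X ⟨u₀, huW⟩).1 hX v hv
    have hsub := hconn.isPreconnected.subset_of_closure_inter_subset hopen ⟨u₀, hu₀, hmem⟩ ?_
    · refine Subtype.ext (funext fun u => ?_)
      by_cases hu : u ∈ U
      · exact Filter.EventuallyEq.eq_of_nhds (hsub hu)
      · exact X.2.2.1 u hu
    · rintro u ⟨huc, huU⟩
      -- At a limit point the determining neighbourhood meets the vanishing set. The nine functions
      -- vanish at a common point, so X vanishes on the whole neighbourhood.
      obtain ⟨W', huW', -, Λ', hΛ'⟩ := exists_determining_map hE hG hU huU
      obtain ⟨v, hvW', hv⟩ := mem_closure_iff.1 huc W' W'.isOpen huW'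
      have h1 := (hΛ' X ⟨v, hvW'⟩).1 ((hΛ' X ⟨v, hvW'⟩).2 hv)
      filter_upwards [W'.isOpen.mem_nhds huW'] with w hw
      exact h1 w hw
  refine ⟨Module.Finite.of_injective _ hinj, ?_⟩
  simpa using LinearMap.finrank_le_finrank_of_injective hinj

end Equation

end Reduction

/-! ### Fundamental vector fields of local transformation groups -/

section LieGroups

open TopologicalSpace

namespace Equation

variable {E : Equation}

theorem mem_system_iff {u : R7} {α : R7 →L[ℝ] ℝ} :
    α ∈ E.system u ↔ ∀ v, (∀ a, E.form a u v = 0) → α v = 0 := by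
  constructor
  · intro h v hv
    refine Submodule.span_induction ?_ (by simp) (fun _ _ _ _ h h' => by simp [h, h'])
      (fun c _ _ h => by simp [h]) h
    rintro _ ⟨b, rfl⟩
    exact hv b
  · intro h
    have h1 := mem_span_of_iInf_ker_le_ker (𝕜 := ℝ) (L := fun a => (E.form a u).toLinearMap)
      (K := α.toLinearMap) fun v hv => h v fun a => (Submodule.mem_iInf _).1 hv a
    obtain ⟨c, hc⟩ := (Submodule.mem_span_range_iff_exists_fun ℝ).1 h1
    refine (Submodule.mem_span_range_iff_exists_fun ℝ).2 ⟨c, ?_⟩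
    ext v
    have := congrArg (fun l => l v) hc
    simpa using this

end Equation

namespace LocalAction

variable {d : ℕ} {G : LocalLieGroup d} {U : Opens R7} (Φ : LocalAction G (U : Set R7))

/-- The action as a function of both variables. -/
def uncurried : (Fin d → ℝ) × R7 → R7 := fun y => Φ.act y.1 y.2

/-- The fundamental vector field of an element of the Lie algebra. -/
noncomputable def fundamental (ξ : Fin d → ℝ) : R7 → R7 :=
  (U : Set R7).indicator fun u => fderiv ℝ Φ.uncurried (0, u) (ξ, 0)

theorem contDiffAt_uncurried {y : (Fin d → ℝ) × R7} (hy : y ∈ Φ.dom) :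
    ContDiffAt ℝ ∞ Φ.uncurried y :=
  Φ.smooth_act.contDiffAt (Φ.isOpen_dom.mem_nhds hy)

theorem differentiableAt_uncurried {y : (Fin d → ℝ) × R7} (hy : y ∈ Φ.dom) :
    DifferentiableAt ℝ Φ.uncurried y :=
  (Φ.contDiffAt_uncurried hy).differentiableAt (by simp)

theorem contDiffAt_fderiv_uncurried {y : (Fin d → ℝ) × R7} (hy : y ∈ Φ.dom) :
    ContDiffAt ℝ ∞ (fderiv ℝ Φ.uncurried) y :=
  (Φ.contDiffAt_uncurried hy).fderiv_right (m := ∞) (by simp)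

theorem fundamental_apply (ξ : Fin d → ℝ) {u : R7} (hu : u ∈ U) :
    Φ.fundamental ξ u = fderiv ℝ Φ.uncurried (0, u) (ξ, 0) :=
  Set.indicator_of_mem (s := (U : Set R7)) hu _

theorem fderiv_act {g : Fin d → ℝ} {u : R7} (h : (g, u) ∈ Φ.dom) (v : R7) :
    fderiv ℝ (Φ.act g) u v = fderiv ℝ Φ.uncurried (g, u) (0, v) := by
  have h1 := (Φ.differentiableAt_uncurried h).hasFDerivAt.comp u (hasFDerivAt_prodMk_right g u)
  have h2 : fderiv ℝ (Φ.act g) u = _ := h1.fderiv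
  rw [h2]
  rfl

theorem fderiv_uncurried_zero {u : R7} (hu : u ∈ U) (v : R7) :
    fderiv ℝ Φ.uncurried (0, u) (0, v) = v := by
  rw [← Φ.fderiv_act (Φ.zero_mem_dom u hu)]
  have : Φ.act 0 =ᶠ[nhds u] id := by
    filter_upwards [U.isOpen.mem_nhds hu] with w hw
    exact Φ.zero_act w hw
  rw [this.fderiv_eq, fderiv_id]
  rfl

theorem contDiffOn_fundamental (ξ : Fin d → ℝ) : ContDiffOn ℝ ∞ (Φ.fundamental ξ) U := by
  have h : ContDiffOn ℝ ∞ (fun u => fderiv ℝ Φ.uncurried (0, u) (ξ, 0)) U := fun u hu =>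
    (((Φ.contDiffAt_fderiv_uncurried (Φ.zero_mem_dom u hu)).comp u
      (contDiffAt_const.prodMk contDiffAt_id)).clm_apply contDiffAt_const).contDiffWithinAt
  exact h.congr fun u hu => Φ.fundamental_apply ξ hu

theorem fderiv_fundamental (ξ : Fin d → ℝ) {u : R7} (hu : u ∈ U) (v : R7) :
    fderiv ℝ (Φ.fundamental ξ) u v =
      fderiv ℝ (fderiv ℝ Φ.uncurried) (0, u) (0, v) (ξ, 0) := by
  have he : Φ.fundamental ξ =ᶠ[nhds u] fun u => fderiv ℝ Φ.uncurried (0, u) (ξ, 0) := by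
    filter_upwards [U.isOpen.mem_nhds hu] with w hw
    exact Φ.fundamental_apply ξ hw
  have h1 := ((Φ.contDiffAt_fderiv_uncurried (Φ.zero_mem_dom u hu)).differentiableAt
    (by simp)).hasFDerivAt.comp u (hasFDerivAt_prodMk_right (𝕜 := ℝ) (0 : Fin d → ℝ) u)
  have h2 := h1.clm_apply (hasFDerivAt_const ((ξ, 0) : (Fin d → ℝ) × R7) u)
  rw [he.fderiv_eq]
  have h3 : fderiv ℝ (fun u => fderiv ℝ Φ.uncurried (0, u) (ξ, 0)) u = _ := h2.fderiv
  rw [h3]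
  simp

/-- For v annihilated by the contact system, the pulled-back forms evaluated on v vanish along the
curve t ↦ tξ in the group. Their derivative at t = 0 is (L_X ω)(v), after exchanging the mixed
second derivatives of the action. -/
theorem fundamental_mem {E : Equation} (hU : (U : Set R7) ⊆ E.Sig) (hΦ : Φ.ActsBySymmetries E)
    (ξ : Fin d → ℝ) : Φ.fundamental ξ ∈ E.symmetryAlgebra U := by
  refine ⟨Φ.contDiffOn_fundamental ξ, fun u hu => Set.indicator_of_notMem hu _, fun u hu a => ?_⟩
  rw [Equation.mem_system_iff]
  intro v hv
  have hdom := Φ.zero_mem_dom u hu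
  set γ : ℝ → (Fin d → ℝ) × R7 := fun t => (t • ξ, u) with hγ
  have hγ0 : γ 0 = (0, u) := by simp [hγ]
  have hγd : HasDerivAt γ (ξ, 0) 0 := by
    have h := ((hasDerivAt_id (0 : ℝ)).smul_const ξ).prodMk (hasDerivAt_const (0 : ℝ) u)
    rwa [one_smul] at h
  have hmem : ∀ᶠ t in nhds (0 : ℝ), γ t ∈ Φ.dom := by
    refine hγd.continuousAt.eventually_mem (Φ.isOpen_dom.mem_nhds ?_)
    rwa [hγ0]
  have hP := ((hγ0 ▸ Φ.differentiableAt_uncurried hdom :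
    DifferentiableAt ℝ Φ.uncurried (γ 0)).hasFDerivAt).comp_hasDerivAt 0 hγd
  have hQ := ((hγ0 ▸ (Φ.contDiffAt_fderiv_uncurried hdom).differentiableAt (by simp) :
    DifferentiableAt ℝ (fderiv ℝ Φ.uncurried) (γ 0)).hasFDerivAt).comp_hasDerivAt 0 hγd
  have hQ' := hQ.clm_apply (hasDerivAt_const (0 : ℝ) ((0, v) : (Fin d → ℝ) × R7))
  have hu0 : Φ.uncurried (γ 0) = u := by rw [hγ0]; exact Φ.zero_act u hu
  have hform : DifferentiableAt ℝ (E.form a) ((Φ.uncurried ∘ γ) 0) := by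
    rw [Function.comp_apply, hu0]
    exact Equation.differentiableAt_form (hU hu) a
  have hF := hform.hasFDerivAt.comp_hasDerivAt 0 hP
  have hR := hF.clm_apply hQ'
  have hzero : (fun t => E.form a (Φ.uncurried (γ t)) (fderiv ℝ Φ.uncurried (γ t) (0, v))) =ᶠ[nhds 0]
      fun _ => 0 := by
    filter_upwards [hmem] with t ht
    have hs := hΦ (t • ξ) (Φ.dom_subset ht).1
    have h1 : (E.form a (Φ.act (t • ξ) u)).comp (fderiv ℝ (Φ.act (t • ξ)) u) ∈ E.system u := by
      rw [← hs.pullback u ht]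
      exact Submodule.mem_map_of_mem (Submodule.subset_span ⟨a, rfl⟩)
    have h2 := Equation.mem_system_iff.1 h1 v hv
    rw [ContinuousLinearMap.comp_apply, Φ.fderiv_act ht] at h2
    exact h2
  have key := hR.unique ((hasDerivAt_const (0 : ℝ) (0 : ℝ)).congr_of_eventuallyEq hzero)
  have hsymm : fderiv ℝ (fderiv ℝ Φ.uncurried) (0, u) (ξ, 0) (0, v) =
      fderiv ℝ (fderiv ℝ Φ.uncurried) (0, u) (0, v) (ξ, 0) :=
    ((Φ.contDiffAt_uncurried hdom).isSymmSndFDerivAt (by simpa using two_le_infty)) _ _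
  simp only [Function.comp_apply, hγ0, map_zero, add_zero, Φ.fderiv_uncurried_zero hu,
    hsymm] at key
  rw [hγ0] at hu0
  rw [lieD, _root_.add_apply, ContinuousLinearMap.comp_apply, Φ.fderiv_fundamental ξ hu,
    Φ.fundamental_apply ξ hu]
  rwa [hu0] at key

/-- An integral curve of the left invariant field of ξ moves no point when the fundamental field
vanishes. By effectiveness it rests at the identity, and its initial velocity ξ is zero. -/
theorem eq_zero_of_fundamental_eq_zero (hΦ : Φ.IsLocallyEffective) {ξ : Fin d → ℝ}
    (h : Φ.fundamental ξ = 0) : ξ = 0 := by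
  obtain ⟨N, W, hN, h0N, hW, hWne, hNW, heff⟩ := hΦ
  set M : (Fin d → ℝ) × (Fin d → ℝ) → Fin d → ℝ := fun y => G.mul y.1 y.2 with hM
  have hMs : ∀ g ∈ G.carrier, ContDiffAt ℝ ∞ M (g, 0) := fun g hg =>
    G.smooth_mul.contDiffAt ((G.isOpen_carrier.prod G.isOpen_carrier).mem_nhds ⟨hg, G.zero_mem⟩)
  have hMd : ∀ g ∈ G.carrier, HasFDerivAt (fun k => G.mul g k)
      ((fderiv ℝ M (g, 0)).comp (ContinuousLinearMap.inr ℝ _ _)) 0 := fun g hg =>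
    ((hMs g hg).differentiableAt (by simp)).hasFDerivAt.comp 0 (hasFDerivAt_prodMk_right g 0)
  -- The left invariant field is used, rather than the line t ↦ tξ, because this line need not be a
  -- one-parameter subgroup in the given chart.
  set Γ : (Fin d → ℝ) → (Fin d → ℝ) := fun g => fderiv ℝ M (g, 0) (0, ξ) with hΓ
  have hΓ0 : Γ 0 = ξ := by
    have h1 : (fun k => G.mul 0 k) =ᶠ[nhds 0] id := by
      filter_upwards [G.isOpen_carrier.mem_nhds G.zero_mem] with k hk
      exact G.zero_mul k hk
    have h2 := (hMd 0 G.zero_mem).unique ((hasFDerivAt_id _).congr_of_eventuallyEq h1)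
    exact congrArg (fun l => l ξ) h2
  have hΓs : ContDiffAt ℝ 1 Γ 0 := by
    have h1 : ContDiffAt ℝ ∞ (fderiv ℝ M) ((0 : Fin d → ℝ), (0 : Fin d → ℝ)) :=
      (hMs 0 G.zero_mem).fderiv_right (m := ∞) (by simp)
    have h2 : ContDiffAt ℝ ∞ (fun g : Fin d → ℝ => fderiv ℝ M (g, 0)) 0 :=
      ContDiffAt.comp (g := fderiv ℝ M) (f := fun g : Fin d → ℝ => (g, (0 : Fin d → ℝ)))
        (0 : Fin d → ℝ) h1 (contDiffAt_id.prodMk contDiffAt_const)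
    exact (h2.clm_apply contDiffAt_const).of_le
      ((one_le_two (α := WithTop ℕ∞)).trans two_le_infty)
  obtain ⟨g, hg0, ε, hε, hg⟩ :=
    hΓs.exists_forall_mem_closedBall_exists_eq_forall_mem_Ioo_hasDerivAt₀ 0
  have hgε : Set.Ioo (0 - ε) (0 + ε) ∈ nhds (0 : ℝ) := Ioo_mem_nhds (by linarith) (by linarith)
  have hgN : ∀ᶠ t in nhds (0 : ℝ), g t ∈ N := by
    refine (hg 0 (mem_of_mem_nhds hgε)).continuousAt.eventually_mem (hN.mem_nhds ?_)
    rwa [hg0]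
  obtain ⟨δ, hδ, hball⟩ := Metric.mem_nhds_iff.1 (Filter.inter_mem hgε hgN)
  have hIcc : ∀ t ∈ Set.Icc 0 (δ / 2), t ∈ Set.Ioo (0 - ε) (0 + ε) ∧ g t ∈ N := by
    intro t ht
    apply hball
    rw [Metric.mem_ball, Real.dist_eq, sub_zero, abs_of_nonneg ht.1]
    linarith [ht.2]
  have hder : ∀ u ∈ W, ∀ t ∈ Set.Icc 0 (δ / 2), HasDerivAt (fun t => Φ.act (g t) u) 0 t := by
    intro u hu t ht
    obtain ⟨htε, htN⟩ := hIcc t ht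
    have hdom : (g t, u) ∈ Φ.dom := hNW ⟨htN, hu⟩
    have huU : u ∈ (U : Set R7) := (Φ.dom_subset hdom).2
    have hgc : g t ∈ G.carrier := (Φ.dom_subset hdom).1
    have hΨ := (Φ.differentiableAt_uncurried hdom).hasFDerivAt
    have h1 := hΨ.comp_hasDerivAt t ((hg t htε).prodMk (hasDerivAt_const t u))
    refine h1.congr_deriv ?_
    have hmul0 : G.mul (g t) 0 = g t := G.mul_zero _ hgc
    have hact0 : Φ.act 0 u = u := Φ.zero_act u huU
    have hL := HasFDerivAt.comp (g := Φ.uncurried) (f := fun k => (G.mul (g t) k, u))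
      (0 : Fin d → ℝ) (hmul0.symm ▸ hΨ : HasFDerivAt Φ.uncurried
        (fderiv ℝ Φ.uncurried (g t, u)) (G.mul (g t) 0, u))
      ((hMd _ hgc).prodMk (hasFDerivAt_const u 0))
    have hA := (Φ.differentiableAt_uncurried (Φ.zero_mem_dom u huU)).hasFDerivAt.comp
      (0 : Fin d → ℝ) (hasFDerivAt_prodMk_left (𝕜 := ℝ) (0 : Fin d → ℝ) u)
    have hR := HasFDerivAt.comp (g := Φ.uncurried) (f := fun k => (g t, Φ.act k u))
      (0 : Fin d → ℝ) (hact0.symm ▸ hΨ : HasFDerivAt Φ.uncurried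
        (fderiv ℝ Φ.uncurried (g t, u)) (g t, Φ.act 0 u))
      ((hasFDerivAt_const (g t) 0).prodMk hA)
    have hcA : ContinuousAt (fun k => Φ.act k u) 0 := hA.continuousAt
    have hcM : ContinuousAt (fun k => G.mul (g t) k) 0 := (hMd _ hgc).continuousAt
    have he : (fun k => Φ.uncurried (g t, Φ.act k u)) =ᶠ[nhds 0]
        fun k => Φ.uncurried (G.mul (g t) k, u) := by
      have e1 : ∀ᶠ k in nhds (0 : Fin d → ℝ), (k, u) ∈ Φ.dom :=
        (Continuous.prodMk_left u).continuousAt.eventually_mem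
          (Φ.isOpen_dom.mem_nhds (Φ.zero_mem_dom u huU))
      have e2 : ∀ᶠ k in nhds (0 : Fin d → ℝ), (g t, Φ.act k u) ∈ Φ.dom :=
        (continuousAt_const.prodMk hcA).eventually_mem (Φ.isOpen_dom.mem_nhds (by rwa [hact0]))
      have e3 : ∀ᶠ k in nhds (0 : Fin d → ℝ), (G.mul (g t) k, u) ∈ Φ.dom :=
        (hcM.prodMk continuousAt_const).eventually_mem (Φ.isOpen_dom.mem_nhds (by rwa [hmul0]))
      filter_upwards [e1, e2, e3] with k h1 h2 h3
      exact Φ.mul_act _ _ _ h1 h2 h3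
    -- This differentiates g(ku) = (gk)u in k at the identity, converting motion along the left
    -- invariant field into the image of the fundamental field.
    have heq := congrArg (fun l => l ξ) (hL.unique (hR.congr_of_eventuallyEq he.symm))
    have hX : fderiv ℝ Φ.uncurried (0, u) (ξ, 0) = 0 := by
      rw [← Φ.fundamental_apply ξ huU, h]
      rfl
    have hX' : fderiv ℝ Φ.uncurried (g t, u) (Γ (g t), 0) =
        fderiv ℝ Φ.uncurried (g t, u) (0, fderiv ℝ Φ.uncurried (0, u) (ξ, 0)) := heq
    rw [hX'.trans (by rw [hX, Prod.mk_zero_zero, map_zero])]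
  have hgz : ∀ t ∈ Set.Icc 0 (δ / 2), g t = 0 := by
    intro t ht
    refine heff _ (hIcc t ht).2 fun u hu => ?_
    have := constant_of_has_deriv_right_zero
      (fun s hs => (hder u hu s hs).continuousAt.continuousWithinAt)
      (fun s hs => (hder u hu s (Set.Ico_subset_Icc_self hs)).hasDerivWithinAt) t ht
    rw [this, hg0]
    exact Φ.zero_act u (Φ.dom_subset (hNW (Set.mk_mem_prod h0N hu))).2
  have h1 : HasDerivWithinAt g (Γ (g 0)) (Set.Icc 0 (δ / 2)) 0 :=
    (hg 0 (mem_of_mem_nhds hgε)).hasDerivWithinAt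
  have h2 : HasDerivWithinAt g 0 (Set.Icc 0 (δ / 2)) 0 :=
    (hasDerivWithinAt_const (0 : ℝ) _ (0 : Fin d → ℝ)).congr hgz hg0
  have hδ2 : (0 : ℝ) < δ / 2 := half_pos hδ
  have h3 := (uniqueDiffOn_Icc hδ2 0 ⟨le_rfl, hδ2.le⟩).eq_deriv _ h1 h2
  rwa [hg0, hΓ0] at h3

theorem le_finrank {E : Equation} (hU : (U : Set R7) ⊆ E.Sig) (hΦ : Φ.ActsBySymmetries E)
    (hΦ' : Φ.IsLocallyEffective) [Module.Finite ℝ (E.symmetryAlgebra U)] :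
    d ≤ Module.finrank ℝ (E.symmetryAlgebra U) := by
  let T : (Fin d → ℝ) →ₗ[ℝ] E.symmetryAlgebra U :=
    { toFun := fun ξ => ⟨Φ.fundamental ξ, Φ.fundamental_mem hU hΦ ξ⟩
      map_add' := fun ξ η => Subtype.ext (funext fun u => by
        by_cases hu : u ∈ U
        · have : ((ξ + η, 0) : (Fin d → ℝ) × R7) = (ξ, 0) + (η, 0) := by simp
          change Φ.fundamental _ u = Φ.fundamental _ u + Φ.fundamental _ u
          rw [Φ.fundamental_apply _ hu, this, map_add, Φ.fundamental_apply _ hu,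
            Φ.fundamental_apply _ hu]
        · simp [fundamental, hu])
      map_smul' := fun c ξ => Subtype.ext (funext fun u => by
        by_cases hu : u ∈ U
        · have : ((c • ξ, 0) : (Fin d → ℝ) × R7) = c • (ξ, 0) := by simp
          change Φ.fundamental _ u = c • Φ.fundamental _ u
          rw [Φ.fundamental_apply _ hu, this, map_smul, Φ.fundamental_apply _ hu]
        · simp [fundamental, hu]) }
  have hT : Function.Injective T := by
    rw [injective_iff_map_eq_zero]
    intro ξ hξ
    exact Φ.eq_zero_of_fundamental_eq_zero hΦ' (congrArg Subtype.val hξ)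
  simpa using LinearMap.finrank_le_finrank_of_injective hT

end LocalAction

end LieGroups

/-! ### Nonvanishing of products of independent covectors -/

theorem eq_zero_of_ιMulti_eq_zero {n : ℕ} {M : Type*} [AddCommGroup M] [Module ℝ M]
    (D : M [⋀^Fin n]→ₗ[ℝ] ℝ) {α : Fin n → M} (h : ExteriorAlgebra.ιMulti ℝ n α = 0) : D α = 0 := by
  have h1 := ExteriorAlgebra.liftAlternating_apply_ιMulti (R := ℝ) (M := M) (N := ℝ)
    (Function.update (fun _ => 0) n D) α
  rw [Function.update_self] at h1
  rw [← h1, h, map_zero]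

theorem det_eq_zero_of_ιMulti_eq_zero {n : ℕ} {M : Type*} [AddCommGroup M] [Module ℝ M]
    (L : M →ₗ[ℝ] (Fin n → ℝ)) {α : Fin n → M} (h : ExteriorAlgebra.ιMulti ℝ n α = 0) :
    (Matrix.of fun i => L (α i)).det = 0 :=
  eq_zero_of_ιMulti_eq_zero (Matrix.detRowAlternating.compLinearMap L) h

/-- By the universal property of the exterior algebra the determinant factors through the product.
If the product vanished, the seven covectors would have a common nonzero kernel vector. -/
theorem prod_covec_ne_zero (α : Fin 7 → R7 →L[ℝ] ℝ) (h : ∀ v, (∀ i, α i v = 0) → v = 0) :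
    covec (α 0) * (covec (α 1) * (covec (α 2) * (covec (α 3) * (covec (α 4) * (covec (α 5) *
      covec (α 6)))))) ≠ 0 := by
  intro h0
  set L : (R7 →L[ℝ] ℝ) →ₗ[ℝ] R7 :=
    { toFun := fun β j => β (Pi.single j 1)
      map_add' := fun _ _ => rfl
      map_smul' := fun _ _ => rfl } with hL
  have h1 : ExteriorAlgebra.ιMulti ℝ 7 α = 0 := by
    rw [ExteriorAlgebra.ιMulti_apply, ← h0]
    simp [List.ofFn_succ, covec]
  have h3 : (Matrix.of fun i j => α i (Pi.single j 1)).det = 0 :=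
    det_eq_zero_of_ιMulti_eq_zero L h1
  obtain ⟨v, hv, hv0⟩ := Matrix.exists_mulVec_eq_zero_iff.2 h3
  apply hv
  refine h v fun i => ?_
  have e : v = ∑ k, v k • (Pi.single k 1 : R7) := by
    ext j
    simp [Pi.single_apply]
  rw [e, map_sum]
  have := congrFun hv0 i
  simpa [Matrix.mulVec, dotProduct, mul_comm] using this

/-! ### The model equation 3 r t³ + 1 = 0 -/

section Cubic

/-- The equation manifold of `3 r t³ + 1 = 0`, in the coordinates `(x, y, z, p, q, s, 1 / t)`. -/
noncomputable def cubicPar (u : R7) : J2 :=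
  ![u 0, u 1, u 2, u 3, u 4, -(u 6) ^ 3 / 3, u 5, (u 6)⁻¹]

theorem cubicPar_apply (u : R7) : cubicPar u 0 = u 0 ∧ cubicPar u 1 = u 1 ∧ cubicPar u 2 = u 2 ∧
    cubicPar u 3 = u 3 ∧ cubicPar u 4 = u 4 ∧ cubicPar u 5 = -(u 6) ^ 3 / 3 ∧ cubicPar u 6 = u 5 ∧
    cubicPar u 7 = (u 6)⁻¹ := ⟨rfl, rfl, rfl, rfl, rfl, rfl, rfl, rfl⟩

theorem hasFDerivAt_coord (k : Fin 7) (u : R7) : HasFDerivAt (fun u : R7 => u k) (dR k) u :=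
  (dR k).hasFDerivAt

theorem hasFDerivAt_cubicPar {u : R7} (hu : 0 < u 6) : HasFDerivAt cubicPar
    (ContinuousLinearMap.pi ![dR 0, dR 1, dR 2, dR 3, dR 4, (-(u 6) ^ 2) • dR 6, dR 5,
      (-(u 6 ^ 2)⁻¹) • dR 6]) u := by
  rw [hasFDerivAt_pi]
  have h6 := hasFDerivAt_coord 6 u
  intro k
  fin_cases k
  · exact hasFDerivAt_coord 0 u
  · exact hasFDerivAt_coord 1 u
  · exact hasFDerivAt_coord 2 u
  · exact hasFDerivAt_coord 3 u
  · exact hasFDerivAt_coord 4 u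
  · have h : HasDerivAt (fun τ : ℝ => -τ ^ 3 / 3) (-(u 6) ^ 2) (u 6) := by
      refine (((hasDerivAt_pow 3 (u 6)).neg).div_const 3).congr_deriv ?_
      norm_num
      ring
    exact h.comp_hasFDerivAt u h6
  · exact hasFDerivAt_coord 5 u
  · exact (hasDerivAt_inv hu.ne').comp_hasFDerivAt u h6

theorem fderiv_cubicPar {u : R7} (hu : 0 < u 6) (v : R7) : fderiv ℝ cubicPar u v =
    ![v 0, v 1, v 2, v 3, v 4, -(u 6) ^ 2 * v 6, v 5, -(u 6 ^ 2)⁻¹ * v 6] := by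
  rw [(hasFDerivAt_cubicPar hu).fderiv]
  ext k
  fin_cases k <;> rfl

/-- The equation `3 r t³ + 1 = 0` on `t > 0`. -/
noncomputable def cubicEquation : Equation where
  dom := {j | 0 < j 7}
  isOpen_dom := isOpen_lt continuous_const (continuous_apply 7)
  F := fun j => 3 * j 5 * j 7 ^ 3 + 1
  smooth_F := by fun_prop
  Sig := {u | 0 < u 6}
  isOpen_Sig := isOpen_lt continuous_const (continuous_apply 6)
  par := cubicPar
  smooth_par := by
    rw [contDiffOn_pi]
    have h : ∀ k : Fin 7, ContDiffOn ℝ ∞ (fun u : R7 => u k) {u | 0 < u 6} := fun k => by fun_prop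
    intro k
    fin_cases k
    · exact h 0
    · exact h 1
    · exact h 2
    · exact h 3
    · exact h 4
    · exact ((h 6).pow 3).neg.div_const 3
    · exact h 5
    · exact (h 6).inv fun u hu => ne_of_gt hu
  image_par := by
    ext j
    constructor
    · rintro ⟨u, hu, rfl⟩
      have hu6 : 0 < u 6 := hu
      obtain ⟨-, -, -, -, -, h5, -, h7⟩ := cubicPar_apply u
      refine ⟨?_, ?_⟩
      · change 0 < cubicPar u 7
        rw [h7]
        exact inv_pos.2 hu6
      · rw [h5, h7]
        field_simp
        ring
    · rintro ⟨h7, hF⟩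
      have h7 : 0 < j 7 := h7
      refine ⟨![j 0, j 1, j 2, j 3, j 4, j 6, (j 7)⁻¹], inv_pos.2 h7, ?_⟩
      ext k
      fin_cases k
      · rfl
      · rfl
      · rfl
      · rfl
      · rfl
      · change -((j 7)⁻¹) ^ 3 / 3 = j 5
        field_simp
        linear_combination -hF
      · rfl
      · exact inv_inv _
  maximal_rank := fun u hu v w hvw => by
    have hu6 : 0 < u 6 := hu
    rw [fderiv_cubicPar hu6, fderiv_cubicPar hu6] at hvw
    have h := fun k => congrFun hvw k
    have h5 := h 5
    simp only [Matrix.cons_val, neg_mul, neg_inj] at h5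
    ext k
    fin_cases k
    · exact h 0
    · exact h 1
    · exact h 2
    · exact h 3
    · exact h 4
    · exact h 6
    · exact mul_left_cancel₀ (pow_pos hu6 2).ne' h5
  transverse := fun u hu => by
    have hu6 : 0 < u 6 := hu
    rw [eq_top_iff]
    intro j _
    rw [Submodule.mem_sup]
    refine ⟨_, ⟨![j 0, j 1, j 2, j 3, j 4, 0, 0], rfl⟩, _, ?_, add_sub_cancel _ j⟩
    rw [LinearMap.mem_ker]
    change projJ1 (j - fderiv ℝ cubicPar u _) = 0
    rw [fderiv_cubicPar hu6]
    ext k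
    fin_cases k <;> simp [projJ1] <;> exact sub_self _

theorem partialF_cubicEquation (j v : J2) :
    fderiv ℝ cubicEquation.F j v = 3 * j 7 ^ 3 * v 5 + 9 * j 5 * j 7 ^ 2 * v 7 := by
  have h5 : HasFDerivAt (fun j : J2 => j 5) (dJ 5) j := (dJ 5).hasFDerivAt
  have h7 : HasFDerivAt (fun j : J2 => j 7) (dJ 7) j := (dJ 7).hasFDerivAt
  have h : HasFDerivAt cubicEquation.F _ j :=
    ((h5.const_mul 3).mul (h7.pow 3)).add_const 1
  rw [h.fderiv]
  simp [dJ]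
  ring

theorem isHyperbolic_cubicEquation : cubicEquation.IsHyperbolic := by
  intro u hu
  have hu6 : 0 < u 6 := hu
  simp only [Equation.partialF, partialF_cubicEquation]
  obtain ⟨-, -, -, -, -, h5, -, h7⟩ := cubicPar_apply u
  change cubicEquation.par u 5 = _ at h5
  change cubicEquation.par u 7 = _ at h7
  rw [h5, h7]
  simp
  have : (0 : ℝ) < 3 * (u 6 ^ 3)⁻¹ * (9 * (u 6 ^ 3 / 3) * (u 6 ^ 2)⁻¹) := by positivity
  linarith

end Cubic

/-! ### Genericity of the model -/

section CubicGeneric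

theorem form_cubic {u : R7} (hu : 0 < u 6) (v : R7) :
    cubicEquation.form 0 u v = v 2 - u 3 * v 0 - u 4 * v 1 ∧
    cubicEquation.form 1 u v = v 3 + u 6 ^ 3 / 3 * v 0 - u 5 * v 1 ∧
    cubicEquation.form 2 u v = v 4 - u 5 * v 0 - (u 6)⁻¹ * v 1 := by
  obtain ⟨h0, h1, h2⟩ := cubicEquation.form_apply u v
  rw [h0, h1, h2]
  change fderiv ℝ cubicPar u v 2 - cubicPar u 3 * fderiv ℝ cubicPar u v 0 - cubicPar u 4 *
    fderiv ℝ cubicPar u v 1 = _ ∧ fderiv ℝ cubicPar u v 3 - cubicPar u 5 *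
    fderiv ℝ cubicPar u v 0 - cubicPar u 6 * fderiv ℝ cubicPar u v 1 = _ ∧
    fderiv ℝ cubicPar u v 4 - cubicPar u 6 * fderiv ℝ cubicPar u v 0 - cubicPar u 7 *
    fderiv ℝ cubicPar u v 1 = _
  rw [fderiv_cubicPar hu]
  simp only [cubicPar, Matrix.cons_val]
  refine ⟨by trivial, by ring, by trivial⟩

theorem eq_of_mem_system_cubic {u : R7} (hu : 0 < u 6) {α : R7 →L[ℝ] ℝ}
    (hα : α ∈ cubicEquation.system u) : α = α (Pi.single 2 1) • cubicEquation.form 0 u +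
      α (Pi.single 3 1) • cubicEquation.form 1 u + α (Pi.single 4 1) • cubicEquation.form 2 u := by
  obtain ⟨c, rfl⟩ := (Submodule.mem_span_range_iff_exists_fun ℝ).1 hα
  ext v
  obtain ⟨h0, h1, h2⟩ := form_cubic hu v
  obtain ⟨a0, a1, a2⟩ := form_cubic hu (Pi.single 2 1)
  obtain ⟨b0, b1, b2⟩ := form_cubic hu (Pi.single 3 1)
  obtain ⟨c0, c1, c2⟩ := form_cubic hu (Pi.single 4 1)
  simp [Fin.sum_univ_three, a0, a1, a2, b0, b1, b2, c0, c1, c2]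

theorem fderiv_comp_cubic {u : R7} (hu : 0 < u 6) (k : Fin 8) :
    fderiv ℝ (cubicEquation.comp k) u = (![dR 0, dR 1, dR 2, dR 3, dR 4, (-(u 6) ^ 2) • dR 6, dR 5,
      (-(u 6 ^ 2)⁻¹) • dR 6] : Fin 8 → R7 →L[ℝ] ℝ) k := by
  ext v
  rw [Equation.fderiv_comp (E := cubicEquation) hu]
  change fderiv ℝ cubicPar u v k = _
  rw [fderiv_cubicPar hu]
  fin_cases k <;> rfl

theorem extD_form_cubic {u : R7} (hu : 0 < u 6) (X Y : R7) :
    extD (cubicEquation.form 0) u X Y = X 0 * Y 3 - Y 0 * X 3 + (X 1 * Y 4 - Y 1 * X 4) ∧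
    extD (cubicEquation.form 1) u X Y =
      u 6 ^ 2 * (Y 0 * X 6 - X 0 * Y 6) + (X 1 * Y 5 - Y 1 * X 5) ∧
    extD (cubicEquation.form 2) u X Y =
      X 0 * Y 5 - Y 0 * X 5 + (u 6 ^ 2)⁻¹ * (Y 1 * X 6 - X 1 * Y 6) := by
  rw [Equation.extD_form (E := cubicEquation) hu, Equation.extD_form (E := cubicEquation) hu,
    Equation.extD_form (E := cubicEquation) hu]
  simp only [fderiv_comp_cubic hu, Matrix.cons_val, add_apply, wedge_apply, smul_apply, smul_eq_mul]
  simp only [dR, ContinuousLinearMap.proj_apply]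
  refine ⟨by ring, by ring, by ring⟩

/-- In the general pairing formula dr and dt are proportional on this equation, so the product
containing both drops out. The other two are multiples of one nonzero top form. -/
theorem isotropic_cubic {A : Set R7} {σ : Fin 2 → OneForm}
    (h : cubicEquation.IsCharacteristicSystem A σ) {u : R7} (hu : u ∈ A) (b b' : Fin 2) :
    σ b u (Pi.single 4 1) * σ b' u (Pi.single 4 1) =
      u 6 ^ 4 * (σ b u (Pi.single 3 1) * σ b' u (Pi.single 3 1)) := by
  have hu6 : 0 < u 6 := h.subset hu
  set c : Fin 2 → Fin 3 → R7 → ℝ := fun b => ![fun v => σ b v (Pi.single 2 1),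
    fun v => σ b v (Pi.single 3 1), fun v => σ b v (Pi.single 4 1)] with hc
  have hσ : ∀ b, σ b =ᶠ[nhds u] c b 0 • cubicEquation.form 0 + c b 1 • cubicEquation.form 1 +
      c b 2 • cubicEquation.form 2 := by
    intro b
    filter_upwards [h.isOpen.mem_nhds hu] with v hv
    exact eq_of_mem_system_cubic (h.subset hv) (h.mem b v hv)
  have hcd : ∀ b a, DifferentiableAt ℝ (c b a) u := by
    intro b a
    have h1 := ((h.smooth b).contDiffAt (h.isOpen.mem_nhds hu)).differentiableAt (by simp)
    have h2 : ∀ w : R7, DifferentiableAt ℝ (fun v => σ b v w) u := fun w =>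
      h1.clm_apply (differentiableAt_const w)
    fin_cases a
    · exact h2 _
    · exact h2 _
    · exact h2 _
  have key := Equation.pairing_eq (E := cubicEquation) hu6 (hσ b) (hcd b) (hσ b') (hcd b')
  rw [h.isotropic b b' u hu] at key
  have e0 : cubicEquation.dc u 0 = covec (dR 0) := by rw [Equation.dc, fderiv_comp_cubic hu6]; rfl
  have e1 : cubicEquation.dc u 1 = covec (dR 1) := by rw [Equation.dc, fderiv_comp_cubic hu6]; rfl
  have e5 : cubicEquation.dc u 5 = (-(u 6) ^ 2) • covec (dR 6) := by
    rw [Equation.dc, fderiv_comp_cubic hu6, ← covec_smul]; rfl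
  have e6 : cubicEquation.dc u 6 = covec (dR 5) := by rw [Equation.dc, fderiv_comp_cubic hu6]; rfl
  have e7 : cubicEquation.dc u 7 = (-(u 6 ^ 2)⁻¹) • covec (dR 6) := by
    rw [Equation.dc, fderiv_comp_cubic hu6, ← covec_smul]; rfl
  rw [e0, e1, e5, e6, e7] at key
  simp only [smul_mul_assoc, mul_smul_comm, covec_sq_mul, mul_zero, smul_zero, add_zero,
    covec_swap_mul (dR 5) (dR 6), mul_neg, smul_neg] at key
  have hP := prod_covec_ne_zero ![dR 0, dR 1, dR 6, dR 5, cubicEquation.form 0 u,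
    cubicEquation.form 1 u, cubicEquation.form 2 u] (fun v hv => by
      obtain ⟨f0, f1, f2⟩ := form_cubic hu6 v
      have v0 : v 0 = 0 := hv 0
      have v1 : v 1 = 0 := hv 1
      have v6 : v 6 = 0 := hv 2
      have v5 : v 5 = 0 := hv 3
      have v2 := f0.symm.trans (hv 4)
      have v3 := f1.symm.trans (hv 5)
      have v4 := f2.symm.trans (hv 6)
      simp only [v0, v1, mul_zero, sub_zero, add_zero] at v2 v3 v4
      ext k
      fin_cases k <;> assumption)
  have hz : (c b 1 u * c b' 1 u * u 6 ^ 2 - c b 2 u * c b' 2 u * (u 6 ^ 2)⁻¹) •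
      (covec (dR 0) * (covec (dR 1) * (covec (dR 6) * (covec (dR 5) * cubicEquation.vol u)))) =
      0 := by
    have h2 : (2 : ℝ) ≠ 0 := two_ne_zero
    refine (smul_eq_zero_iff_right h2).1 ?_
    rw [key]
    module
  have hz' := (smul_eq_zero.1 hz).resolve_right hP
  have hne : u 6 ≠ 0 := hu6.ne'
  field_simp at hz'
  simp only [hc, Matrix.cons_val] at hz'
  linear_combination -hz'

theorem extD_characteristic_cubic {u : R7} (hu : 0 < u 6) {ε : ℝ} {c₀ c₁ : R7 → ℝ}
    (h₀ : DifferentiableAt ℝ c₀ u) (h₁ : DifferentiableAt ℝ c₁ u) {σ : OneForm}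
    (hσ : σ =ᶠ[nhds u] c₀ • cubicEquation.form 0 + c₁ • (cubicEquation.form 1 +
      (fun v : R7 => ε * v 6 ^ 2) • cubicEquation.form 2)) {X Y : R7}
    (hX₀ : cubicEquation.form 0 u X = 0) (hY₀ : cubicEquation.form 0 u Y = 0)
    (hX₁ : cubicEquation.form 1 u X + ε * u 6 ^ 2 * cubicEquation.form 2 u X = 0)
    (hY₁ : cubicEquation.form 1 u Y + ε * u 6 ^ 2 * cubicEquation.form 2 u Y = 0) :
    extD σ u X Y = c₀ u * (X 0 * Y 3 - Y 0 * X 3 + (X 1 * Y 4 - Y 1 * X 4)) +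
      c₁ u * (u 6 ^ 2 * (Y 0 * X 6 - X 0 * Y 6) + (X 1 * Y 5 - Y 1 * X 5) +
        ε * u 6 ^ 2 * (X 0 * Y 5 - Y 0 * X 5) + ε * (Y 1 * X 6 - X 1 * Y 6) +
        2 * ε * u 6 * (X 6 * cubicEquation.form 2 u Y - Y 6 * cubicEquation.form 2 u X)) := by
  have hf := fun a => Equation.differentiableAt_form (E := cubicEquation) hu a
  have hg : HasFDerivAt (fun v : R7 => ε * v 6 ^ 2) ((2 * ε * u 6) • dR 6) u := by
    refine (((hasFDerivAt_coord 6 u).pow 2).const_mul ε).congr_fderiv ?_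
    ext v
    simp
    ring
  have hg' := hg.differentiableAt.smul (hf 2)
  obtain ⟨d0, d1, d2⟩ := extD_form_cubic hu X Y
  rw [extD_congr hσ, extD_add (h₀.smul (hf 0)) (h₁.smul ((hf 1).add hg')), extD_smul h₀ (hf 0),
    extD_smul h₁ ((hf 1).add hg'), extD_add (hf 1) hg', extD_smul hg.differentiableAt (hf 2),
    hg.fderiv]
  simp only [add_apply, smul_apply, smul_eq_mul, wedge_apply, Pi.add_apply, Pi.smul_apply',
    d0, d1, d2, hX₀, hY₀]
  simp only [hX₁, hY₁, dR, ContinuousLinearMap.proj_apply]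
  have hne : u 6 ≠ 0 := hu.ne'
  field_simp
  ring

theorem pair_eq_zero {V : Type*} [AddCommGroup V] [Module ℝ V] {f : Fin 2 → V}
    (h : LinearIndependent ℝ f) {a a' : ℝ} (h0 : a • f 0 + a' • f 1 = 0) : a = 0 ∧ a' = 0 := by
  have := Fintype.linearIndependent_iff.1 h ![a, a'] (by simpa [Fin.sum_univ_two] using h0)
  exact ⟨this 0, this 1⟩

theorem exists_ne_zero_cubic {A : Set R7} {σ : Fin 2 → OneForm}
    (h : cubicEquation.IsCharacteristicSystem A σ) {u : R7} (hu : u ∈ A) :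
    ∃ b, σ b u (Pi.single 3 1) ≠ 0 := by
  have hiso := fun {v} (hv : v ∈ A) => isotropic_cubic h hv
  have hdec := fun {v} (hv : v ∈ A) b => eq_of_mem_system_cubic (h.subset hv) (h.mem b v hv)
  have hind := fun a a' : ℝ => pair_eq_zero (h.independent u hu) (a := a) (a' := a')
  by_contra! hcon
  have h4 : ∀ b, σ b u (Pi.single 4 1) = 0 := fun b => by
    have := hiso hu b b
    rw [hcon b] at this
    simpa using this
  have h0 := hdec hu 0
  have h1 := hdec hu 1
  rw [hcon, h4] at h0 h1
  have hs := hind (σ 1 u (Pi.single 2 1)) (-σ 0 u (Pi.single 2 1)) (by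
    rw [h0, h1]
    ext v
    simp
    ring)
  have := hind 1 0 (by
    rw [h0, neg_eq_zero.1 hs.2]
    simp)
  exact one_ne_zero this.1

/-- Isotropy of one form gives ω³-coefficient = ± u₆² times ω²-coefficient. The sign is locally
constant by continuity, and mixed isotropy forces the second form to have the same sign. So the
system is locally {ω¹, ω² + εu₆²ω³}. -/
theorem exists_sign_cubic {A : Set R7} {σ : Fin 2 → OneForm}
    (h : cubicEquation.IsCharacteristicSystem A σ) {u : R7} (hu : u ∈ A) : ∃ ε : ℝ, ε ^ 2 = 1 ∧
    ∀ᶠ v in nhds u, ∀ b, σ b v (Pi.single 4 1) = ε * v 6 ^ 2 * σ b v (Pi.single 3 1) := by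
  have hu6 : 0 < u 6 := h.subset hu
  have hiso := fun {v} (hv : v ∈ A) => isotropic_cubic h hv
  have hdec := fun {v} (hv : v ∈ A) b => eq_of_mem_system_cubic (h.subset hv) (h.mem b v hv)
  have hcd : ∀ b (w : R7), DifferentiableAt ℝ (fun v => σ b v w) u := fun b w =>
    (((h.smooth b).contDiffAt (h.isOpen.mem_nhds hu)).differentiableAt (by simp)).clm_apply
      (differentiableAt_const w)
  obtain ⟨b₀, hb₀⟩ := exists_ne_zero_cubic h hu
  obtain ⟨ε, hε, hεu⟩ : ∃ ε : ℝ, ε ^ 2 = 1 ∧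
      σ b₀ u (Pi.single 4 1) = ε * u 6 ^ 2 * σ b₀ u (Pi.single 3 1) := by
    have h1 : (σ b₀ u (Pi.single 4 1) - u 6 ^ 2 * σ b₀ u (Pi.single 3 1)) *
        (σ b₀ u (Pi.single 4 1) + u 6 ^ 2 * σ b₀ u (Pi.single 3 1)) = 0 := by
      linear_combination hiso hu b₀ b₀
    rcases mul_eq_zero.1 h1 with h2 | h2
    · exact ⟨1, by norm_num, by linear_combination h2⟩
    · exact ⟨-1, by norm_num, by linear_combination h2⟩
  have hε0 : ε ≠ 0 := by
    rintro rfl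
    norm_num at hε
  refine ⟨ε, hε, ?_⟩
  have c1 : ∀ᶠ v in nhds u, σ b₀ v (Pi.single 3 1) ≠ 0 :=
    (hcd b₀ _).continuousAt.eventually_ne hb₀
  have hc2 : ContinuousAt (fun v : R7 => σ b₀ v (Pi.single 4 1) +
      ε * v 6 ^ 2 * σ b₀ v (Pi.single 3 1)) u :=
    (hcd b₀ _).continuousAt.add ((continuousAt_const.mul
      ((continuous_apply 6).continuousAt.pow 2)).mul (hcd b₀ _).continuousAt)
  have c2 := hc2.eventually_ne (y := 0) (by
    rw [hεu, ← two_mul]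
    exact mul_ne_zero two_ne_zero (mul_ne_zero (mul_ne_zero hε0 (pow_pos hu6 2).ne') hb₀))
  filter_upwards [c1, c2, h.isOpen.mem_nhds hu] with v h1 h2 hvA b
  have hv6 : 0 < v 6 := h.subset hvA
  have h3 : σ b₀ v (Pi.single 4 1) = ε * v 6 ^ 2 * σ b₀ v (Pi.single 3 1) := by
    rw [← sub_eq_zero]
    refine (mul_eq_zero.1 ?_).resolve_right h2
    linear_combination hiso hvA b₀ b₀ - v 6 ^ 4 * σ b₀ v (Pi.single 3 1) ^ 2 * hε
  have h4 := hiso hvA b₀ b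
  rw [h3] at h4
  have h5 : ε * v 6 ^ 2 * σ b₀ v (Pi.single 3 1) ≠ 0 :=
    mul_ne_zero (mul_ne_zero hε0 (pow_pos hv6 2).ne') h1
  apply mul_left_cancel₀ h5
  linear_combination h4 - v 6 ^ 4 * σ b₀ v (Pi.single 3 1) * σ b v (Pi.single 3 1) * hε

/-- The decisive terms carry 2εu₆, the derivative of εu₆²: the characteristic slope varies along the
vertical direction, and this removes the Cauchy characteristics. -/
theorem eq_zero_of_characteristic_cubic {u : R7} (hu6 : 0 < u 6) {ε : ℝ} (hε0 : ε ≠ 0) {X : R7}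
    (hX₀ : cubicEquation.form 0 u X = 0)
    (hX₁ : cubicEquation.form 1 u X + ε * u 6 ^ 2 * cubicEquation.form 2 u X = 0)
    (hY : ∀ Y : R7, cubicEquation.form 0 u Y = 0 →
      cubicEquation.form 1 u Y + ε * u 6 ^ 2 * cubicEquation.form 2 u Y = 0 →
      (X 0 * Y 3 - Y 0 * X 3 + (X 1 * Y 4 - Y 1 * X 4)) = 0 ∧
      (u 6 ^ 2 * (Y 0 * X 6 - X 0 * Y 6) + (X 1 * Y 5 - Y 1 * X 5) +
        ε * u 6 ^ 2 * (X 0 * Y 5 - Y 0 * X 5) + ε * (Y 1 * X 6 - X 1 * Y 6) +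
        2 * ε * u 6 * (X 6 * cubicEquation.form 2 u Y - Y 6 * cubicEquation.form 2 u X)) = 0) :
    X = 0 := by
  obtain ⟨x0, x1, x2⟩ := form_cubic hu6 X
  have hne : u 6 ≠ 0 := hu6.ne'
  -- Four test vectors in the kernel of the system suffice: the two vertical coordinate directions,
  -- a direction with ω³ = 1 and ω² = -εu₆², and a lift of ∂/∂x annihilated by all contact forms.
  obtain ⟨s0, s1, s2⟩ := form_cubic hu6 (Pi.single 5 1)
  obtain ⟨t0, t1, t2⟩ := form_cubic hu6 (Pi.single 6 1)
  obtain ⟨w0, w1, w2⟩ := form_cubic hu6 ![0, 0, 0, -(ε * u 6 ^ 2), 1, 0, 0]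
  obtain ⟨y0, y1, y2⟩ := form_cubic hu6 ![1, 0, u 3, -(u 6 ^ 3 / 3), u 5, 0, 0]
  simp at s0 s1 s2 t0 t1 t2 w0 w1 w2 y0 y1 y2
  have hs := (hY (Pi.single 5 1) s0 (by rw [s1, s2]; ring)).2
  have ht := (hY (Pi.single 6 1) t0 (by rw [t1, t2]; ring)).2
  have hw := hY ![0, 0, 0, -(ε * u 6 ^ 2), 1, 0, 0] w0 (by rw [w1, w2]; ring)
  have hy := (hY ![1, 0, u 3, -(u 6 ^ 3 / 3), u 5, 0, 0] y0 (by rw [y1, y2]; ring)).2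
  simp [s2, t2, w2, y2] at hs ht hw hy
  obtain ⟨hw1, hw2⟩ := hw
  have X0 : X 0 = 0 := by
    have : 2 * (ε * u 6 ^ 2) * X 0 = 0 := by linear_combination hs - hw1
    exact (mul_eq_zero.1 this).resolve_left
      (mul_ne_zero two_ne_zero (mul_ne_zero hε0 (pow_pos hu6 2).ne'))
  have X1 : X 1 = 0 := by linear_combination hs - ε * u 6 ^ 2 * X0
  have h6 : X 6 = 0 := hw2.resolve_left (not_or.2 ⟨hε0, hne⟩)
  have h5 : X 5 = 0 := by
    have : ε * u 6 ^ 2 * X 5 = 0 := by linear_combination u 6 ^ 2 * h6 - hy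
    exact (mul_eq_zero.1 this).resolve_left (mul_ne_zero hε0 (pow_pos hu6 2).ne')
  have hω : cubicEquation.form 2 u X = 0 := by
    have : 2 * ε * u 6 * cubicEquation.form 2 u X = 0 := by
      linear_combination -ht - u 6 ^ 2 * X0 - ε * X1
    exact (mul_eq_zero.1 this).resolve_left (mul_ne_zero (mul_ne_zero two_ne_zero hε0) hne)
  have h4 : X 4 = 0 := by linear_combination hω - x2 + u 5 * X0 + (u 6)⁻¹ * X1
  have h3 : X 3 = 0 := by
    linear_combination hX₁ - x1 - u 6 ^ 3 / 3 * X0 + u 5 * X1 - ε * u 6 ^ 2 * hω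
  have h2 : X 2 = 0 := by linear_combination hX₀ - x0 + u 3 * X0 + u 4 * X1
  ext k
  fin_cases k <;> assumption


theorem isGeneric_cubicEquation : cubicEquation.IsGeneric := by
  intro A σ h u hu
  rw [pfaffClass_eq_iff]
  intro X hX
  have hu6 : 0 < u 6 := h.subset hu
  have hdec := fun {v} (hv : v ∈ A) b => eq_of_mem_system_cubic (h.subset hv) (h.mem b v hv)
  have hind := fun a a' : ℝ => pair_eq_zero (h.independent u hu) (a := a) (a' := a')
  have hcd : ∀ b (w : R7), DifferentiableAt ℝ (fun v => σ b v w) u := fun b w =>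
    (((h.smooth b).contDiffAt (h.isOpen.mem_nhds hu)).differentiableAt (by simp)).clm_apply
      (differentiableAt_const w)
  obtain ⟨b₀, hb₀⟩ := exists_ne_zero_cubic h hu
  obtain ⟨ε, hε, hev⟩ := exists_sign_cubic h hu
  have hε0 : ε ≠ 0 := by
    rintro rfl
    norm_num at hε
  have hσ : ∀ b, σ b =ᶠ[nhds u] (fun v => σ b v (Pi.single 2 1)) • cubicEquation.form 0 +
      (fun v => σ b v (Pi.single 3 1)) • (cubicEquation.form 1 +
        (fun v : R7 => ε * v 6 ^ 2) • cubicEquation.form 2) := by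
    intro b
    filter_upwards [hev, h.isOpen.mem_nhds hu] with v h1 hvA
    conv_lhs => rw [hdec hvA b, h1 b]
    ext w
    simp
    ring
  have hσu := fun b => (hσ b).eq_of_nhds
  have hval : ∀ b w, σ b u w = σ b u (Pi.single 2 1) * cubicEquation.form 0 u w +
      σ b u (Pi.single 3 1) * (cubicEquation.form 1 u w +
        ε * u 6 ^ 2 * cubicEquation.form 2 u w) := by
    intro b w
    exact (congrArg (fun l : R7 →L[ℝ] ℝ => l w) (hσu b)).trans (by simp; ring)
  -- The given generators are related to ω¹ and ω² + εu₆²ω³ by an invertible matrix, so conditions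
  -- on the former may be read off on the latter.
  have hdet : σ 0 u (Pi.single 2 1) * σ 1 u (Pi.single 3 1) -
      σ 0 u (Pi.single 3 1) * σ 1 u (Pi.single 2 1) ≠ 0 := by
    intro hD
    have h1 := hind (σ 1 u (Pi.single 3 1)) (-σ 0 u (Pi.single 3 1)) (by
      ext w
      simp only [add_apply, smul_apply, smul_eq_mul, zero_apply]
      linear_combination σ 1 u (Pi.single 3 1) * hval 0 w - σ 0 u (Pi.single 3 1) * hval 1 w +
        cubicEquation.form 0 u w * hD)
    fin_cases b₀
    · exact hb₀ (neg_eq_zero.1 h1.2)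
    · exact hb₀ h1.1
  have solve : ∀ {P Q : ℝ}, (∀ b, σ b u (Pi.single 2 1) * P + σ b u (Pi.single 3 1) * Q = 0) →
      P = 0 ∧ Q = 0 := by
    intro P Q hPQ
    constructor
    · apply mul_left_cancel₀ hdet
      linear_combination σ 1 u (Pi.single 3 1) * hPQ 0 - σ 0 u (Pi.single 3 1) * hPQ 1
    · apply mul_left_cancel₀ hdet
      linear_combination σ 0 u (Pi.single 2 1) * hPQ 1 - σ 1 u (Pi.single 2 1) * hPQ 0
  obtain ⟨hX₀, hX₁⟩ := solve fun b => (hval b X).symm.trans (hX b).1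
  have hY : ∀ Y : R7, cubicEquation.form 0 u Y = 0 →
      cubicEquation.form 1 u Y + ε * u 6 ^ 2 * cubicEquation.form 2 u Y = 0 →
      (X 0 * Y 3 - Y 0 * X 3 + (X 1 * Y 4 - Y 1 * X 4)) = 0 ∧
      (u 6 ^ 2 * (Y 0 * X 6 - X 0 * Y 6) + (X 1 * Y 5 - Y 1 * X 5) +
        ε * u 6 ^ 2 * (X 0 * Y 5 - Y 0 * X 5) + ε * (Y 1 * X 6 - X 1 * Y 6) +
        2 * ε * u 6 * (X 6 * cubicEquation.form 2 u Y - Y 6 * cubicEquation.form 2 u X)) = 0 := by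
    intro Y hY₀ hY₁
    refine solve fun b => ?_
    rw [← extD_characteristic_cubic hu6 (hcd b _) (hcd b _) (hσ b) hX₀ hY₀ hX₁ hY₁]
    have hker : ∀ α ∈ pfaff σ u, α Y = 0 := fun α hα => by
      refine Submodule.span_induction ?_ (by simp) (fun _ _ _ _ h h' => by simp [h, h'])
        (fun c _ _ h => by simp [h]) hα
      rintro _ ⟨b, rfl⟩
      exact (hval b Y).trans (by rw [hY₀, hY₁]; ring)
    exact hker _ (hX b).2
  exact eq_zero_of_characteristic_cubic hu6 hε0 hX₀ hX₁ hY

end CubicGeneric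

/-! ### The nine-dimensional local symmetry group -/

namespace CubicGroup

/-- The fourth entry of the unimodular matrix with first entries `1 + g 0, g 1, g 2`. -/
noncomputable def d (g : Fin 9 → ℝ) : ℝ := (1 + g 1 * g 2) / (1 + g 0)

theorem det_eq {g : Fin 9 → ℝ} (hg : 1 + g 0 ≠ 0) : (1 + g 0) * d g = 1 + g 1 * g 2 :=
  mul_div_cancel₀ _ hg

/-- Multiplication in the symmetry group of `3 r t³ + 1 = 0`. -/
noncomputable def mul (g h : Fin 9 → ℝ) : Fin 9 → ℝ :=
  ![(1 + g 0) * (1 + h 0) + g 1 * h 2 - 1,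
    (1 + g 0) * h 1 + g 1 * d h,
    g 2 * (1 + h 0) + d g * h 2,
    (1 + g 3) * (1 + h 3) - 1,
    (1 + g 3) ^ 2 * h 4 + g 4,
    (1 + g 3) ^ 3 * h 5 + (g 5 + g 7 * h 4) * d h + (g 6 + g 8 * h 4) * h 1,
    (1 + g 3) ^ 3 * h 6 + (g 5 + g 7 * h 4) * h 2 + (g 6 + g 8 * h 4) * (1 + h 0),
    (1 + g 3) ^ 3 * h 7 + (1 + h 3) ^ 2 * (g 7 * d h + g 8 * h 1),
    (1 + g 3) ^ 3 * h 8 + (1 + h 3) ^ 2 * (g 7 * h 2 + g 8 * (1 + h 0))]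

/-- Inversion in the symmetry group of `3 r t³ + 1 = 0`. -/
noncomputable def inv (g : Fin 9 → ℝ) : Fin 9 → ℝ :=
  ![d g - 1, -g 1, -g 2, (1 + g 3)⁻¹ - 1, -g 4 * (1 + g 3)⁻¹ ^ 2,
    -((1 + g 0) * g 5 - g 1 * g 6) * (1 + g 3)⁻¹ ^ 3 +
      g 4 * ((1 + g 0) * g 7 - g 1 * g 8) * (1 + g 3)⁻¹ ^ 5,
    -(d g * g 6 - g 2 * g 5) * (1 + g 3)⁻¹ ^ 3 + g 4 * (d g * g 8 - g 2 * g 7) * (1 + g 3)⁻¹ ^ 5,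
    -((1 + g 0) * g 7 - g 1 * g 8) * (1 + g 3)⁻¹ ^ 5,
    -(d g * g 8 - g 2 * g 7) * (1 + g 3)⁻¹ ^ 5]

theorem mul_apply (g h : Fin 9 → ℝ) :
    mul g h 0 = (1 + g 0) * (1 + h 0) + g 1 * h 2 - 1 ∧
    mul g h 1 = (1 + g 0) * h 1 + g 1 * d h ∧
    mul g h 2 = g 2 * (1 + h 0) + d g * h 2 ∧
    mul g h 3 = (1 + g 3) * (1 + h 3) - 1 ∧
    mul g h 4 = (1 + g 3) ^ 2 * h 4 + g 4 ∧
    mul g h 5 = (1 + g 3) ^ 3 * h 5 + (g 5 + g 7 * h 4) * d h + (g 6 + g 8 * h 4) * h 1 ∧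
    mul g h 6 = (1 + g 3) ^ 3 * h 6 + (g 5 + g 7 * h 4) * h 2 + (g 6 + g 8 * h 4) * (1 + h 0) ∧
    mul g h 7 = (1 + g 3) ^ 3 * h 7 + (1 + h 3) ^ 2 * (g 7 * d h + g 8 * h 1) ∧
    mul g h 8 = (1 + g 3) ^ 3 * h 8 + (1 + h 3) ^ 2 * (g 7 * h 2 + g 8 * (1 + h 0)) :=
  ⟨rfl, rfl, rfl, rfl, rfl, rfl, rfl, rfl, rfl⟩

theorem inv_apply (g : Fin 9 → ℝ) :
    inv g 0 = d g - 1 ∧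
    inv g 1 = -g 1 ∧
    inv g 2 = -g 2 ∧
    inv g 3 = (1 + g 3)⁻¹ - 1 ∧
    inv g 4 = -g 4 * (1 + g 3)⁻¹ ^ 2 ∧
    inv g 5 = -((1 + g 0) * g 5 - g 1 * g 6) * (1 + g 3)⁻¹ ^ 3 + g 4 * ((1 + g 0) * g 7 - g 1 * g 8) * (1 + g 3)⁻¹ ^ 5 ∧
    inv g 6 = -(d g * g 6 - g 2 * g 5) * (1 + g 3)⁻¹ ^ 3 + g 4 * (d g * g 8 - g 2 * g 7) * (1 + g 3)⁻¹ ^ 5 ∧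
    inv g 7 = -((1 + g 0) * g 7 - g 1 * g 8) * (1 + g 3)⁻¹ ^ 5 ∧
    inv g 8 = -(d g * g 8 - g 2 * g 7) * (1 + g 3)⁻¹ ^ 5 :=
  ⟨rfl, rfl, rfl, rfl, rfl, rfl, rfl, rfl, rfl⟩

theorem ext_nine {f g : Fin 9 → ℝ} (h0 : f 0 = g 0) (h1 : f 1 = g 1) (h2 : f 2 = g 2)
    (h3 : f 3 = g 3) (h4 : f 4 = g 4) (h5 : f 5 = g 5) (h6 : f 6 = g 6) (h7 : f 7 = g 7)
    (h8 : f 8 = g 8) : f = g := by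
  ext k
  fin_cases k <;> assumption

theorem d_mul {g h : Fin 9 → ℝ} (hg : 1 + g 0 ≠ 0) (hh : 1 + h 0 ≠ 0)
    (hgh : 1 + mul g h 0 ≠ 0) : d (mul g h) = g 2 * h 1 + d g * d h := by
  apply mul_left_cancel₀ hgh
  rw [det_eq hgh]
  have e1 := det_eq hg
  have e2 := det_eq hh
  simp only [mul, Matrix.cons_val]
  linear_combination (-((1 + h 0) * d h - h 1 * h 2)) * e1 - e2

/-- The elements with positive diagonal scalings. -/
def carrier : Set (Fin 9 → ℝ) := {g | 0 < 1 + g 0 ∧ 0 < 1 + g 3}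

/-- The elements of `carrier` with positive second diagonal entry. -/
def invDom : Set (Fin 9 → ℝ) := {g | g ∈ carrier ∧ 0 < 1 + g 1 * g 2}

theorem isOpen_carrier : IsOpen carrier :=
  (isOpen_lt (f := fun _ => (0 : ℝ)) (g := fun g : Fin 9 → ℝ => 1 + g 0) continuous_const
    (by fun_prop)).inter (isOpen_lt (f := fun _ => (0 : ℝ)) (g := fun g : Fin 9 → ℝ => 1 + g 3)
    continuous_const (by fun_prop))

theorem isOpen_invDom : IsOpen invDom :=
  isOpen_carrier.inter (isOpen_lt (f := fun _ => (0 : ℝ)) (g := fun g : Fin 9 → ℝ => 1 + g 1 * g 2)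
    continuous_const (by fun_prop))

theorem d_pos {g : Fin 9 → ℝ} (hg : g ∈ invDom) : 0 < d g := div_pos hg.2 hg.1.1

theorem contDiffOn_d : ContDiffOn ℝ ∞ d carrier :=
  ContDiffOn.div (by fun_prop) (by fun_prop) fun _ hg => hg.1.ne'

theorem one_add_inv_zero (g : Fin 9 → ℝ) : 1 + inv g 0 = d g := by
  simp [inv]

/-- Inverting a unimodular 2 × 2 matrix exchanges its diagonal entries. This is also why `invDom`
asks the second diagonal entry to be positive. -/
theorem d_inv {g : Fin 9 → ℝ} (hg : g ∈ invDom) : d (inv g) = 1 + g 0 := by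
  rw [d, one_add_inv_zero, div_eq_iff (d_pos hg).ne', det_eq hg.1.1.ne']
  simp [inv]

theorem zero_mul (g : Fin 9 → ℝ) : mul 0 g = g := by
  ext k
  fin_cases k <;> simp [mul, d]

theorem mul_zero (g : Fin 9 → ℝ) : mul g 0 = g := by
  ext k
  fin_cases k <;> simp [mul, d]

theorem mul_assoc {g h k : Fin 9 → ℝ} (hg : g ∈ carrier) (hh : h ∈ carrier) (hk : k ∈ carrier)
    (hgh : mul g h ∈ carrier) (hhk : mul h k ∈ carrier) :
    mul (mul g h) k = mul g (mul h k) := by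
  have e1 := d_mul hg.1.ne' hh.1.ne' hgh.1.ne'
  have e2 := d_mul hh.1.ne' hk.1.ne' hhk.1.ne'
  apply ext_nine <;> simp only [mul_apply, e1, e2] <;> ring

theorem inv_mul {g : Fin 9 → ℝ} (hg : g ∈ invDom) : mul (inv g) g = 0 := by
  have e1 := det_eq hg.1.1.ne'
  have e2 := d_inv hg
  have e3 : (1 + g 3)⁻¹ * (1 + g 3) = 1 := inv_mul_cancel₀ hg.1.2.ne'
  apply ext_nine <;> simp only [mul_apply, inv_apply, e2, Pi.zero_apply]
  · linear_combination e1
  · ring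
  · ring
  · linear_combination e3
  · ring
  · linear_combination (-(1 + g 3)⁻¹ ^ 3 * g 5) * e1
  · linear_combination (-(1 + g 3)⁻¹ ^ 3 * g 6) * e1
  · linear_combination (-(1 + g 3) ^ 2 * (1 + g 3)⁻¹ ^ 5 * g 7) * e1 -
      (1 + g 3)⁻¹ ^ 3 * g 7 * ((1 + g 3)⁻¹ * (1 + g 3) + 1) * e3
  · linear_combination (-(1 + g 3) ^ 2 * (1 + g 3)⁻¹ ^ 5 * g 8) * e1 -
      (1 + g 3)⁻¹ ^ 3 * g 8 * ((1 + g 3)⁻¹ * (1 + g 3) + 1) * e3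

theorem mul_inv {g : Fin 9 → ℝ} (hg : g ∈ invDom) : mul g (inv g) = 0 := by
  have e1 := det_eq hg.1.1.ne'
  have e2 := d_inv hg
  have e3 : (1 + g 3)⁻¹ * (1 + g 3) = 1 := inv_mul_cancel₀ hg.1.2.ne'
  have e4 : (1 + g 3)⁻¹ ^ 3 * (1 + g 3) ^ 3 = 1 := by rw [← mul_pow, e3, one_pow]
  apply ext_nine <;> simp only [mul_apply, inv_apply, e2, Pi.zero_apply]
  · linear_combination e1
  · ring
  · ring
  · linear_combination e3
  · linear_combination (-g 4 * ((1 + g 3)⁻¹ * (1 + g 3) + 1)) * e3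
  · linear_combination (-((1 + g 0) * g 5 - g 1 * g 6) +
      g 4 * (1 + g 3)⁻¹ ^ 2 * ((1 + g 0) * g 7 - g 1 * g 8)) * e4
  · linear_combination (-(d g * g 6 - g 2 * g 5) +
      g 4 * (1 + g 3)⁻¹ ^ 2 * (d g * g 8 - g 2 * g 7)) * e4
  · linear_combination (-(1 + g 3)⁻¹ ^ 2 * ((1 + g 0) * g 7 - g 1 * g 8)) * e4
  · linear_combination (-(1 + g 3)⁻¹ ^ 2 * (d g * g 8 - g 2 * g 7)) * e4

theorem inv_mem {g : Fin 9 → ℝ} (hg : g ∈ invDom) : inv g ∈ carrier := by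
  refine ⟨by rw [one_add_inv_zero]; exact d_pos hg, ?_⟩
  have h : 1 + inv g 3 = (1 + g 3)⁻¹ := add_sub_cancel _ _
  rw [h]
  exact inv_pos.2 hg.1.2

theorem contDiffOn_mul : ContDiffOn ℝ ∞ (fun y : (Fin 9 → ℝ) × (Fin 9 → ℝ) => mul y.1 y.2)
    (carrier ×ˢ carrier) := by
  have h1 : ContDiffOn ℝ ∞ (fun y : (Fin 9 → ℝ) × (Fin 9 → ℝ) => d y.1) (carrier ×ˢ carrier) :=
    contDiffOn_d.comp contDiffOn_fst fun _ hy => hy.1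
  have h2 : ContDiffOn ℝ ∞ (fun y : (Fin 9 → ℝ) × (Fin 9 → ℝ) => d y.2) (carrier ×ˢ carrier) :=
    contDiffOn_d.comp contDiffOn_snd fun _ hy => hy.2
  rw [contDiffOn_pi]
  intro i
  fin_cases i <;> simp only [mul] <;> simp <;> fun_prop

theorem contDiffOn_inv : ContDiffOn ℝ ∞ inv invDom := by
  have h1 : ContDiffOn ℝ ∞ d invDom := contDiffOn_d.mono fun _ hg => hg.1
  have h2 : ContDiffOn ℝ ∞ (fun g : Fin 9 → ℝ => (1 + g 3)⁻¹) invDom :=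
    ContDiffOn.inv (by fun_prop) fun _ hg => hg.1.2.ne'
  rw [contDiffOn_pi]
  intro i
  fin_cases i <;> simp only [inv] <;> simp [-inv_pow] <;> fun_prop

end CubicGroup

/-- The local Lie group of symmetries of `3 r t³ + 1 = 0`. -/
noncomputable def cubicGroup : LocalLieGroup 9 where
  carrier := CubicGroup.carrier
  isOpen_carrier := CubicGroup.isOpen_carrier
  zero_mem := by simp [CubicGroup.carrier]
  mul := CubicGroup.mul
  smooth_mul := CubicGroup.contDiffOn_mul
  zero_mul := fun g _ => CubicGroup.zero_mul g
  mul_zero := fun g _ => CubicGroup.mul_zero g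
  mul_assoc := fun _ hg _ hh _ hk h1 h2 => CubicGroup.mul_assoc hg hh hk h1 h2
  invDom := CubicGroup.invDom
  isOpen_invDom := CubicGroup.isOpen_invDom
  zero_mem_invDom := by simp [CubicGroup.invDom, CubicGroup.carrier]
  invDom_subset := fun _ hg => hg.1
  inv := CubicGroup.inv
  smooth_inv := CubicGroup.contDiffOn_inv
  inv_mem := fun _ hg => CubicGroup.inv_mem hg
  inv_mul := fun _ hg => CubicGroup.inv_mul hg
  mul_inv := fun _ hg => CubicGroup.mul_inv hg

/-! ### The action of the group on the equation manifold -/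

namespace CubicGroup

/-- The denominator of the projective action on the first coordinate. -/
noncomputable def J (g : Fin 9 → ℝ) (u : R7) : ℝ := g 2 * u 0 + d g

/-- The bilinear polynomial added to the dependent variable. -/
def K (g : Fin 9 → ℝ) (u : R7) : ℝ := g 5 + g 6 * u 0 + g 7 * u 1 + g 8 * u 0 * u 1

/-- The action of the symmetry group on the equation manifold. -/
noncomputable def act (g : Fin 9 → ℝ) (u : R7) : R7 :=
  ![((1 + g 0) * u 0 + g 1) / J g u,
    (1 + g 3) ^ 2 * u 1 + g 4,
    ((1 + g 3) ^ 3 * u 2 + K g u) / J g u,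
    J g u * ((1 + g 3) ^ 3 * u 3 + g 6 + g 8 * u 1) - g 2 * ((1 + g 3) ^ 3 * u 2 + K g u),
    ((1 + g 3) * u 4 + (g 7 + g 8 * u 0) * (1 + g 3)⁻¹ ^ 2) / J g u,
    J g u * ((1 + g 3) * u 5 + g 8 * (1 + g 3)⁻¹ ^ 2) -
      g 2 * ((1 + g 3) * u 4 + (g 7 + g 8 * u 0) * (1 + g 3)⁻¹ ^ 2),
    (1 + g 3) * J g u * u 6]

theorem act_apply (g : Fin 9 → ℝ) (u : R7) :
    act g u 0 = ((1 + g 0) * u 0 + g 1) / J g u ∧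
    act g u 1 = (1 + g 3) ^ 2 * u 1 + g 4 ∧
    act g u 2 = ((1 + g 3) ^ 3 * u 2 + K g u) / J g u ∧
    act g u 3 = J g u * ((1 + g 3) ^ 3 * u 3 + g 6 + g 8 * u 1) -
      g 2 * ((1 + g 3) ^ 3 * u 2 + K g u) ∧
    act g u 4 = ((1 + g 3) * u 4 + (g 7 + g 8 * u 0) * (1 + g 3)⁻¹ ^ 2) / J g u ∧
    act g u 5 = J g u * ((1 + g 3) * u 5 + g 8 * (1 + g 3)⁻¹ ^ 2) -
      g 2 * ((1 + g 3) * u 4 + (g 7 + g 8 * u 0) * (1 + g 3)⁻¹ ^ 2) ∧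
    act g u 6 = (1 + g 3) * J g u * u 6 := ⟨rfl, rfl, rfl, rfl, rfl, rfl, rfl⟩

theorem ext_seven {u v : R7} (h0 : u 0 = v 0) (h1 : u 1 = v 1) (h2 : u 2 = v 2)
    (h3 : u 3 = v 3) (h4 : u 4 = v 4) (h5 : u 5 = v 5) (h6 : u 6 = v 6) : u = v := by
  ext k
  fin_cases k <;> assumption

/-- The cocycle rule for denominators of fractional linear maps; the composition law of the action
rests on it. -/
theorem J_mul {g h : Fin 9 → ℝ} {u : R7} (hg : g ∈ carrier) (hh : h ∈ carrier)
    (hgh : 1 + mul g h 0 ≠ 0) (hJ : J h u ≠ 0) :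
    J (mul g h) u = J g (act h u) * J h u := by
  have hx : act h u 0 * J h u = (1 + h 0) * u 0 + h 1 := div_mul_cancel₀ _ hJ
  rw [J, d_mul hg.1.ne' hh.1.ne' hgh, J, (mul_apply g h).2.2.1]
  rw [J] at hx ⊢
  linear_combination -g 2 * hx

theorem act_act {g h : Fin 9 → ℝ} {u : R7} (hg : g ∈ carrier) (hh : h ∈ carrier)
    (hgh : 1 + mul g h 0 ≠ 0) (hJ : J h u ≠ 0) (hJ' : J g (act h u) ≠ 0) :
    act g (act h u) = act (mul g h) u := by
  have hJm := J_mul hg hh hgh hJ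
  obtain ⟨x, y, z, p, q, s, t⟩ := act_apply h u
  rw [eq_div_iff hJ] at x z q
  have e := det_eq hh.1.ne'
  have w1 : (1 + g 3) ^ 2 * (1 + g 3)⁻¹ ^ 2 = 1 := by
    rw [← mul_pow, mul_inv_cancel₀ hg.2.ne', one_pow]
  have w2 : (1 + h 3) ^ 2 * (1 + h 3)⁻¹ ^ 2 = 1 := by
    rw [← mul_pow, mul_inv_cancel₀ hh.2.ne', one_pow]
  have w3 : (1 + ((1 + g 3) * (1 + h 3) - 1))⁻¹ = (1 + g 3)⁻¹ * (1 + h 3)⁻¹ := by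
    rw [add_sub_cancel, _root_.mul_inv]
  obtain ⟨m0, m1, m2, m3, m4, m5, m6, m7, m8⟩ := mul_apply g h
  obtain ⟨x', y', z', p', q', s', t'⟩ := act_apply g (act h u)
  obtain ⟨x'', y'', z'', p'', q'', s'', t''⟩ := act_apply (mul g h) u
  have hJ2 : J g (act h u) * J h u ≠ 0 := mul_ne_zero hJ' hJ
  have eG : J g (act h u) = g 2 * act h u 0 + d g := rfl
  have eJ : J h u = h 2 * u 0 + d h := rfl
  simp only [w3, hJm, K, m0, m1, m2, m3, m4, m5, m6, m7, m8] at x'' y'' z'' p'' q'' s'' t''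
  simp only [K] at z' p' z p
  apply ext_seven
  · rw [x', x'', div_eq_div_iff hJ' hJ2]
    simp only [eJ] at x ⊢
    linear_combination (1 + g 0) * J g (act h u) * x
  · rw [y', y'', y]
    ring
  · rw [z', z'', div_eq_div_iff hJ' hJ2]
    simp only [eJ, y] at x z ⊢
    linear_combination J g (act h u) * ((1 + g 3) ^ 3 * z +
      (g 6 + g 8 * ((1 + h 3) ^ 2 * u 1 + h 4)) * x)
  · rw [p', p'']
    simp only [eG, p, eJ, y] at x z ⊢
    set X := act h u 0
    set Z := act h u 2
    linear_combination (1 + g 3) ^ 3 * g 2 * ((1 + h 0 - X * h 2) * (-z) + Z * (e - h 2 * x)) +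
      (g 5 + g 7 * ((1 + h 3) ^ 2 * u 1 + h 4)) * g 2 * (e - h 2 * x) +
      (g 6 + g 8 * ((1 + h 3) ^ 2 * u 1 + h 4)) * (-g 2 * (1 + h 0) * x - d g * e)
  · rw [q', q'', div_eq_div_iff hJ' hJ2]
    simp only [eJ] at x q ⊢
    linear_combination J g (act h u) * ((1 + g 3) * q + g 8 * (1 + g 3)⁻¹ ^ 2 * x -
      (h 7 + h 8 * u 0) * (1 + h 3)⁻¹ ^ 2 * (1 + g 3) * w1 -
      (g 7 * (h 2 * u 0 + d h) + g 8 * ((1 + h 0) * u 0 + h 1)) * (1 + g 3)⁻¹ ^ 2 * w2)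
  · rw [s', s'']
    simp only [eG, s, eJ] at x q ⊢
    set X := act h u 0
    set Q := act h u 4
    linear_combination (1 + g 3) * g 2 * ((1 + h 0 - X * h 2) * (-q) + Q * (e - h 2 * x)) +
      (g 7 * (1 + g 3)⁻¹ ^ 2) * g 2 * (e - h 2 * x) +
      (g 8 * (1 + g 3)⁻¹ ^ 2) * (-g 2 * (1 + h 0) * x - d g * e) -
      (g 2 * X + d g) * (h 2 * u 0 + d h) * (h 8 * (1 + h 3)⁻¹ ^ 2 * (1 + g 3) * w1 +
        (1 + g 3)⁻¹ ^ 2 * (g 7 * h 2 + g 8 * (1 + h 0)) * w2) +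
      (g 2 * (1 + h 0) + d g * h 2) * ((h 7 + h 8 * u 0) * (1 + h 3)⁻¹ ^ 2 * (1 + g 3) * w1 +
        (1 + g 3)⁻¹ ^ 2 * (g 7 * (h 2 * u 0 + d h) + g 8 * ((1 + h 0) * u 0 + h 1)) * w2)
  · rw [t', t'', t]
    ring

/-- The domain of the action. -/
def actDom : Set ((Fin 9 → ℝ) × R7) := {y | y.1 ∈ carrier ∧ 0 < y.2 6 ∧
  0 < (1 + y.1 0) * (y.1 2 * y.2 0) + (1 + y.1 1 * y.1 2)}

/-- The polynomial in the definition is (1 + g₀) times the denominator J; clearing the positive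
factor 1 + g₀ makes openness evident. -/
theorem mem_actDom {g : Fin 9 → ℝ} {u : R7} :
    (g, u) ∈ actDom ↔ g ∈ carrier ∧ 0 < u 6 ∧ 0 < J g u := by
  refine and_congr_right fun hg => and_congr_right fun _ => ?_
  have h : (1 + g 0) * (g 2 * u 0) + (1 + g 1 * g 2) = (1 + g 0) * J g u := by
    rw [← det_eq hg.1.ne', J]
    ring
  change 0 < (1 + g 0) * (g 2 * u 0) + (1 + g 1 * g 2) ↔ _
  rw [h]
  exact mul_pos_iff_of_pos_left hg.1

theorem isOpen_actDom : IsOpen actDom := by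
  refine (isOpen_carrier.preimage continuous_fst).inter (IsOpen.inter ?_ ?_)
  · exact isOpen_lt (f := fun _ => (0 : ℝ)) (g := fun y : (Fin 9 → ℝ) × R7 => y.2 6)
      continuous_const (by fun_prop)
  · exact isOpen_lt (f := fun _ => (0 : ℝ)) (g := fun y : (Fin 9 → ℝ) × R7 =>
      (1 + y.1 0) * (y.1 2 * y.2 0) + (1 + y.1 1 * y.1 2)) continuous_const (by fun_prop)

theorem contDiffOn_act : ContDiffOn ℝ ∞ (fun y : (Fin 9 → ℝ) × R7 => act y.1 y.2) actDom := by
  have h1 : ContDiffOn ℝ ∞ (fun y : (Fin 9 → ℝ) × R7 => d y.1) actDom :=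
    contDiffOn_d.comp contDiffOn_fst fun _ hy => hy.1
  have h2 : ContDiffOn ℝ ∞ (fun y : (Fin 9 → ℝ) × R7 => J y.1 y.2) actDom := by
    simp only [J]
    fun_prop
  have h3 : ContDiffOn ℝ ∞ (fun y : (Fin 9 → ℝ) × R7 => (J y.1 y.2)⁻¹) actDom :=
    h2.inv fun y hy => (mem_actDom.1 hy).2.2.ne'
  have h4 : ContDiffOn ℝ ∞ (fun y : (Fin 9 → ℝ) × R7 => (1 + y.1 3)⁻¹) actDom :=
    ContDiffOn.inv (by fun_prop) fun _ hy => hy.1.2.ne'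
  rw [contDiffOn_pi]
  intro i
  fin_cases i <;> simp only [act, K, div_eq_mul_inv] <;> simp [-inv_pow] <;> fun_prop

theorem act_mem {g : Fin 9 → ℝ} {u : R7} (h : (g, u) ∈ actDom) : 0 < act g u 6 := by
  obtain ⟨hg, hu, hJ⟩ := mem_actDom.1 h
  rw [(act_apply g u).2.2.2.2.2.2]
  exact mul_pos (mul_pos hg.2 hJ) hu

theorem J_zero (u : R7) : J 0 u = 1 := by simp [J, d]

theorem zero_act (u : R7) : act 0 u = u := by
  apply ext_seven <;> simp [act, J_zero, K]

theorem inv_act {g : Fin 9 → ℝ} {u : R7} (hg : g ∈ invDom) (h : (g, u) ∈ actDom) :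
    (inv g, act g u) ∈ actDom ∧ act (inv g) (act g u) = u := by
  obtain ⟨hgc, hu, hJ⟩ := mem_actDom.1 h
  have hm : 1 + mul (inv g) g 0 ≠ 0 := by rw [inv_mul hg]; simp
  have hJ1 := J_mul (u := u) (inv_mem hg) hgc hm hJ.ne'
  rw [inv_mul hg, J_zero] at hJ1
  have hJ2 : 0 < J (inv g) (act g u) := (mul_pos_iff_of_pos_right hJ).1 (hJ1 ▸ one_pos)
  refine ⟨mem_actDom.2 ⟨inv_mem hg, act_mem h, hJ2⟩, ?_⟩
  rw [act_act (inv_mem hg) hgc hm hJ.ne' hJ2.ne', inv_mul hg, zero_act]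

end CubicGroup

namespace CubicGroup

theorem fderiv_act {g : Fin 9 → ℝ} {u : R7} (h : (g, u) ∈ actDom) (v : R7) :
    let D := fderiv ℝ (act g) u v
    D 0 = v 0 / J g u ^ 2 ∧
    D 1 = (1 + g 3) ^ 2 * v 1 ∧
    D 2 = ((1 + g 3) ^ 3 * v 2 + ((g 6 + g 8 * u 1) * v 0 + (g 7 + g 8 * u 0) * v 1)) / J g u -
      g 2 * v 0 * ((1 + g 3) ^ 3 * u 2 + K g u) / J g u ^ 2 ∧
    D 3 = J g u * ((1 + g 3) ^ 3 * v 3 + g 8 * v 1) +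
      g 2 * v 0 * ((1 + g 3) ^ 3 * u 3 + g 6 + g 8 * u 1) -
      g 2 * ((1 + g 3) ^ 3 * v 2 + ((g 6 + g 8 * u 1) * v 0 + (g 7 + g 8 * u 0) * v 1)) ∧
    D 4 = ((1 + g 3) * v 4 + g 8 * v 0 * (1 + g 3)⁻¹ ^ 2) / J g u -
      g 2 * v 0 * ((1 + g 3) * u 4 + (g 7 + g 8 * u 0) * (1 + g 3)⁻¹ ^ 2) / J g u ^ 2 ∧
    D 5 = J g u * ((1 + g 3) * v 5) + g 2 * v 0 * ((1 + g 3) * u 5 + g 8 * (1 + g 3)⁻¹ ^ 2) -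
      g 2 * ((1 + g 3) * v 4 + g 8 * v 0 * (1 + g 3)⁻¹ ^ 2) ∧
    D 6 = (1 + g 3) * (J g u * v 6 + g 2 * v 0 * u 6) := by
  intro D
  obtain ⟨hg, hu, hJ⟩ := mem_actDom.1 h
  have hsm : ContDiffAt ℝ ∞ (act g) u :=
    (contDiffOn_act.contDiffAt (isOpen_actDom.mem_nhds h)).comp u
      (contDiffAt_const.prodMk contDiffAt_id)
  -- Each component is differentiated along a line as a function of one variable.
  have hline : HasDerivAt (fun t : ℝ => u + t • v) v 0 := by
    simpa using ((hasDerivAt_id (0 : ℝ)).smul_const v).const_add u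
  have h0 : u + (0 : ℝ) • v = u := by simp
  have hD : HasDerivAt (fun t : ℝ => act g (u + t • v)) D 0 := by
    have hd : HasFDerivAt (act g) (fderiv ℝ (act g) u) (u + (0 : ℝ) • v) := by
      rw [h0]
      exact (hsm.differentiableAt (by simp)).hasFDerivAt
    exact hd.comp_hasDerivAt 0 hline
  have hk := hasDerivAt_pi.1 hD
  have l : ∀ k, HasDerivAt (fun t : ℝ => (u + t • v) k) (v k) 0 := hasDerivAt_pi.1 hline
  have lJ : HasDerivAt (fun t : ℝ => J g (u + t • v)) (g 2 * v 0) 0 :=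
    ((l 0).const_mul (g 2)).add_const (d g)
  have lK : HasDerivAt (fun t : ℝ => K g (u + t • v))
      ((g 6 + g 8 * u 1) * v 0 + (g 7 + g 8 * u 0) * v 1) 0 := by
    refine ((((l 0).const_mul (g 6)).const_add (g 5)).add ((l 1).const_mul (g 7))).add
      (((l 0).const_mul (g 8)).mul (l 1)) |>.congr_deriv ?_
    simp only [h0]
    ring
  have hJ0 : J g (u + (0 : ℝ) • v) ≠ 0 := by rw [h0]; exact hJ.ne'
  have lz := ((l 2).const_mul ((1 + g 3) ^ 3)).add lK
  have lq := ((l 4).const_mul (1 + g 3)).add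
    ((((l 0).const_mul (g 8)).const_add (g 7)).mul_const ((1 + g 3)⁻¹ ^ 2))
  have hne := hJ.ne'
  have e := det_eq hg.1.ne'
  refine ⟨(hk 0).unique (((((l 0).const_mul (1 + g 0)).add_const (g 1)).div lJ hJ0).congr_deriv ?_),
    (hk 1).unique (((l 1).const_mul _).add_const _),
    (hk 2).unique ((lz.div lJ hJ0).congr_deriv ?_),
    (hk 3).unique (((lJ.mul ((((l 3).const_mul ((1 + g 3) ^ 3)).add_const (g 6)).add
      ((l 1).const_mul (g 8)))).sub (lz.const_mul (g 2))).congr_deriv ?_),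
    (hk 4).unique ((lq.div lJ hJ0).congr_deriv ?_),
    (hk 5).unique (((lJ.mul (((l 5).const_mul (1 + g 3)).add_const (g 8 * (1 + g 3)⁻¹ ^ 2))).sub
      (lq.const_mul (g 2))).congr_deriv ?_),
    (hk 6).unique (((lJ.const_mul (1 + g 3)).mul (l 6)).congr_deriv ?_)⟩
  · simp only [h0]
    rw [div_left_inj' (pow_ne_zero 2 hne)]
    simp only [J]
    linear_combination v 0 * e
  · simp only [h0]
    simp only [Pi.add_apply, Pi.smul_apply, zero_smul, add_zero]
    field_simp
  · simp only [h0]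
    simp only [Pi.add_apply, Pi.smul_apply, zero_smul, add_zero]
    ring
  · simp only [h0]
    simp only [Pi.add_apply, Pi.smul_apply, zero_smul, add_zero]
    field_simp
  · simp only [h0]
    ring
  · simp only [h0]
    ring

/-- The pullback of the contact coframe is triangular with nonzero diagonal. This gives both the
invariance of the system and, with the remaining coordinates, the invertibility of the differential.
-/
theorem form_act {g : Fin 9 → ℝ} {u : R7} (h : (g, u) ∈ actDom) (v : R7) :
    cubicEquation.form 0 (act g u) (fderiv ℝ (act g) u v) =
      (1 + g 3) ^ 3 / J g u * cubicEquation.form 0 u v ∧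
    cubicEquation.form 1 (act g u) (fderiv ℝ (act g) u v) =
      (1 + g 3) ^ 3 * J g u * cubicEquation.form 1 u v -
        (1 + g 3) ^ 3 * g 2 * cubicEquation.form 0 u v ∧
    cubicEquation.form 2 (act g u) (fderiv ℝ (act g) u v) =
      (1 + g 3) / J g u * cubicEquation.form 2 u v := by
  obtain ⟨hg, hu, hJ⟩ := mem_actDom.1 h
  obtain ⟨f0, f1, f2⟩ := form_cubic (act_mem h) (fderiv ℝ (act g) u v)
  obtain ⟨k0, k1, k2⟩ := form_cubic hu v
  obtain ⟨d0, d1, d2, d3, d4, d5, d6⟩ := fderiv_act h v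
  obtain ⟨x, y, z, p, q, s, t⟩ := act_apply g u
  have hne := hJ.ne'
  have hE := hg.2.ne'
  have hu' := hu.ne'
  rw [f0, f1, f2, k0, k1, k2, d0, d1, d2, d3, d4, p, q, s, t]
  refine ⟨?_, ?_, ?_⟩
  · field_simp
    ring
  · field_simp
    ring
  · field_simp
    ring

theorem isContactSymmetry_act {g : Fin 9 → ℝ} (hg : g ∈ carrier) :
    cubicEquation.IsContactSymmetry {u | (g, u) ∈ actDom} (act g) where
  isOpen := isOpen_actDom.preimage (Continuous.prodMk_right g)
  subset := fun _ hu => (mem_actDom.1 hu).2.1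
  mapsTo := fun _ hu => act_mem hu
  smooth := contDiffOn_act.comp (contDiffOn_const.prodMk contDiffOn_id) fun _ hu => hu
  bijective := fun u hu => by
    have hu : (g, u) ∈ actDom := hu
    obtain ⟨-, hu6, hJ⟩ := mem_actDom.1 hu
    have hE := hg.2.ne'
    have hinj : Function.Injective (fderiv ℝ (act g) u).toLinearMap := by
      rw [injective_iff_map_eq_zero]
      intro v hv
      have hv : fderiv ℝ (act g) u v = 0 := hv
      obtain ⟨d0, d1, -, -, -, d5, d6⟩ := fderiv_act hu v
      obtain ⟨f0, f1, f2⟩ := form_act hu v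
      obtain ⟨k0, k1, k2⟩ := form_cubic hu6 v
      simp only [hv, map_zero, Pi.zero_apply] at d0 d1 d5 d6 f0 f1 f2
      have v0 : v 0 = 0 := by simpa [hJ.ne'] using d0.symm
      have v1 : v 1 = 0 := by simpa [hE] using d1.symm
      have w0 : cubicEquation.form 0 u v = 0 := by simpa [hE, hJ.ne'] using f0.symm
      have w1 : cubicEquation.form 1 u v = 0 := by simpa [hE, hJ.ne', w0] using f1.symm
      have w2 : cubicEquation.form 2 u v = 0 := by simpa [hE, hJ.ne'] using f2.symm
      rw [w0, v0, v1] at k0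
      rw [w1, v0, v1] at k1
      rw [w2, v0, v1] at k2
      have v4 : v 4 = 0 := by simpa using k2.symm
      refine ext_seven v0 v1 (by simpa using k0.symm) (by simpa using k1.symm) v4 ?_ ?_
      · simpa [hE, hJ.ne', v0, v4] using d5.symm
      · simpa [hE, hJ.ne', v0] using d6.symm
    exact ⟨hinj, (LinearMap.injective_iff_surjective.1 hinj)⟩
  pullback := fun u hu => by
    have hu : (g, u) ∈ actDom := hu
    obtain ⟨-, hu6, hJ⟩ := mem_actDom.1 hu
    have hE := hg.2.ne'
    have hJ' := hJ.ne'
    set P := (ContinuousLinearMap.precomp ℝ (fderiv ℝ (act g) u) :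
      (R7 →L[ℝ] ℝ) →L[ℝ] (R7 →L[ℝ] ℝ)).toLinearMap with hP
    have hPa : ∀ α v, P α v = α (fderiv ℝ (act g) u v) := fun _ _ => rfl
    have p0 : P (cubicEquation.form 0 (act g u)) =
        ((1 + g 3) ^ 3 / J g u) • cubicEquation.form 0 u := by
      ext v
      exact (hPa _ _).trans (form_act hu v).1
    have p1 : P (cubicEquation.form 1 (act g u)) = ((1 + g 3) ^ 3 * J g u) •
        cubicEquation.form 1 u - ((1 + g 3) ^ 3 * g 2) • cubicEquation.form 0 u := by
      ext v
      exact (hPa _ _).trans (form_act hu v).2.1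
    have p2 : P (cubicEquation.form 2 (act g u)) =
        ((1 + g 3) / J g u) • cubicEquation.form 2 u := by
      ext v
      exact (hPa _ _).trans (form_act hu v).2.2
    have hm : ∀ a, cubicEquation.form a u ∈ cubicEquation.system u := fun a =>
      Submodule.subset_span ⟨a, rfl⟩
    have hPm : ∀ a, P (cubicEquation.form a (act g u)) ∈
        (cubicEquation.system (act g u)).map P := fun a =>
      Submodule.mem_map_of_mem (Submodule.subset_span ⟨a, rfl⟩)
    apply le_antisymm
    · rw [Equation.system, Submodule.map_span_le]
      rintro _ ⟨a, rfl⟩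
      fin_cases a
      · exact p0 ▸ Submodule.smul_mem _ _ (hm 0)
      · exact p1 ▸ sub_mem (Submodule.smul_mem _ _ (hm 1)) (Submodule.smul_mem _ _ (hm 0))
      · exact p2 ▸ Submodule.smul_mem _ _ (hm 2)
    · have q0 : cubicEquation.form 0 u ∈ (cubicEquation.system (act g u)).map P := by
        have := Submodule.smul_mem _ ((1 + g 3) ^ 3 / J g u)⁻¹ (hPm 0)
        rwa [p0, inv_smul_smul₀ (div_ne_zero (pow_ne_zero 3 hE) hJ')] at this
      rw [Equation.system, Submodule.span_le]
      rintro _ ⟨a, rfl⟩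
      fin_cases a
      · exact q0
      · have := Submodule.smul_mem _ ((1 + g 3) ^ 3 * J g u)⁻¹
          (add_mem (hPm 1) (Submodule.smul_mem _ ((1 + g 3) ^ 3 * g 2) q0))
        rwa [p1, sub_add_cancel, inv_smul_smul₀ (mul_ne_zero (pow_ne_zero 3 hE) hJ')] at this
      · have := Submodule.smul_mem _ ((1 + g 3) / J g u)⁻¹ (hPm 2)
        rwa [p2, inv_smul_smul₀ (div_ne_zero hE hJ')] at this

/-- Fixing points forces polynomial identities: one quadratic in x, one affine in y, one bilinear in
x and y. Three values of x and two of y determine all coefficients. The signs of the diagonal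
entries and of the scaling are settled by positivity on `carrier`. -/
theorem eq_zero_of_act_eq {g : Fin 9 → ℝ} (hg : g ∈ carrier)
    (h : ∀ u : R7, 0 < u 0 → u 0 < 1 → 0 < u 6 → (g, u) ∈ actDom ∧ act g u = u) : g = 0 := by
  have key : ∀ x y : ℝ, 0 < x → x < 1 →
      (1 + g 0) * x + g 1 = x * (g 2 * x + d g) ∧ (1 + g 3) ^ 2 * y + g 4 = y ∧
      g 5 + g 6 * x + g 7 * y + g 8 * x * y = 0 := by
    intro x y hx0 hx1
    obtain ⟨hd, ha⟩ := h ![x, y, 0, 0, 0, 0, 1] hx0 hx1 one_pos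
    have hJ := (mem_actDom.1 hd).2.2.ne'
    obtain ⟨a0, a1, a2, -⟩ := act_apply g ![x, y, 0, 0, 0, 0, 1]
    rw [ha] at a0 a1 a2
    rw [eq_div_iff hJ] at a0 a2
    simp [J, K] at a0 a1 a2
    exact ⟨a0.symm, a1.symm, a2.symm⟩
  obtain ⟨x1, y1, z1⟩ := key (1 / 4) 0 (by norm_num) (by norm_num)
  obtain ⟨x2, y2, z2⟩ := key (1 / 2) 1 (by norm_num) (by norm_num)
  obtain ⟨x3, -, z3⟩ := key (3 / 4) 0 (by norm_num) (by norm_num)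
  obtain ⟨-, -, z4⟩ := key (1 / 2) 0 (by norm_num) (by norm_num)
  obtain ⟨-, -, z5⟩ := key (1 / 4) 1 (by norm_num) (by norm_num)
  have e := det_eq hg.1.ne'
  have g2 : g 2 = 0 := by linear_combination -8 * x1 + 16 * x2 - 8 * x3
  have g1 : g 1 = 0 := by linear_combination 3 * x1 - 3 * x2 + x3
  have hd : d g = 1 + g 0 := by
    linear_combination 4 * x1 - 4 * x2 - (3 / 4 : ℝ) * g2
  have g0 : g 0 = 0 := by
    rw [hd, g1] at e
    have : (g 0) * (1 + g 0 + 1) = 0 := by linear_combination e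
    exact (mul_eq_zero.1 this).resolve_right (by linarith [hg.1])
  have g4 : g 4 = 0 := by linear_combination y1
  have g3 : g 3 = 0 := by
    have : (g 3) * (1 + g 3 + 1) = 0 := by linear_combination y2 - g4
    exact (mul_eq_zero.1 this).resolve_right (by linarith [hg.2])
  have g6 : g 6 = 0 := by linear_combination 4 * z4 - 4 * z1
  have g5 : g 5 = 0 := by linear_combination z4 - (1 / 2 : ℝ) * g6
  have g8 : g 8 = 0 := by linear_combination 4 * z2 - 4 * z5 - g6
  have g7 : g 7 = 0 := by linear_combination z2 - g5 - (1 / 2 : ℝ) * g6 - (1 / 2 : ℝ) * g8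
  exact ext_nine g0 g1 g2 g3 g4 g5 g6 g7 g8

end CubicGroup

/-! ### The bound is attained -/

/-- The local action of `cubicGroup` on the equation manifold of `3 r t³ + 1 = 0`. -/
noncomputable def cubicAction : LocalAction cubicGroup cubicEquation.Sig where
  dom := CubicGroup.actDom
  isOpen_dom := CubicGroup.isOpen_actDom
  dom_subset := fun _ hy => ⟨hy.1, hy.2.1⟩
  zero_mem_dom := fun u hu => by
    refine CubicGroup.mem_actDom.2 ⟨cubicGroup.zero_mem, hu, ?_⟩
    rw [CubicGroup.J_zero]
    exact one_pos
  act := CubicGroup.act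
  smooth_act := CubicGroup.contDiffOn_act
  act_mem := fun _ _ h => CubicGroup.act_mem h
  zero_act := fun u _ => CubicGroup.zero_act u
  mul_act := fun _ _ _ h h' h'' => CubicGroup.act_act h'.1 h.1 h''.1.1.ne'
    (CubicGroup.mem_actDom.1 h).2.2.ne' (CubicGroup.mem_actDom.1 h').2.2.ne'
  inv_act := fun _ _ hg h => CubicGroup.inv_act hg h

theorem cubicAction_isLocallyEffective : cubicAction.IsLocallyEffective := by
  have hdom : ∀ (g : Fin 9 → ℝ) (u : R7), g ∈ CubicGroup.invDom →
      0 < (1 + g 0) * g 2 + (1 + g 1 * g 2) → 0 < u 0 → u 0 < 1 → 0 < u 6 →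
      (g, u) ∈ CubicGroup.actDom := by
    intro g u hg h h0 h1 h6
    refine ⟨hg.1, h6, ?_⟩
    have := add_pos (mul_pos h0 h) (mul_pos (sub_pos.2 h1) hg.2)
    change 0 < (1 + g 0) * (g 2 * u 0) + (1 + g 1 * g 2)
    linarith
  -- The denominator is affine in x; the two inequalities make it positive at x = 0 and x = 1. The
  -- whole strip 0 < x < 1 thus lies in the domain of every element of the chosen neighbourhood.
  refine ⟨{g | g ∈ CubicGroup.invDom ∧ 0 < (1 + g 0) * g 2 + (1 + g 1 * g 2)},
    {u | 0 < u 0 ∧ u 0 < 1 ∧ 0 < u 6}, ?_, ⟨cubicGroup.zero_mem_invDom, by simp⟩, ?_,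
    ⟨![1 / 2, 0, 0, 0, 0, 0, 1], by norm_num, by norm_num, one_pos⟩, ?_, ?_⟩
  · exact CubicGroup.isOpen_invDom.inter (isOpen_lt (f := fun _ => (0 : ℝ))
      (g := fun g : Fin 9 → ℝ => (1 + g 0) * g 2 + (1 + g 1 * g 2)) continuous_const (by fun_prop))
  · exact (isOpen_lt continuous_const (continuous_apply 0)).inter
      ((isOpen_lt (continuous_apply 0) continuous_const).inter
        (isOpen_lt continuous_const (continuous_apply 6)))
  · rintro ⟨g, u⟩ ⟨⟨hg, h⟩, h0, h1, h6⟩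
    exact hdom g u hg h h0 h1 h6
  · rintro g ⟨hg, h⟩ hact
    exact CubicGroup.eq_zero_of_act_eq hg.1 fun u h0 h1 h6 =>
      ⟨hdom g u hg h h0 h1 h6, hact u ⟨h0, h1, h6⟩⟩

theorem cubicAction_actsBySymmetries : cubicAction.ActsBySymmetries cubicEquation :=
  fun _ hg => CubicGroup.isContactSymmetry_act hg

theorem isConnected_cubicEquation_Sig : IsConnected cubicEquation.Sig := by
  refine ⟨⟨fun _ => 1, (one_pos : (0 : ℝ) < 1)⟩, Convex.isPreconnected (convex_iff_forall_pos.2 ?_)⟩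
  intro u hu v hv a b ha hb _
  have hu : 0 < u 6 := hu
  have hv : 0 < v 6 := hv
  exact add_pos (mul_pos ha hu) (mul_pos hb hv)

end ContactPDE

theorem mainTheorem1 :
    (∀ E : ContactPDE.Equation, E.IsHyperbolic → E.IsGeneric →
      ∀ U : TopologicalSpace.Opens ContactPDE.R7,
        (U : Set ContactPDE.R7) ⊆ E.Sig → IsConnected (U : Set ContactPDE.R7) →
          (Module.Finite ℝ (E.symmetryAlgebra U) ∧
            Module.finrank ℝ (E.symmetryAlgebra U) ≤ 9) ∧
          ∀ d : ℕ, E.HasSymmetryGroup U d → d ≤ 9) ∧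
    ∃ E : ContactPDE.Equation, E.IsHyperbolic ∧ E.IsGeneric ∧
      ∃ U : TopologicalSpace.Opens ContactPDE.R7,
        (U : Set ContactPDE.R7) = E.Sig ∧ IsConnected (U : Set ContactPDE.R7) ∧
        Module.finrank ℝ (E.symmetryAlgebra U) = 9 ∧ E.HasSymmetryGroup U 9 := by
  open ContactPDE in
  refine ⟨fun E hE hG U hU hconn => ?_, cubicEquation, isHyperbolic_cubicEquation,
    isGeneric_cubicEquation, ⟨cubicEquation.Sig, cubicEquation.isOpen_Sig⟩, rfl,
    isConnected_cubicEquation_Sig, ?_,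
    cubicGroup, cubicAction, cubicAction_isLocallyEffective, cubicAction_actsBySymmetries⟩
  · have hfin := Equation.finrank_symmetryAlgebra_le hE hG hU hconn
    refine ⟨hfin, fun d ⟨G, Φ, hΦ, hΦ'⟩ => ?_⟩
    have := hfin.1
    exact (Φ.le_finrank hU hΦ' hΦ).trans hfin.2
  · have hfin := Equation.finrank_symmetryAlgebra_le isHyperbolic_cubicEquation
      isGeneric_cubicEquation (U := ⟨cubicEquation.Sig, cubicEquation.isOpen_Sig⟩) subset_rfl
      isConnected_cubicEquation_Sig
    have := hfin.1
    -- The fundamental fields of the explicit group already fill nine dimensions, so no direct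
    -- computation of the symmetry algebra is required.
    exact le_antisymm hfin.2 (LocalAction.le_finrank
      (U := ⟨cubicEquation.Sig, cubicEquation.isOpen_Sig⟩) cubicAction subset_rfl
      cubicAction_actsBySymmetries cubicAction_isLocallyEffective)
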